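/- **Conventions.** For $c>0$ let $\mathbb S^{d}(c)=\{X\in\mathbb R^{d+1}:\langle X,X\rangle=1/c\}$ and let $\mathbb H^{m}(-c)$ be one sheet of $\{X\in\mathbb L^{m+1}:\langle X,X\rangle=-1/c\}$, where $\mathbb L^{m+1}$ is $\mathbb R^{m+1}$ with the Lorentz product of signature $(+,\dots,+,-)$. Put $\mathbb Q^N_c=\mathbb S^N(c)\subset\mathbb R^{N+1}$ for $c>0$ and $\mathbb Q^N_0=\mathbb R^N$; let $\epsilon=1$ if $c>0$ and $\epsilon=0$ if $c=0$. *Extrinsic products.* Let $\mathbb R^{d}=\bigoplus_{i\in I}\mathbb R^{m_i}\oplus\mathbb R^{m'}$ ($I$ finite) be an orthogonal decomposition, the last summand possibly trivial, let each $N_i$ be either $\mathbb R^{m_i}$ or a sphere $\mathbb S^{m_i-1}(c_i)\subset\mathbb R^{m_i}$ with $m_i\ge 2$, $c_i>0$, and let $v\in\mathbb R^{m'}$ be a constant vector. The map $\Psi\colon\prod_{i\in I} N_i\to\mathbb R^d$, $\Psi((x_i)_i)=((x_i)_i,v)$, is called an extrinsic product of the $N_i$. If all $N_i$ are spheres, $\Psi$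 takes values in $\mathbb S^{d-1}(c)$ with $1/c=\sum_i 1/c_i+\langle v,v\rangle$. *Stereographic projections.* A stereographic projection of the unit sphere $\mathbb S^N\subset\mathbb R^{N+1}$ onto $\mathbb R^N$ is the central projection of $\mathbb S^N\setminus\{e\}$ from a pole $e\in\mathbb S^N$ onto a hyperplane orthogonal to $e$ that does not contain $e$, this hyperplane being identified with $\mathbb R^N$ by an isometry. *The maps $\Theta$.* Let $p_0,w\in\mathbb L^{N+2}$ be light-like with $\langle p_0,w\rangle=1$ and let $A\colon\mathbb R^N\to\{p_0,w\}^\perp$ be a linear isometry; then $E(x)=p_0+A(x)-\frac12\|x\|^2w$ is an isometry of $\mathbb R^N$ onto $\{p\in\mathbb L^{N+2}:\langle p,p\rangle=0,\ \langle p,w\rangle=1\}$. Let $1\le m\le N-1$, let $\mathbb L^{N+2}=V\oplus W$ be an orthogonal decomposition with $V$ time-like and let $C\colon\mathbb L^{m+1}\to V$, $D\colon\mathbb R^{N-m+1}\to W$ be linear isometries. These data define $\Theta\colon\mathbb H^m(-c)\times\mathbb S^{N-m}(c)\to\mathbb R^N$ by $$E(\Theta(X,Y))=\frac{C(X)+D(Y)}{\langle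 C(X)+D(Y),w\rangle},$$ wherever the denominator is not zero (that is, outside of at most one point). $\Theta$ is a conformal diffeomorphism onto the complement of $E^{-1}(V)$ (an $(m-1)$-dimensional sphere or affine subspace); we call such a $\Theta$ a standard conformal diffeomorphism. **Theorem.** Let $k\ge2$ and let $M_1,\dots,M_k$ be connected Riemannian manifolds of dimensions $n_i\ge1$ with $n=n_1+\dots+n_k\ge3$. Let $f\colon M=\prod_{i=1}^kM_i\to\mathbb R^N$ be a conformal immersion of the Riemannian product whose second fundamental form is adapted to the product net, i.e. for each $i$ the subbundle $E_i\subset TM$ of the vectors tangent to the $i$-th factor is invariant under all shape operators of $f$. Then one of the following holds. (i) There are $c\ge0$, an extrinsic product $\Psi\colon\prod_{i=1}^kN_i\to\mathbb Q^N_c\subset\mathbb R^{N+\epsilon}$ (all $N_i$ being spheres if $c>0$) and isometric immersions $f_i\colon M_i\to N_i$ such that $$f=\mathcal P\circ H\circ\Psi\circ(f_1\times\dots\times f_k),$$ where $H$ is a homothety of $\mathbb R^{N+\epsilon}$ and $\mathcal P$ is, if $c>0$, a stereographic projection of $H(\mathbb Q^N_c)=\mathbb S^N$ onto $\mathbb R^N$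 and, if $c=0$, either the identity or an inversion of $\mathbb R^N$ with respect to a sphere of unit radius. (The image of $H\circ\Psi\circ(f_1\times\dots\times f_k)$ does not contain the pole of the projection or the center of the inversion.) (ii) For exactly one $j\in\{1,\dots,k\}$ there are $m$ with $1\le m\le N-1$, $c>0$, an extrinsic product of spheres $\Psi\colon\prod_{i\ne j}N_i\to\mathbb S^{N-m}(c)$, isometric immersions $f_j\colon M_j\to\mathbb H^m(-c)$ and $f_i\colon M_i\to N_i$ for $i\neq j$, and a standard conformal diffeomorphism $\Theta\colon\mathbb H^m(-c)\times\mathbb S^{N-m}(c)\to\mathbb R^N$, defined on the image of $f_j\times(\Psi\circ\prod_{i\ne j}f_i)$, such that $$f=\Theta\circ\Big(f_j\times\big(\Psi\circ\textstyle\prod_{i\neq j}f_i\big)\Big)\circ T_j,\qquad T_j(p_1,\dots,p_k)=\big(p_j,(p_i)_{i\ne j}\big).$$ -/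

import Mathlib

open scoped Manifold ContDiff

noncomputable section

/-- Euclidean space `ℝⁿ`. -/
abbrev Euc (n : ℕ) : Type := EuclideanSpace ℝ (Fin n)

/-- A smooth Riemannian metric on a manifold modelled on `ℝⁿ`. -/
abbrev RiemMetric (n : ℕ) (M : Type*) [TopologicalSpace M] [ChartedSpace (Euc n) M]
    [IsManifold (𝓡 n) ∞ M] :=
  Bundle.ContMDiffRiemannianMetric (𝓡 n) ∞ (Euc n) (fun p : M => TangentSpace (𝓡 n) p)

/-! ### Model spaces -/

/-- The Lorentz vector space `𝕃^{d+1} = ℝ^d × ℝ`, whose last coordinate is the time coordinate. -/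
abbrev Mink (d : ℕ) : Type := Euc d × ℝ

/-- The Lorentz product of signature `(+, …, +, -)`. -/
def lor {d : ℕ} (X Y : Mink d) : ℝ := inner ℝ X.1 Y.1 - X.2 * Y.2

/-- The sphere `𝕊^{d-1}(c) = {X ∈ ℝ^d : ⟨X, X⟩ = 1 / c}`. -/
def sphereCurv (d : ℕ) (c : ℝ) : Set (Euc d) := {X | inner ℝ X X = 1 / c}

/-- Hyperbolic space `ℍ^m(-c)`: one sheet of `{X ∈ 𝕃^{m+1} : ⟨X, X⟩ = -1 / c}`. -/
def hypCurv (m : ℕ) (c : ℝ) : Set (Mink m) := {X | lor X X = -1 / c ∧ 0 < X.2}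

/-! ### Isometric immersions -/

/-- `f : M → F` is an isometric immersion of the Riemannian manifold `(M, g)` into the vector space
`F` with the scalar product `B`. An isometric immersion into a submanifold `S` of `F` is such an `f`
with values in `S`. -/
def IsIsometricImmersion {n : ℕ} {M : Type*} [TopologicalSpace M] [ChartedSpace (Euc n) M]
    [IsManifold (𝓡 n) ∞ M] (g : RiemMetric n M)
    {F : Type*} [NormedAddCommGroup F] [NormedSpace ℝ F] (B : F → F → ℝ) (f : M → F) : Prop :=
  ContMDiff (𝓡 n) 𝓘(ℝ, F) ∞ f ∧
    ∀ (p : M) (u v : TangentSpace (𝓡 n) p),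
      B (mfderiv (𝓡 n) 𝓘(ℝ, F) f p u) (mfderiv (𝓡 n) 𝓘(ℝ, F) f p v) = g.inner p u v

/-! ### Conformal immersions of a Riemannian product and their second fundamental form -/

/-- The model of the product manifold `∏ i, M i`, where `M i` has dimension `n i`. The tangent space
at `p` of the product is `∏ i, T_{p i} (M i)`. -/
abbrev prodModel {k : ℕ} (n : Fin k → ℕ) :
    ModelWithCorners ℝ (∀ i, Euc (n i)) (ModelPi fun i => Euc (n i)) :=
  ModelWithCorners.pi fun i => 𝓡 (n i)

section Product

variable {k : ℕ} {n : Fin k → ℕ} {M : Fin k → Type*} [∀ i, TopologicalSpace (M i)]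
  [∀ i, ChartedSpace (Euc (n i)) (M i)]

/-- The differential of a map of the product manifold into `ℝ^N`. -/
def prodDeriv {N : ℕ} (f : (∀ i, M i) → Euc N) (p : ∀ i, M i) :
    (∀ i, TangentSpace (𝓡 (n i)) (p i)) →ₗ[ℝ] Euc N :=
  (mfderiv (prodModel n) 𝓘(ℝ, Euc N) f p :
    TangentSpace (prodModel n) p →L[ℝ] TangentSpace 𝓘(ℝ, Euc N) (f p)).toLinearMap

/-- The Riemannian product metric. -/
def prodMetric [∀ i, IsManifold (𝓡 (n i)) ∞ (M i)] (g : ∀ i, RiemMetric (n i) (M i))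
    (p : ∀ i, M i) (X Y : ∀ i, TangentSpace (𝓡 (n i)) (p i)) : ℝ :=
  ∑ i, (g i).inner (p i) (X i) (Y i)

/-- `f` is a conformal immersion of the Riemannian product `∏ i, (M i, g i)` into `ℝ^N`: the metric
it induces is `φ²` times the product metric, for a positive smooth conformal factor `φ`. -/
def IsConformalImmersion [∀ i, IsManifold (𝓡 (n i)) ∞ (M i)] (g : ∀ i, RiemMetric (n i) (M i))
    {N : ℕ} (f : (∀ i, M i) → Euc N) : Prop :=
  ContMDiff (prodModel n) 𝓘(ℝ, Euc N) ∞ f ∧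
    ∃ φ : (∀ i, M i) → ℝ, ContMDiff (prodModel n) 𝓘(ℝ, ℝ) ∞ φ ∧ (∀ p, 0 < φ p) ∧
      ∀ (p : ∀ i, M i) (X Y : ∀ i, TangentSpace (𝓡 (n i)) (p i)),
        inner ℝ (prodDeriv f p X) (prodDeriv f p Y) = φ p ^ 2 * prodMetric g p X Y

/-- The normal space of `f` at `p`. -/
def normalSpace {N : ℕ} (f : (∀ i, M i) → Euc N) (p : ∀ i, M i) : Submodule ℝ (Euc N) :=
  (LinearMap.range (prodDeriv (n := n) f p))ᗮ

/-- The second fundamental form of `f` at `p`: the normal component of the second derivative of `f`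
in the direction of the tangent vectors `X` and `Y`. The second derivative is taken in the chart at
`p`; that of another chart has the same normal component. -/
def secondFundamentalForm {N : ℕ} (f : (∀ i, M i) → Euc N) (p : ∀ i, M i)
    (X Y : ∀ i, TangentSpace (𝓡 (n i)) (p i)) : Euc N :=
  (normalSpace (n := n) f p).starProjection
    (fderiv ℝ (fderiv ℝ (f ∘ (extChartAt (prodModel n) p).symm)) (extChartAt (prodModel n) p p) X Y)

/-- The subspace `E_i(p)` of the product net: the vectors tangent to the `i`-th factor. -/
def productNet (p : ∀ i, M i) (i : Fin k) :
    Submodule ℝ (∀ i, TangentSpace (𝓡 (n i)) (p i)) where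
  carrier := {X | ∀ j, j ≠ i → X j = 0}
  add_mem' := fun {X Y} hX hY j hj => by simp [hX j hj, hY j hj]
  zero_mem' := fun _ _ => rfl
  smul_mem' := fun a X hX j hj => by simp [hX j hj]

/-- `Z = A_ξ X`, where `A_ξ` is the shape operator of `f` at `p` in the normal direction `ξ`, that
is, `⟨A_ξ X, Y⟩ = ⟨α(X, Y), ξ⟩` for all `Y`, in the metric induced by `f`. -/
def IsShapeOperatorValue {N : ℕ} (f : (∀ i, M i) → Euc N) (p : ∀ i, M i) (ξ : Euc N)
    (X Z : ∀ i, TangentSpace (𝓡 (n i)) (p i)) : Prop :=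
  ∀ Y : ∀ i, TangentSpace (𝓡 (n i)) (p i),
    inner ℝ (prodDeriv f p Z) (prodDeriv f p Y) = inner ℝ (secondFundamentalForm f p X Y) ξ

/-- The second fundamental form of `f` is adapted to the product net: every `E_i` is invariant under
all shape operators. -/
def IsAdaptedToProductNet {N : ℕ} (n : Fin k → ℕ) [∀ i, ChartedSpace (Euc (n i)) (M i)]
    (f : (∀ i, M i) → Euc N) : Prop :=
  ∀ (p : ∀ i, M i) (i : Fin k), ∀ ξ ∈ normalSpace (n := n) f p,
    ∀ X ∈ productNet (n := n) p i, ∃ Z ∈ productNet (n := n) p i, IsShapeOperatorValue f p ξ X Z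

end Product

/-! ### Extrinsic products -/

/-- An extrinsic product `Ψ : ∏ i, N i → ℝ^d`, `Ψ x = ∑ i, L i (x i) + v`. The orthogonal
decomposition of `ℝ^d` is given by isometric embeddings `L i : ℝ^{m i} → ℝ^d` with mutually
orthogonal images; the last summand, in which the constant vector `v` lies, is the orthogonal
complement of these images. Each `N i` is either `ℝ^{m i}` or a sphere in `ℝ^{m i}`, `m i ≥ 2`. -/
structure ExtrinsicProduct (ι : Type) (d : ℕ) where
  m : ι → ℕ
  L : ∀ i, Euc (m i) →ₗᵢ[ℝ] Euc d
  orth : ∀ i j, i ≠ j → ∀ x y, inner ℝ (L i x) (L j y) = 0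
  v : Euc d
  v_orth : ∀ i x, inner ℝ (L i x) v = 0
  N : ∀ i, Set (Euc (m i))
  N_eq : ∀ i, N i = Set.univ ∨ (2 ≤ m i ∧ ∃ c : ℝ, 0 < c ∧ N i = sphereCurv (m i) c)

/-- The map `Ψ`; only its values on `∏ i, N i` matter. -/
def ExtrinsicProduct.map {ι : Type} [Fintype ι] {d : ℕ} (Ψ : ExtrinsicProduct ι d)
    (x : ∀ i, Euc (Ψ.m i)) : Euc d :=
  ∑ i, Ψ.L i (x i) + Ψ.v

/-- `Ψ` is an extrinsic product of spheres with values in `𝕊^{d-1}(c)`. -/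
def ExtrinsicProduct.IsSpherical {ι : Type} [Fintype ι] {d : ℕ} (Ψ : ExtrinsicProduct ι d)
    (c : ℝ) : Prop :=
  (∀ i, 2 ≤ Ψ.m i ∧ ∃ c' : ℝ, 0 < c' ∧ Ψ.N i = sphereCurv (Ψ.m i) c') ∧
    ∀ x : ∀ i, Euc (Ψ.m i), (∀ i, x i ∈ Ψ.N i) → Ψ.map x ∈ sphereCurv d c

/-! ### Stereographic projections -/

/-- `P` is the stereographic projection of the unit sphere of `ℝ^{N+1}`, with pole `e`, onto a
hyperplane `{y : ⟨y, e⟩ = t}`, `t ≠ 1`, which is identified with `ℝ^N` by an affine isometry `J`.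
The image of `x ≠ e` is the point of the hyperplane on the line through `e` and `x`. -/
def IsStereographicProjection {N : ℕ} (e : Euc (N + 1)) (P : Euc (N + 1) → Euc N) : Prop :=
  ‖e‖ = 1 ∧ ∃ (t : ℝ) (J : Euc N →ᵃⁱ[ℝ] Euc (N + 1)), t ≠ 1 ∧
    Set.range J = {y | inner ℝ y e = t} ∧
    ∀ x : Euc (N + 1), ‖x‖ = 1 → x ≠ e →
      ∃ s : ℝ, J (P x) = AffineMap.lineMap e x s

/-! ### The conformal diffeomorphism `Θ` through the light cone -/

/-- A triple `(p₀, w, A)`: two light-like vectors of `𝕃^{N+2}` with `⟨p₀, w⟩ = 1` and a linear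
isometry `A` of `ℝ^N` onto the orthogonal complement of their span. -/
structure ConeTriple (N : ℕ) where
  p₀ : Mink (N + 1)
  w : Mink (N + 1)
  A : Euc N →ₗ[ℝ] Mink (N + 1)
  p₀_null : lor p₀ p₀ = 0
  w_null : lor w w = 0
  p₀_w : lor p₀ w = 1
  A_isom : ∀ x y, lor (A x) (A y) = inner ℝ x y
  A_p₀ : ∀ x, lor (A x) p₀ = 0
  A_w : ∀ x, lor (A x) w = 0

/-- The isometry `x ↦ p₀ + A x - ‖x‖² / 2 • w` of `ℝ^N` onto the umbilical hypersurface
`{p : ⟨p, p⟩ = 0, ⟨p, w⟩ = 1}` of the light cone. -/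
def ConeTriple.embed {N : ℕ} (τ : ConeTriple N) (x : Euc N) : Mink (N + 1) :=
  τ.p₀ + τ.A x - (‖x‖ ^ 2 / 2) • τ.w

/-- `Θ` is a standard conformal diffeomorphism `ℍ^m(-c) × 𝕊^l(c) → ℝ^N`, `m + l = N`. For an
orthogonal decomposition of `𝕃^{N+2}` given by linear isometries `C` of `𝕃^{m+1}` and `D` of
`ℝ^{l+1}` into `𝕃^{N+2}` with orthogonal images, `(X, Y) ↦ C X + D Y` takes values in the light
cone; `Θ` is its projection to `{p : ⟨p, p⟩ = 0, ⟨p, w⟩ = 1}`, followed by the identification of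
this hypersurface with `ℝ^N`. The set `dom` on which `Θ` is defined, where `⟨C X + D Y, w⟩ ≠ 0`, is
`ℍ^m(-c) × 𝕊^l(c)`, with at most one point removed (that is sent to infinity). -/
def IsTheta {N m l : ℕ} (c : ℝ) (dom : Set (Mink m × Euc (l + 1)))
    (Θ : Mink m × Euc (l + 1) → Euc N) : Prop :=
  ∃ (τ : ConeTriple N) (C : Mink m →ₗ[ℝ] Mink (N + 1)) (D : Euc (l + 1) →ₗ[ℝ] Mink (N + 1)),
    (∀ X X', lor (C X) (C X') = lor X X') ∧
    (∀ Y Y', lor (D Y) (D Y') = inner ℝ Y Y') ∧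
    (∀ X Y, lor (C X) (D Y) = 0) ∧
    dom = {Z | Z.1 ∈ hypCurv m c ∧ Z.2 ∈ sphereCurv (l + 1) c ∧ lor (C Z.1 + D Z.2) τ.w ≠ 0} ∧
    ∀ Z ∈ dom, τ.embed (Θ Z) = (lor (C Z.1 + D Z.2) τ.w)⁻¹ • (C Z.1 + D Z.2)

/-! ### The two cases of the classification -/

section Cases

variable {k N : ℕ} {n : Fin k → ℕ} {M : Fin k → Type*} [∀ i, TopologicalSpace (M i)]
  [∀ i, ChartedSpace (Euc (n i)) (M i)] [∀ i, IsManifold (𝓡 (n i)) ∞ (M i)]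

/-- `f = P ∘ H ∘ Ψ ∘ (f_1 × ⋯ × f_k)` with `Ψ : ∏ i, N i → 𝕊^N(c) ⊆ ℝ^{N+1}` an extrinsic product of
spheres, `f_i : M_i → N_i` isometric immersions, `H` a homothety of `ℝ^{N+1}` that takes `𝕊^N(c)` to
the unit sphere and `P` a stereographic projection of the unit sphere. -/
def CaseSphere (g : ∀ i, RiemMetric (n i) (M i)) (f : (∀ i, M i) → Euc N) : Prop :=
  ∃ (c : ℝ) (Ψ : ExtrinsicProduct (Fin k) (N + 1)) (h : ∀ i, M i → Euc (Ψ.m i))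
    (a : Euc (N + 1)) (r : ℝ) (e : Euc (N + 1)) (P : Euc (N + 1) → Euc N),
    0 < c ∧ Ψ.IsSpherical c ∧
    (∀ i, IsIsometricImmersion (g i) (inner ℝ) (h i) ∧ ∀ q, h i q ∈ Ψ.N i) ∧
    0 < r ∧ AffineMap.homothety a r '' sphereCurv (N + 1) c = Metric.sphere 0 1 ∧
    IsStereographicProjection e P ∧
    ∀ p, AffineMap.homothety a r (Ψ.map fun i => h i (p i)) ≠ e ∧
      f p = P (AffineMap.homothety a r (Ψ.map fun i => h i (p i)))

/-- `f = P ∘ H ∘ Ψ ∘ (f_1 × ⋯ × f_k)` with `Ψ : ∏ i, N i → ℝ^N` an extrinsic product,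
`f_i : M_i → N_i` isometric immersions, `H` a homothety of `ℝ^N` and `P` either the identity or the
inversion in a sphere of unit radius, with center `q`. -/
def CaseFlat (g : ∀ i, RiemMetric (n i) (M i)) (f : (∀ i, M i) → Euc N) : Prop :=
  ∃ (Ψ : ExtrinsicProduct (Fin k) N) (h : ∀ i, M i → Euc (Ψ.m i)) (a : Euc N) (r : ℝ),
    (∀ i, IsIsometricImmersion (g i) (inner ℝ) (h i) ∧ ∀ q, h i q ∈ Ψ.N i) ∧
    0 < r ∧
    ((∀ p, f p = AffineMap.homothety a r (Ψ.map fun i => h i (p i))) ∨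
      ∃ q : Euc N, ∀ p, AffineMap.homothety a r (Ψ.map fun i => h i (p i)) ≠ q ∧
        f p = EuclideanGeometry.inversion q 1
          (AffineMap.homothety a r (Ψ.map fun i => h i (p i))))

/-- `f = Θ ∘ (f_j × (Ψ ∘ (f_1 × ⋯ × f̂_j × ⋯ × f_k))) ∘ T_j` with `f_j : M_j → ℍ^m(-c)` and
`f_i : M_i → N_i`, `i ≠ j`, isometric immersions, `Ψ : ∏_{i ≠ j} N_i → 𝕊^l(c)`, `l = N - m`, an
extrinsic product of spheres and `Θ : ℍ^m(-c) × 𝕊^l(c) → ℝ^N` a standard conformal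
diffeomorphism. -/
def CaseTheta (g : ∀ i, RiemMetric (n i) (M i)) (f : (∀ i, M i) → Euc N) (j : Fin k) : Prop :=
  ∃ (m l : ℕ) (c : ℝ) (Ψ : ExtrinsicProduct {i : Fin k // i ≠ j} (l + 1))
    (hj : M j → Mink m) (h : ∀ i : {i : Fin k // i ≠ j}, M i → Euc (Ψ.m i))
    (dom : Set (Mink m × Euc (l + 1))) (Θ : Mink m × Euc (l + 1) → Euc N),
    1 ≤ m ∧ 1 ≤ l ∧ m + l = N ∧ 0 < c ∧ Ψ.IsSpherical c ∧
    (IsIsometricImmersion (g j) lor hj ∧ ∀ q, hj q ∈ hypCurv m c) ∧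
    (∀ i : {i : Fin k // i ≠ j},
      IsIsometricImmersion (g i) (inner ℝ) (h i) ∧ ∀ q, h i q ∈ Ψ.N i) ∧
    IsTheta c dom Θ ∧
    ∀ p, (hj (p j), Ψ.map fun i => h i (p i)) ∈ dom ∧
      f p = Θ (hj (p j), Ψ.map fun i => h i (p i))

end Cases

end

/-! The proof moves to the light cone of 𝕃^{N+2}. The map E = `τ.embed` is an isometry of ℝ^N onto
the section ⟨·, w⟩ = 1 of the cone, and a vector of the cone is orthogonal to itself and to the
tangent vectors there. Rescaling E ∘ f by a positive function therefore multiplies the induced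
metric by the square of that function. With φ the conformal factor, F = φ⁻¹ E ∘ f is an isometric
immersion of the Riemannian product, and f is recovered from F by normalising ⟨F, w⟩ to 1.

The heart of the proof is that F is a sum of maps of the single factors (`mixed_fderiv_eq_zero`,
`eq_add_sum_slice`, `exists_isSplitLift`). Take a tangent to the i-th and b tangent to the j-th
factor, i ≠ j. Adaptedness puts ∂a∂b F into the span of F and the tangent space. By the Koszul
formula, ∂a∂b F is orthogonal to the tangent space because the metric is a product. Hence ∂a∂b F =
s(a, b) F. Differentiating the orthogonality relation and using the symmetry of third derivatives
gives s(a, b)⟨e, d⟩ = s(e, b)⟨a, d⟩ for e outside the j-th factor. The choice d = e ⊥ a yields s(a,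
b) = 0. Since n ≥ 3, such an e exists, possibly after exchanging i and j. By connectedness F = F₀ +
∑ G_i, where the G_i are isometric immersions of the factors whose spans S_i are mutually
orthogonal.

The signature of the S_i now decides. If all S_i are positive definite, the component v of F₀
orthogonal to all of them is time-like. Then F lies in a section of the cone by an affine hyperplane
orthogonal to v, a round sphere, and normalising ⟨F, w⟩ is a stereographic projection
(`caseSphere`). If no S_i contains a time-like vector but some S_j contains a light-like z ≠ 0, then
z is orthogonal to all S_i and F lies in the flat section ⟨z, ·⟩ = const. Passing to the section
defined by w is a homothety or, if z and w are not proportional, an inversion up to homothety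
(`caseFlat`). If some S_j contains a time-like vector, then 𝕃^{N+2} = S_j ⊕ S_j^⊥ splits F into a
part depending only on the j-th factor and a part depending on the others. Their squared lengths add
up to zero, so both are constant. This is ℍ × 𝕊 (`caseTheta`).

For the uniqueness of j (`eq_of_caseTheta`), a presentation with hyperbolic factor j' gives a second
isometric lift F' of f. Two such lifts have the same Gram matrix. If j' ≠ j, the increments of F'
along the j-th factor lie in a Euclidean space, so S_j could not contain a time-like vector. -/

open scoped Manifold ContDiff

noncomputable section

open Filter Topology

set_option linter.unusedSectionVars false

/-! ### Vanishing of mixed second derivatives at a point -/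

section LocalSplitting

variable {ι : Type*} [Fintype ι] {E : ι → Type*} [∀ i, NormedAddCommGroup (E i)]
  [∀ i, NormedSpace ℝ (E i)] {V L : Type*} [NormedAddCommGroup V] [NormedSpace ℝ V]
  [NormedAddCommGroup L] [NormedSpace ℝ L]

/-- The derivative of the scalar product of two vector-valued maps. -/
theorem hasFDerivAt_bilin (B : L →L[ℝ] L →L[ℝ] ℝ) {P Q : V → L} {P' Q' : V →L[ℝ] L} {y : V}
    (hP : HasFDerivAt P P' y) (hQ : HasFDerivAt Q Q' y) :
    ∃ D : V →L[ℝ] ℝ, HasFDerivAt (fun y => B (P y) (Q y)) D y ∧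
      ∀ v, D v = B (P y) (Q' v) + B (P' v) (Q y) :=
  ⟨_, B.hasFDerivAt_of_bilinear hP hQ, fun v => by simp⟩

theorem hasFDerivAt_fderiv_apply {U : V → L} {y : V} (hU : ContDiffAt ℝ 2 U y) (a : V) :
    HasFDerivAt (fun y => fderiv ℝ U y a) ((fderiv ℝ (fderiv ℝ U) y).flip a) y := by
  have h : DifferentiableAt ℝ (fderiv ℝ U) y :=
    (hU.fderiv_right (m := 1) (by norm_num)).differentiableAt (by norm_num)
  have := h.hasFDerivAt.clm_apply (hasFDerivAt_const a y)
  convert this using 1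
  ext v
  simp

theorem hasFDerivAt_fderiv_fderiv_apply {U : V → L} {y : V} (hU : ContDiffAt ℝ 3 U y) (a b : V) :
    ∃ D : V →L[ℝ] L, HasFDerivAt (fun y => fderiv ℝ (fderiv ℝ U) y a b) D y ∧
      ∀ v, D v = fderiv ℝ (fderiv ℝ (fderiv ℝ U)) y v a b := by
  have h : DifferentiableAt ℝ (fderiv ℝ (fderiv ℝ U)) y :=
    ((hU.fderiv_right (m := 2) (by norm_num)).fderiv_right (m := 1)
      (by norm_num)).differentiableAt (by norm_num)
  exact ⟨_, (h.hasFDerivAt.clm_apply (hasFDerivAt_const a y)).clm_apply (hasFDerivAt_const b y),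
    fun v => by simp⟩

theorem fderiv_fderiv_symm {U : V → L} {y : V} (hU : ContDiffAt ℝ 2 U y) (a b : V) :
    fderiv ℝ (fderiv ℝ U) y a b = fderiv ℝ (fderiv ℝ U) y b a :=
  (hU.isSymmSndFDerivAt (by simp)) a b

/-- The Koszul formula for constant vector fields. -/
theorem koszul (B : L →L[ℝ] L →L[ℝ] ℝ) (hB : ∀ x y, B x y = B y x) {U : V → L} {y : V}
    (hU : ContDiffAt ℝ 2 U y) (a b d : V)
    (h1 : fderiv ℝ (fun y => B (fderiv ℝ U y b) (fderiv ℝ U y d)) y a = 0)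
    (h2 : fderiv ℝ (fun y => B (fderiv ℝ U y a) (fderiv ℝ U y d)) y b = 0)
    (h3 : fderiv ℝ (fun y => B (fderiv ℝ U y a) (fderiv ℝ U y b)) y d = 0) :
    B (fderiv ℝ (fderiv ℝ U) y a b) (fderiv ℝ U y d) = 0 := by
  have key : ∀ p q e, fderiv ℝ (fun y => B (fderiv ℝ U y p) (fderiv ℝ U y q)) y e =
      B (fderiv ℝ U y p) (fderiv ℝ (fderiv ℝ U) y e q) +
        B (fderiv ℝ (fderiv ℝ U) y e p) (fderiv ℝ U y q) := by
    intro p q e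
    obtain ⟨D, hD, hD'⟩ := hasFDerivAt_bilin B (hasFDerivAt_fderiv_apply hU p)
      (hasFDerivAt_fderiv_apply hU q)
    rw [hD.fderiv, hD']
    rfl
  -- In `h1 + h2 - h3` all terms cancel by symmetry except twice the one sought.
  rw [key] at h1 h2 h3
  have s := fderiv_fderiv_symm hU
  rw [s b a, hB (fderiv ℝ U y a)] at h2
  rw [s d b, s d a, hB (fderiv ℝ U y a)] at h3
  rw [hB (fderiv ℝ U y b)] at h1
  linarith

/-- A function that locally depends only on the `i`-th coordinate is constant to first order in
the other directions. -/
theorem fderiv_eq_zero_of_eventually_coord {K : (∀ i, E i) → ℝ} {y : ∀ i, E i}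
    (hK : DifferentiableAt ℝ K y) (i : ι) (h : E i → ℝ) (hh : ∀ᶠ z in 𝓝 y, K z = h (z i))
    (v : ∀ i, E i) (hv : v i = 0) : fderiv ℝ K y v = 0 := by
  have h1 : HasDerivAt (fun t : ℝ => K (y + t • v)) (fderiv ℝ K y v) 0 := by
    simpa [HasLineDerivAt] using hK.hasFDerivAt.hasLineDerivAt v
  have h2 : (fun t : ℝ => K (y + t • v)) =ᶠ[𝓝 0] fun _ => h (y i) := by
    have hc : Tendsto (fun t : ℝ => y + t • v) (𝓝 0) (𝓝 y) := by
      have : Continuous fun t : ℝ => y + t • v := by fun_prop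
      simpa using this.tendsto 0
    filter_upwards [hc.eventually hh] with t ht
    rw [ht]; simp [hv]
  exact h1.unique ((hasDerivAt_const (0 : ℝ) (h (y i))).congr_of_eventuallyEq h2)

variable [DecidableEq ι]

/-- In an isometric map of a product metric, mixed second derivatives have no tangential
component. -/
theorem mixed_fderiv_orthogonal (B : L →L[ℝ] L →L[ℝ] ℝ) (hB : ∀ x y, B x y = B y x)
    {U : (∀ i, E i) → L} {c : ∀ i, E i} (hU : ContDiffAt ℝ 2 U c)
    (orth : ∀ᶠ y in 𝓝 c, ∀ i j, i ≠ j → ∀ a b,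
      B (fderiv ℝ U y (Pi.single i a)) (fderiv ℝ U y (Pi.single j b)) = 0)
    (diag : ∀ i, ∃ h : E i → E i → E i → ℝ, ∀ᶠ y in 𝓝 c, ∀ a b,
      B (fderiv ℝ U y (Pi.single i a)) (fderiv ℝ U y (Pi.single i b)) = h (y i) a b)
    {i j : ι} (hij : i ≠ j) (a : E i) (b : E j) (d : ∀ i, E i) :
    B (fderiv ℝ (fderiv ℝ U) c (Pi.single i a) (Pi.single j b)) (fderiv ℝ U c d) = 0 := by
  have hdiff : ∀ p q, DifferentiableAt ℝ (fun y => B (fderiv ℝ U y p) (fderiv ℝ U y q)) c := by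
    intro p q
    obtain ⟨D, hD, -⟩ := hasFDerivAt_bilin B (hasFDerivAt_fderiv_apply hU p)
      (hasFDerivAt_fderiv_apply hU q)
    exact hD.differentiableAt
  -- A metric coefficient between distinct factors vanishes near `c`; one inside the factor `p` does
  -- not vary in the direction of another factor `r`. Each of the three Koszul terms is of one of
  -- these kinds.
  have key : ∀ (p q r : ι) (x : E p) (y : E q) (z : E r), (p ≠ q ∨ r ≠ p) →
      fderiv ℝ (fun w => B (fderiv ℝ U w (Pi.single p x)) (fderiv ℝ U w (Pi.single q y))) c
        (Pi.single r z) = 0 := by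
    intro p q r x y z hpq
    by_cases h : p = q
    · subst h
      have hr : r ≠ p := by tauto
      obtain ⟨h, hh⟩ := diag p
      refine fderiv_eq_zero_of_eventually_coord (hdiff _ _) p (fun w => h w x y) ?_ _ ?_
      · filter_upwards [hh] with w hw using hw x y
      · simp [Pi.single_eq_of_ne hr.symm]
    · have : (fun w => B (fderiv ℝ U w (Pi.single p x)) (fderiv ℝ U w (Pi.single q y)))
          =ᶠ[𝓝 c] fun _ => 0 := by
        filter_upwards [orth] with w hw using hw p q h x y
      rw [this.fderiv_eq]
      simp
  have hsingle : ∀ l (e : E l), B (fderiv ℝ (fderiv ℝ U) c (Pi.single i a) (Pi.single j b))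
      (fderiv ℝ U c (Pi.single l e)) = 0 := by
    intro l e
    refine koszul B hB hU _ _ _ (key _ _ _ _ _ _ ?_) (key _ _ _ _ _ _ ?_)
      (key _ _ _ _ _ _ (Or.inl hij))
    · exact Or.inr hij
    · exact Or.inr hij.symm
  rw [← Finset.univ_sum_single d, map_sum, map_sum]
  exact Finset.sum_eq_zero fun l _ => hsingle l (d l)

/-- Mixed second derivatives vanish for an isometric map of a product into the light cone whose
mixed second derivatives lie in the span of the position vector and the tangent space. -/
theorem mixed_fderiv_eq_zero (B : L →L[ℝ] L →L[ℝ] ℝ) (hB : ∀ x y, B x y = B y x)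
    {U : (∀ i, E i) → L} {c : ∀ i, E i} (hU : ContDiffAt ℝ ∞ U c)
    (orth : ∀ᶠ y in 𝓝 c, ∀ i j, i ≠ j → ∀ a b,
      B (fderiv ℝ U y (Pi.single i a)) (fderiv ℝ U y (Pi.single j b)) = 0)
    (diag : ∀ i, ∃ h : E i → E i → E i → ℝ, ∀ᶠ y in 𝓝 c, ∀ a b,
      B (fderiv ℝ U y (Pi.single i a)) (fderiv ℝ U y (Pi.single i b)) = h (y i) a b)
    (null : ∀ᶠ y in 𝓝 c, B (U y) (U y) = 0)
    (pos : ∀ v, v ≠ 0 → 0 < B (fderiv ℝ U c v) (fderiv ℝ U c v))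
    (mix : ∀ i j, i ≠ j → ∀ (a : E i) (b : E j), ∃ (s : ℝ) (Z : ∀ i, E i),
      fderiv ℝ (fderiv ℝ U) c (Pi.single i a) (Pi.single j b) = s • U c + fderiv ℝ U c Z)
    {i j : ι} (hij : i ≠ j)
    (dim : (∃ l, l ≠ i ∧ l ≠ j ∧ Nontrivial (E l)) ∨
      (∀ a : E i, ∃ e : E i, e ≠ 0 ∧
        B (fderiv ℝ U c (Pi.single i a)) (fderiv ℝ U c (Pi.single i e)) = 0) ∨
      (∀ a : E j, ∃ e : E j, e ≠ 0 ∧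
        B (fderiv ℝ U c (Pi.single j a)) (fderiv ℝ U c (Pi.single j e)) = 0))
    (a : E i) (b : E j) :
    fderiv ℝ (fderiv ℝ U) c (Pi.single i a) (Pi.single j b) = 0 := by
  have hU3 : ContDiffAt ℝ 3 U c := contDiffAt_infty.1 hU 3
  have hU2 : ContDiffAt ℝ 2 U c := contDiffAt_infty.1 hU 2
  have hU2e : ∀ᶠ y in 𝓝 c, ContDiffAt ℝ 2 U y := hU2.eventually (by simp)
  -- Differentiating ⟨U, U⟩ = 0 once, and then a second time in `hnn`.
  have hnt : ∀ᶠ y in 𝓝 c, ∀ v, B (U y) (fderiv ℝ U y v) = 0 := by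
    filter_upwards [null.eventually_nhds, hU2e] with y hy hUy v
    have hd := (hUy.differentiableAt (by norm_num)).hasFDerivAt
    obtain ⟨D, hD, hD'⟩ := hasFDerivAt_bilin B hd hd
    have h0 : D = 0 := hD.unique ((hasFDerivAt_const (0 : ℝ) y).congr_of_eventuallyEq hy)
    have := hD' v
    rw [h0, hB (fderiv ℝ U y v)] at this
    simp only [_root_.zero_apply] at this
    linarith
  have hnn : ∀ v w, B (U c) (fderiv ℝ (fderiv ℝ U) c v w) =
      - B (fderiv ℝ U c v) (fderiv ℝ U c w) := by
    intro v w
    obtain ⟨D, hD, hD'⟩ := hasFDerivAt_bilin B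
      (hU2.differentiableAt (by norm_num)).hasFDerivAt (hasFDerivAt_fderiv_apply hU2 w)
    have h0 : D = 0 := hD.unique ((hasFDerivAt_const (0 : ℝ) c).congr_of_eventuallyEq
      (by filter_upwards [hnt] with y hy using hy w))
    have := hD' v
    rw [h0] at this
    simp only [_root_.zero_apply, ContinuousLinearMap.flip_apply] at this
    linarith
  have hort : ∀ᶠ y in 𝓝 c, ∀ i j, i ≠ j → ∀ (a : E i) (b : E j) d,
      B (fderiv ℝ (fderiv ℝ U) y (Pi.single i a) (Pi.single j b)) (fderiv ℝ U y d) = 0 := by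
    choose h hh using diag
    filter_upwards [hU2e, orth.eventually_nhds, (eventually_all.2 hh).eventually_nhds]
      with y h1 h2 h3 i j hij a b d
    exact mixed_fderiv_orthogonal B hB h1 h2 (fun i => ⟨h i, h3.mono fun z hz => hz i⟩) hij a b d
  -- The tangential part `Z` of the mixed derivative is orthogonal to the tangent space, in
  -- particular to itself, hence zero by `pos`. Only a multiple of the position vector remains.
  have hmix : ∀ i j, i ≠ j → ∀ (a : E i) (b : E j), ∃ s : ℝ,
      fderiv ℝ (fderiv ℝ U) c (Pi.single i a) (Pi.single j b) = s • U c := by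
    intro i j hij a b
    obtain ⟨s, Z, hZ⟩ := mix i j hij a b
    refine ⟨s, ?_⟩
    have h1 := hort.self_of_nhds i j hij a b Z
    rw [hZ] at h1
    simp only [map_add, map_smul, _root_.add_apply, _root_.smul_apply,
      hnt.self_of_nhds Z, smul_zero, zero_add] at h1
    have : Z = 0 := by
      by_contra hne
      exact (pos Z hne).ne' h1
    rw [hZ, this]; simp
  -- The derivative of the orthogonality relation `hort`.
  have hdiff : ∀ i j, i ≠ j → ∀ (a : E i) (b : E j) (e d : ∀ i, E i),
      B (fderiv ℝ (fderiv ℝ (fderiv ℝ U)) c e (Pi.single i a) (Pi.single j b)) (fderiv ℝ U c d) =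
      - B (fderiv ℝ (fderiv ℝ U) c (Pi.single i a) (Pi.single j b))
          (fderiv ℝ (fderiv ℝ U) c e d) := by
    intro i j hij a b e d
    obtain ⟨D₀, hD₀, hD₀'⟩ := hasFDerivAt_fderiv_fderiv_apply hU3 (Pi.single i a) (Pi.single j b)
    obtain ⟨D, hD, hD'⟩ := hasFDerivAt_bilin B hD₀ (hasFDerivAt_fderiv_apply hU2 d)
    have h0 : D = 0 := hD.unique ((hasFDerivAt_const (0 : ℝ) c).congr_of_eventuallyEq
      (by filter_upwards [hort] with y hy using hy i j hij a b d))
    have := hD' e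
    rw [h0, hD₀'] at this
    simp only [_root_.zero_apply, ContinuousLinearMap.flip_apply] at this
    linarith
  have hsym3 : ∀ e a b, fderiv ℝ (fderiv ℝ (fderiv ℝ U)) c e a b =
      fderiv ℝ (fderiv ℝ (fderiv ℝ U)) c a e b := by
    intro e a b
    have h2 : ContDiffAt ℝ 2 (fderiv ℝ U) c := hU3.fderiv_right (by norm_num)
    rw [fderiv_fderiv_symm h2]
  -- With ∂a∂b U = s U and ∂e∂b U = t U, `hdiff` and `hnn` evaluate ⟨∂e∂a∂b U, ∂e U⟩ in two ways, as
  -- s⟨∂e U, ∂e U⟩ and as t⟨∂a U, ∂e U⟩ = 0. Here `l = i` is allowed; only the factor `j` is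
  -- excluded for `e`.
  have main : ∀ i l j, i ≠ j → l ≠ j → ∀ (a : E i) (e : E l) (b : E j), e ≠ 0 →
      B (fderiv ℝ U c (Pi.single i a)) (fderiv ℝ U c (Pi.single l e)) = 0 →
      fderiv ℝ (fderiv ℝ U) c (Pi.single i a) (Pi.single j b) = 0 := by
    intro i l j hij hlj a e b he hae
    obtain ⟨s, hs⟩ := hmix i j hij a b
    obtain ⟨t, ht⟩ := hmix l j hlj e b
    have h1 := hdiff i j hij a b (Pi.single l e) (Pi.single l e)
    have h2 := hdiff l j hlj e b (Pi.single i a) (Pi.single l e)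
    rw [hsym3, h2, hs, ht] at h1
    simp only [map_smul, _root_.smul_apply, hnn, hae, smul_eq_mul] at h1
    have hp := pos (Pi.single l e) (by simpa using he)
    have : s = 0 := by
      have : s * B (fderiv ℝ U c (Pi.single l e)) (fderiv ℝ U c (Pi.single l e)) = 0 := by
        linarith
      exact (mul_eq_zero.1 this).resolve_right hp.ne'
    rw [hs, this, zero_smul]
  -- The auxiliary direction lies in a third factor, in the factor `i`, or, after exchanging the
  -- roles of `a` and `b`, in the factor `j`.
  rcases dim with ⟨l, hli, hlj, hl⟩ | h | h
  · obtain ⟨e, he⟩ := exists_ne (0 : E l)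
    exact main i l j hij hlj a e b he (orth.self_of_nhds i l hli.symm a e)
  · obtain ⟨e, he, hae⟩ := h a
    exact main i i j hij hij a e b he hae
  · obtain ⟨e, he, hae⟩ := h b
    rw [fderiv_fderiv_symm hU2]
    exact main j j i hij.symm hij.symm b e a he hae

end LocalSplitting

/-! ### Maps with zero differential; differentials in preferred charts -/

section Constant

variable {n : ℕ} {M : Type*} [TopologicalSpace M] [ChartedSpace (Euc n) M]
  {V : Type*} [NormedAddCommGroup V] [NormedSpace ℝ V]

/-- A map with vanishing differential on a connected manifold is constant. -/
theorem eq_of_hasMFDerivAt_zero [IsManifold (𝓡 n) 1 M] [ConnectedSpace M] {g : M → V}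
    (hg : ∀ x, HasMFDerivAt (𝓡 n) 𝓘(ℝ, V) g x 0) (x y : M) : g x = g y := by
  suffices h : IsLocallyConstant g from
    h.apply_eq_of_isPreconnected isPreconnected_univ trivial trivial
  rw [IsLocallyConstant.iff_eventually_eq]
  intro x
  set e := extChartAt (𝓡 n) x
  have hopen : IsOpen e.target := isOpen_extChartAt_target x
  obtain ⟨r, hr, hball⟩ := Metric.isOpen_iff.1 hopen (e x) (mem_extChartAt_target x)
  have hder : ∀ z ∈ Metric.ball (e x) r, HasFDerivAt (g ∘ e.symm) (0 : Euc n →L[ℝ] V) z := by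
    intro z hz
    have hz' := hball hz
    have h1 : MDifferentiableAt 𝓘(ℝ, Euc n) (𝓡 n) e.symm z :=
      (contMDiffOn_extChartAt_symm (n := 1) x).contMDiffAt (hopen.mem_nhds hz') |>.mdifferentiableAt
        (by simp)
    have h2 := (hg (e.symm z)).comp z h1.hasMFDerivAt
    rw [hasMFDerivAt_iff_hasFDerivAt] at h2
    exact HasFDerivAt.congr_fderiv h2 (by ext1 v; rfl)
  have hconst : ∀ z ∈ Metric.ball (e x) r, (g ∘ e.symm) z = (g ∘ e.symm) (e x) := by
    intro z hz
    exact (convex_ball (e x) r).is_const_of_fderivWithin_eq_zero (𝕜 := ℝ)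
      (fun w hw => (hder w hw).differentiableAt.differentiableWithinAt)
      (fun w hw => by
        rw [fderivWithin_of_isOpen Metric.isOpen_ball hw, (hder w hw).fderiv])
      hz (Metric.mem_ball_self hr)
  have hcont : ContinuousAt e x := continuousAt_extChartAt x
  filter_upwards [hcont (Metric.ball_mem_nhds _ hr), extChartAt_source_mem_nhds (I := 𝓡 n) x]
    with y hy hys
  have := hconst (e y) hy
  simp only [Function.comp, e.left_inv hys, e.left_inv (mem_extChartAt_source x)] at this
  exact this

/-- The differential of `g` at `x`, computed in the preferred chart at `x`. -/
def chartDeriv (n : ℕ) [ChartedSpace (Euc n) M] (g : M → V) (x : M) : Euc n →L[ℝ] V :=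
  fderiv ℝ (g ∘ (extChartAt (𝓡 n) x).symm) (extChartAt (𝓡 n) x x)

theorem hasFDerivAt_of_hasMFDerivAt {g : M → V} {x : M} {D : Euc n →L[ℝ] V}
    (hg : HasMFDerivAt (𝓡 n) 𝓘(ℝ, V) g x D) :
    HasFDerivAt (g ∘ (extChartAt (𝓡 n) x).symm) D (extChartAt (𝓡 n) x x) := by
  have h1 : HasFDerivWithinAt (g ∘ (extChartAt (𝓡 n) x).symm) D
      (Set.range (𝓡 n)) (extChartAt (𝓡 n) x x) := hg.2
  have hr : Set.range (𝓡 n) = Set.univ := by simp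
  rwa [hr, hasFDerivWithinAt_univ] at h1

theorem chartDeriv_eq {g : M → V} {x : M} {D : Euc n →L[ℝ] V}
    (hg : HasMFDerivAt (𝓡 n) 𝓘(ℝ, V) g x D) : chartDeriv n g x = D :=
  (hasFDerivAt_of_hasMFDerivAt hg).fderiv

theorem hasMFDerivAt_chartDeriv {g : M → V} {x : M}
    (hg : MDifferentiableAt (𝓡 n) 𝓘(ℝ, V) g x) :
    HasMFDerivAt (𝓡 n) 𝓘(ℝ, V) g x (chartDeriv (V := V) n g x) := by
  have h := chartDeriv_eq (n := n) (g := g) (x := x)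
    (D := show Euc n →L[ℝ] V from mfderiv (𝓡 n) 𝓘(ℝ, V) g x) hg.hasMFDerivAt
  rw [h]
  exact hg.hasMFDerivAt

theorem mfderiv_apply_eq_chartDeriv {g : M → V} {x : M}
    (hg : MDifferentiableAt (𝓡 n) 𝓘(ℝ, V) g x) (X : TangentSpace (𝓡 n) x) :
    mfderiv (𝓡 n) 𝓘(ℝ, V) g x X = chartDeriv n g x X :=
  congrArg (fun D : Euc n →L[ℝ] V => D X) (hasMFDerivAt_chartDeriv hg).mfderiv

/-- The differential of the inverse of the preferred chart at `x`, with the tangent spaces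
identified with `ℝⁿ`. -/
def chartFrame (n : ℕ) [ChartedSpace (Euc n) M] (x : M) (z : Euc n) : Euc n →L[ℝ] Euc n :=
  show Euc n →L[ℝ] Euc n from mfderiv 𝓘(ℝ, Euc n) (𝓡 n) (extChartAt (𝓡 n) x).symm z

end Constant

/-! ### Product charts and restrictions to the factors -/

section Product

variable {k : ℕ} {n : Fin k → ℕ} {M : Fin k → Type*} [∀ i, TopologicalSpace (M i)]
  [∀ i, ChartedSpace (Euc (n i)) (M i)] {V : Type*}

/-- The inverse of the product of the preferred charts at the components of `p`. -/
def coordMap (p : ∀ i, M i) (y : ∀ i, Euc (n i)) : ∀ i, M i :=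
  fun i => (extChartAt (𝓡 (n i)) (p i)).symm (y i)

/-- The coordinates of `p` in the product of the preferred charts at its components. -/
def coordCenter (p : ∀ i, M i) : ∀ i, Euc (n i) := fun i => extChartAt (𝓡 (n i)) (p i) (p i)

variable [NormedAddCommGroup V] [NormedSpace ℝ V]

/-- Smoothness at the centres of the product charts. -/
def SmoothInCharts (n : Fin k → ℕ) [∀ i, ChartedSpace (Euc (n i)) (M i)]
    (F : (∀ i, M i) → V) : Prop :=
  ∀ p, ContDiffAt ℝ ∞ (F ∘ coordMap (n := n) p) (coordCenter p)

theorem range_prodModel : Set.range (prodModel n) = Set.univ :=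
  Set.range_eq_univ.2 fun y => ⟨y, rfl⟩

theorem coordMap_coordCenter (p : ∀ i, M i) : coordMap (n := n) p (coordCenter p) = p := by
  funext i
  simp [coordMap, coordCenter]

theorem smoothInCharts_of_contMDiff {F : (∀ i, M i) → V}
    (hF : ContMDiff (prodModel n) 𝓘(ℝ, V) ∞ F) : SmoothInCharts n F := by
  intro p
  have h := (contMDiffAt_iff.1 (hF p)).2
  rw [range_prodModel, contDiffWithinAt_univ] at h
  -- The preferred chart of the product manifold at `p` is by definition the product of the
  -- preferred charts, so its inverse is `coordMap p`.
  exact h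

theorem prodDeriv_apply {N : ℕ} {f : (∀ i, M i) → Euc N}
    (hf : ContMDiff (prodModel n) 𝓘(ℝ, Euc N) ∞ f) (p : ∀ i, M i)
    (X : ∀ i, TangentSpace (𝓡 (n i)) (p i)) :
    prodDeriv f p X = fderiv ℝ (f ∘ coordMap (n := n) p) (coordCenter p) X := by
  have h : MDifferentiableAt (prodModel n) 𝓘(ℝ, Euc N) f p := (hf p).mdifferentiableAt (by simp)
  have h2 : HasFDerivWithinAt (f ∘ coordMap (n := n) p)
      (show (∀ i, Euc (n i)) →L[ℝ] Euc N from mfderiv (prodModel n) 𝓘(ℝ, Euc N) f p)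
      (Set.range (prodModel n)) (coordCenter p) := h.hasMFDerivAt.2
  rw [range_prodModel, hasFDerivWithinAt_univ] at h2
  exact congrArg (fun D : (∀ i, Euc (n i)) →L[ℝ] Euc N => D X) h2.fderiv.symm

theorem coordMap_update (p : ∀ i, M i) (y : ∀ i, Euc (n i)) (i : Fin k) (t : Euc (n i)) :
    coordMap p (Function.update y i t) =
      Function.update (coordMap p y) i ((extChartAt (𝓡 (n i)) (p i)).symm t) := by
  funext j
  by_cases h : j = i
  · subst h; simp [coordMap]
  · simp [coordMap, h]

theorem hasFDerivAt_update_coord {E : Fin k → Type*} [∀ i, NormedAddCommGroup (E i)]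
    [∀ i, NormedSpace ℝ (E i)] (y : ∀ i, E i) (i : Fin k) (t : E i) :
    HasFDerivAt (Function.update y i) (ContinuousLinearMap.single ℝ E i) t := by
  convert hasFDerivAt_update (𝕜 := ℝ) y t using 1
  ext v j
  by_cases h : j = i
  · subst h; simp
  · simp [h]

/-- The restriction of a map of a product to the `i`-th factor through `p`. -/
def slice (F : (∀ i, M i) → V) (p : ∀ i, M i) (i : Fin k) : M i → V :=
  fun x => F (Function.update p i x)

/-- Smoothness of `F` is recorded only at the centres of product charts. The base point is therefore
moved to `Function.update p i x`, whose chart is centred where the slice is to be differentiated. -/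
theorem slice_comp_symm (F : (∀ i, M i) → V) (p : ∀ i, M i) (i : Fin k) (x : M i) :
    slice F p i ∘ (extChartAt (𝓡 (n i)) x).symm =
      (F ∘ coordMap (n := n) (Function.update p i x)) ∘
        Function.update (coordCenter (Function.update p i x)) i := by
  funext t
  simp only [slice, Function.comp, coordMap_update, coordMap_coordCenter, Function.update_idem,
    Function.update_self]

theorem update_coordCenter (p : ∀ i, M i) (i : Fin k) (x : M i) :
    Function.update (coordCenter (n := n) (Function.update p i x)) i (extChartAt (𝓡 (n i)) x x) =
      coordCenter (Function.update p i x) := by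
  funext j
  by_cases h : j = i
  · subst h; simp [coordCenter]
  · simp [h]

theorem slice_update (F : (∀ i, M i) → V) (p : ∀ i, M i) (i : Fin k) (x : M i) :
    slice F (Function.update p i x) i = slice F p i := by
  funext y
  simp [slice]

theorem slice_eventuallyEq (F : (∀ i, M i) → V) (p : ∀ i, M i) (i : Fin k) :
    slice F p i =ᶠ[𝓝 (p i)] ((F ∘ coordMap (n := n) p) ∘ Function.update (coordCenter p) i) ∘
      extChartAt (𝓡 (n i)) (p i) := by
  filter_upwards [extChartAt_source_mem_nhds (I := 𝓡 (n i)) (p i)] with y hy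
  have h := congrFun (slice_comp_symm (n := n) F p i (p i)) (extChartAt (𝓡 (n i)) (p i) y)
  rw [Function.update_eq_self] at h
  simpa only [Function.comp, (extChartAt (𝓡 (n i)) (p i)).left_inv hy] using h

theorem contDiffAt_comp_update {F : (∀ i, M i) → V} (hF : SmoothInCharts n F) (p : ∀ i, M i)
    (i : Fin k) :
    ContDiffAt ℝ ∞ ((F ∘ coordMap (n := n) p) ∘ Function.update (coordCenter p) i)
      (extChartAt (𝓡 (n i)) (p i) (p i)) := by
  have h := hF p
  have e : Function.update (coordCenter (n := n) p) i (extChartAt (𝓡 (n i)) (p i) (p i)) =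
      coordCenter p := Function.update_eq_self i _
  rw [← e] at h
  refine h.comp _ ?_
  exact (contDiff_update ∞ (coordCenter p) i).contDiffAt

theorem contMDiff_slice [∀ i, IsManifold (𝓡 (n i)) ∞ (M i)] {F : (∀ i, M i) → V}
    (hF : SmoothInCharts n F) (p : ∀ i, M i) (i : Fin k) :
    ContMDiff (𝓡 (n i)) 𝓘(ℝ, V) ∞ (slice F p i) := by
  intro x
  -- It suffices to treat the slice through `q` at the point `q i`: by `slice_update` the slice
  -- through `p` is also the slice through `Function.update p i x`.
  have key : ∀ q : ∀ i, M i, ContMDiffAt (𝓡 (n i)) 𝓘(ℝ, V) ∞ (slice F q i) (q i) := by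
    intro q
    refine ContMDiffAt.congr_of_eventuallyEq ?_ (slice_eventuallyEq (n := n) F q i)
    exact (contDiffAt_comp_update hF q i).contMDiffAt.comp (q i) contMDiffAt_extChartAt
  have h := key (Function.update p i x)
  rw [slice_update] at h
  simpa using h

theorem chartDeriv_slice [∀ i, IsManifold (𝓡 (n i)) ∞ (M i)] {F : (∀ i, M i) → V}
    (hF : SmoothInCharts n F) (p : ∀ i, M i) (i : Fin k) (X : Euc (n i)) :
    chartDeriv (n i) (slice F p i) (p i) X =
      fderiv ℝ (F ∘ coordMap (n := n) p) (coordCenter p) (Pi.single i X) := by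
  have e := slice_comp_symm (n := n) F p i (p i)
  rw [Function.update_eq_self] at e
  have h2 : HasFDerivAt ((F ∘ coordMap (n := n) p) ∘ Function.update (coordCenter p) i)
      ((fderiv ℝ (F ∘ coordMap (n := n) p) (coordCenter p)).comp
        (ContinuousLinearMap.single ℝ (fun i => Euc (n i)) i))
      (extChartAt (𝓡 (n i)) (p i) (p i)) := by
    refine HasFDerivAt.comp _ ?_ (hasFDerivAt_update_coord _ _ _)
    have : Function.update (coordCenter (n := n) p) i (extChartAt (𝓡 (n i)) (p i) (p i)) =
      coordCenter p := Function.update_eq_self i _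
    rw [this]
    exact ((hF p).differentiableAt (by simp)).hasFDerivAt
  rw [chartDeriv, e, h2.fderiv]
  rfl

/-- The partial derivatives in a product chart in terms of differentials of slices. -/
theorem fderiv_comp_coordMap [∀ i, IsManifold (𝓡 (n i)) ∞ (M i)] {F : (∀ i, M i) → V}
    (hF : SmoothInCharts n F) (p : ∀ i, M i) (y : ∀ i, Euc (n i))
    (hy : ∀ i, y i ∈ (extChartAt (𝓡 (n i)) (p i)).target)
    (hd : DifferentiableAt ℝ (F ∘ coordMap (n := n) p) y) (i : Fin k) (a : Euc (n i)) :
    fderiv ℝ (F ∘ coordMap (n := n) p) y (Pi.single i a) =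
      chartDeriv (n i) (slice F (coordMap p y) i) (coordMap p y i)
        (chartFrame (n i) (p i) (y i) a) := by
  have e : (F ∘ coordMap (n := n) p) ∘ Function.update y i =
      slice F (coordMap p y) i ∘ (extChartAt (𝓡 (n i)) (p i)).symm := by
    funext t
    simp only [slice, Function.comp, coordMap_update]
  have h1 : HasFDerivAt ((F ∘ coordMap (n := n) p) ∘ Function.update y i)
      ((fderiv ℝ (F ∘ coordMap (n := n) p) y).comp
        (ContinuousLinearMap.single ℝ (fun i => Euc (n i)) i)) (y i) := by
    refine HasFDerivAt.comp _ ?_ (hasFDerivAt_update_coord _ _ _)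
    rw [Function.update_eq_self]
    exact hd.hasFDerivAt
  have h2 : MDifferentiableAt 𝓘(ℝ, Euc (n i)) (𝓡 (n i)) (extChartAt (𝓡 (n i)) (p i)).symm (y i) :=
    (contMDiffOn_extChartAt_symm (n := ∞) (p i)).contMDiffAt
      ((isOpen_extChartAt_target (p i)).mem_nhds (hy i)) |>.mdifferentiableAt (by simp)
  have h3 : MDifferentiableAt (𝓡 (n i)) 𝓘(ℝ, V) (slice F (coordMap p y) i) (coordMap p y i) :=
    (contMDiff_slice hF _ i _).mdifferentiableAt (by simp)
  -- Away from the centre, `chartDeriv` refers to the preferred chart at `coordMap p y i`, which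
  -- need not be the one at `p i`. The differential of the inverse chart, `chartFrame`, relates the
  -- two.
  have h4 := HasMFDerivAt.comp (y i) (hasMFDerivAt_chartDeriv h3) h2.hasMFDerivAt
  rw [hasMFDerivAt_iff_hasFDerivAt, ← e] at h4
  exact congrArg (fun D : Euc (n i) →L[ℝ] V => D a) (h1.unique h4)

end Product

/-! ### From vanishing mixed derivatives to a sum of maps of the factors -/

section Splitting

variable {k : ℕ} {n : Fin k → ℕ} {M : Fin k → Type*} [∀ i, TopologicalSpace (M i)]
  [∀ i, ChartedSpace (Euc (n i)) (M i)] [∀ i, IsManifold (𝓡 (n i)) ∞ (M i)]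
  {V : Type*} [NormedAddCommGroup V] [NormedSpace ℝ V]

/-- All mixed second derivatives vanish at the centres of the product charts. -/
def MixedDerivZero (n : Fin k → ℕ) [∀ i, ChartedSpace (Euc (n i)) (M i)]
    (F : (∀ i, M i) → V) : Prop :=
  ∀ (p : ∀ i, M i) (i j : Fin k), i ≠ j → ∀ (a : Euc (n i)) (b : Euc (n j)),
    fderiv ℝ (fderiv ℝ (F ∘ coordMap (n := n) p)) (coordCenter p) (Pi.single i a)
      (Pi.single j b) = 0

/-- Since `p i` stays fixed, one chart of the `i`-th factor serves for all `y`. The derivative in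
`y` of this partial derivative is then a mixed second derivative at the centre of the product chart
at `q`. -/
theorem hasMFDerivAt_chartDeriv_slice {F : (∀ i, M i) → V} (hF : SmoothInCharts n F)
    (hmix : MixedDerivZero n F) (p : ∀ i, M i) {i j : Fin k} (hij : i ≠ j) (X : Euc (n i))
    (y₀ : M j) :
    HasMFDerivAt (𝓡 (n j)) 𝓘(ℝ, V)
      (fun y => chartDeriv (n i) (slice F (Function.update p j y) i) (p i) X)
      y₀ 0 := by
  set q := Function.update p j y₀ with hq
  have hqi : q i = p i := by simp [hq, hij]
  have hqj : q j = y₀ := by simp [hq]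
  set U := F ∘ coordMap (n := n) q with hU
  have hU2 : ContDiffAt ℝ 2 U (coordCenter q) := contDiffAt_infty.1 (hF q) 2
  set K : Euc (n j) → V := fun z => fderiv ℝ U (Function.update (coordCenter q) j z) (Pi.single i X)
    with hK
  have hctr : Function.update (coordCenter (n := n) q) j (extChartAt (𝓡 (n j)) y₀ y₀) =
      coordCenter q := update_coordCenter p j y₀
  have hK' : HasFDerivAt K (0 : Euc (n j) →L[ℝ] V) (extChartAt (𝓡 (n j)) y₀ y₀) := by
    have h1 := hasFDerivAt_fderiv_apply hU2 (Pi.single i X)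
    rw [← hctr] at h1
    have h2 := h1.comp _ (hasFDerivAt_update_coord (coordCenter (n := n) q) j _)
    refine h2.congr_fderiv ?_
    ext1 b
    rw [hctr]
    exact hmix q j i hij.symm b X
  have h3 : HasMFDerivAt (𝓡 (n j)) 𝓘(ℝ, V) (K ∘ extChartAt (𝓡 (n j)) y₀) y₀ 0 := by
    have h4 : MDifferentiableAt (𝓡 (n j)) 𝓘(ℝ, Euc (n j)) (extChartAt (𝓡 (n j)) y₀) y₀ :=
      (contMDiffAt_extChartAt (n := ∞)).mdifferentiableAt (by simp)
    have h5 := HasMFDerivAt.comp y₀ hK'.hasMFDerivAt h4.hasMFDerivAt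
    exact h5.congr_mfderiv (by ext1 v; rfl)
  -- For `y` in the chart domain at `y₀`, the slice through `Function.update p j y` is `U`
  -- restricted to an `i`-th coordinate slice, so the function is `K` read in that chart.
  refine h3.congr_of_eventuallyEq ?_
  have hcont : ContinuousAt
      (fun y => Function.update (coordCenter (n := n) q) j (extChartAt (𝓡 (n j)) y₀ y)) y₀ :=
    continuousAt_const.update j (continuousAt_extChartAt y₀)
  have hdiff : ∀ᶠ y in 𝓝 y₀, DifferentiableAt ℝ U
      (Function.update (coordCenter q) j (extChartAt (𝓡 (n j)) y₀ y)) := by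
    have h6 : ∀ᶠ z in 𝓝 (coordCenter q), ContDiffAt ℝ 2 U z := hU2.eventually (by simp)
    rw [← hctr] at h6
    exact (hcont.eventually h6).mono fun z hz => hz.differentiableAt (by norm_num)
  filter_upwards [hdiff, extChartAt_source_mem_nhds (I := 𝓡 (n j)) y₀] with y hy hys
  have e : slice F (Function.update p j y) i ∘ (extChartAt (𝓡 (n i)) (p i)).symm =
      U ∘ Function.update
        (Function.update (coordCenter q) j (extChartAt (𝓡 (n j)) y₀ y)) i := by
    funext t
    simp only [slice, Function.comp, hU, coordMap_update, coordMap_coordCenter]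
    congr 1
    rw [hqi, hqj, (extChartAt (𝓡 (n j)) y₀).left_inv hys, hq, Function.update_idem]
  have hc : extChartAt (𝓡 (n i)) (p i) (p i) =
      Function.update (coordCenter (n := n) q) j (extChartAt (𝓡 (n j)) y₀ y) i := by
    simp only [Function.update_of_ne hij, coordCenter]
    rw [hqi]
  have h7 : HasFDerivAt (U ∘ Function.update
        (Function.update (coordCenter q) j (extChartAt (𝓡 (n j)) y₀ y)) i)
      ((fderiv ℝ U (Function.update (coordCenter q) j (extChartAt (𝓡 (n j)) y₀ y))).comp
        (ContinuousLinearMap.single ℝ (fun i => Euc (n i)) i))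
      (Function.update (coordCenter (n := n) q) j (extChartAt (𝓡 (n j)) y₀ y) i) := by
    refine HasFDerivAt.comp _ ?_ (hasFDerivAt_update_coord _ _ _)
    rw [Function.update_eq_self]
    exact hy.hasFDerivAt
  rw [chartDeriv, e, hc, h7.fderiv]
  rfl

variable [∀ i, ConnectedSpace (M i)]

theorem chartDeriv_slice_update_eq {F : (∀ i, M i) → V} (hF : SmoothInCharts n F)
    (hmix : MixedDerivZero n F) (p : ∀ i, M i) {i j : Fin k} (hij : i ≠ j)
    (X : Euc (n i)) (y : M j) :
    chartDeriv (n i) (slice F (Function.update p j y) i) (p i) X =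
      chartDeriv (n i) (slice F p i) (p i) X := by
  have : IsManifold (𝓡 (n j)) 1 (M j) := IsManifold.of_le (n := ∞) (by simp)
  have h := eq_of_hasMFDerivAt_zero
    (fun y₀ => hasMFDerivAt_chartDeriv_slice hF hmix p hij X y₀) y (p j)
  simpa only [Function.update_eq_self] using h

/-- By the previous lemma, which uses that `M j` is connected, both slices have the same
differential; as `M i` is connected, their difference is constant. -/
theorem slice_sub_slice_eq {F : (∀ i, M i) → V} (hF : SmoothInCharts n F)
    (hmix : MixedDerivZero n F) (p : ∀ i, M i) {i j : Fin k} (hij : i ≠ j) (y : M j)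
    (x x' : M i) :
    slice F (Function.update p j y) i x - slice F p i x =
      slice F (Function.update p j y) i x' - slice F p i x' := by
  have : IsManifold (𝓡 (n i)) 1 (M i) := IsManifold.of_le (n := ∞) (by simp)
  refine eq_of_hasMFDerivAt_zero (n := n i) (M := M i)
    (g := fun x => slice F (Function.update p j y) i x - slice F p i x) (fun z => ?_) x x'
  have h1 : MDifferentiableAt (𝓡 (n i)) 𝓘(ℝ, V) (slice F (Function.update p j y) i) z :=
    (contMDiff_slice hF _ i z).mdifferentiableAt (by simp)
  have h2 : MDifferentiableAt (𝓡 (n i)) 𝓘(ℝ, V) (slice F p i) z :=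
    (contMDiff_slice hF _ i z).mdifferentiableAt (by simp)
  have h3 := (hasMFDerivAt_chartDeriv h1).sub (hasMFDerivAt_chartDeriv h2)
  refine h3.congr_mfderiv ?_
  ext1 X
  have h4 := chartDeriv_slice_update_eq hF hmix (Function.update p i z) hij X y
  rw [Function.update_comm hij, slice_update, slice_update, Function.update_self] at h4
  exact sub_eq_zero.2 h4

/-- A map of a product with vanishing mixed second derivatives is a sum of maps of the factors. -/
theorem eq_add_sum_slice {F : (∀ i, M i) → V} (hF : SmoothInCharts n F)
    (hmix : MixedDerivZero n F) (o p : ∀ i, M i) :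
    F p = F o + ∑ i, (slice F o i (p i) - F o) := by
  -- Increments along the `i`-th factor do not change when the other coordinates are switched one by
  -- one from `o` to `p`. Switching the `i`-th one does not affect the slice at all.
  have h1 : ∀ (s : Finset (Fin k)) (i : Fin k) (x x' : M i),
      slice F (s.piecewise p o) i x - slice F (s.piecewise p o) i x' =
        slice F o i x - slice F o i x' := by
    intro s i x x'
    induction s using Finset.induction_on with
    | empty => simp
    | insert j s hj ih =>
      rw [Finset.piecewise_insert]
      by_cases hij : i = j
      · subst hij; rw [slice_update]; exact ih
      · have := slice_sub_slice_eq hF hmix (s.piecewise p o) hij (p j) x x'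
        rw [← ih, sub_eq_sub_iff_sub_eq_sub]
        exact this
  have h2 : ∀ s : Finset (Fin k), F (s.piecewise p o) =
      F o + ∑ i ∈ s, (slice F o i (p i) - F o) := by
    intro s
    induction s using Finset.induction_on with
    | empty => simp
    | insert j s hj ih =>
      rw [Finset.piecewise_insert, Finset.sum_insert hj]
      have h3 := h1 s j (p j) (o j)
      have h4 : slice F (s.piecewise p o) j (o j) = F (s.piecewise p o) := by
        have : Function.update (s.piecewise p o) j (o j) = s.piecewise p o := by
          rw [Function.update_eq_iff]; simp [hj]
        rw [slice, this]
      have h5 : slice F o j (o j) = F o := by simp [slice]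
      rw [h4, h5, ih] at h3
      change slice F (s.piecewise p o) j (p j) = _
      rw [sub_eq_iff_eq_add.1 h3]
      abel
  simpa using h2 Finset.univ

end Splitting

/-! ### Isometric immersions of a Riemannian product -/

/-- The metric at `x`, with the tangent space identified with `ℝⁿ`. -/
def metricAt {n : ℕ} {M : Type*} [TopologicalSpace M] [ChartedSpace (Euc n) M]
    [IsManifold (𝓡 n) ∞ M] (g : RiemMetric n M) (x : M) (X Y : Euc n) : ℝ :=
  g.inner x X Y

theorem metricAt_pos {n : ℕ} {M : Type*} [TopologicalSpace M] [ChartedSpace (Euc n) M]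
    [IsManifold (𝓡 n) ∞ M] (g : RiemMetric n M) (x : M) {X : Euc n} (hX : X ≠ 0) :
    0 < metricAt g x X X := g.pos x X hX

theorem metricAt_zero_right {n : ℕ} {M : Type*} [TopologicalSpace M] [ChartedSpace (Euc n) M]
    [IsManifold (𝓡 n) ∞ M] (g : RiemMetric n M) (x : M) (X : Euc n) : metricAt g x X 0 = 0 :=
  map_zero (g.inner x (show TangentSpace (𝓡 n) x from X))

theorem metricAt_zero_left {n : ℕ} {M : Type*} [TopologicalSpace M] [ChartedSpace (Euc n) M]
    [IsManifold (𝓡 n) ∞ M] (g : RiemMetric n M) (x : M) (X : Euc n) : metricAt g x 0 X = 0 :=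
  (g.symm x _ _).trans (metricAt_zero_right g x X)

section Isometric

variable {k : ℕ} {n : Fin k → ℕ} {M : Fin k → Type*} [∀ i, TopologicalSpace (M i)]
  [∀ i, ChartedSpace (Euc (n i)) (M i)] [∀ i, IsManifold (𝓡 (n i)) ∞ (M i)]
  {V : Type*} [NormedAddCommGroup V] [NormedSpace ℝ V]

/-- `F` is an isometric immersion of the Riemannian product into the vector space `V` with scalar
product `B`, in terms of the restrictions of `F` to the factors. -/
structure IsProductIsometry (B : V →L[ℝ] V →L[ℝ] ℝ) (g : ∀ i, RiemMetric (n i) (M i))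
    (F : (∀ i, M i) → V) : Prop where
  smooth : SmoothInCharts n F
  orth : ∀ p i j, i ≠ j → ∀ (X : Euc (n i)) (Y : Euc (n j)),
    B (chartDeriv (n i) (slice F p i) (p i) X) (chartDeriv (n j) (slice F p j) (p j) Y) = 0
  diag : ∀ p i (X Y : Euc (n i)),
    B (chartDeriv (n i) (slice F p i) (p i) X) (chartDeriv (n i) (slice F p i) (p i) Y) =
      metricAt (g i) (p i) X Y

theorem bilin_sum_single {ι : Type*} [Fintype ι] [DecidableEq ι] {E : ι → Type*}
    [∀ i, NormedAddCommGroup (E i)] [∀ i, NormedSpace ℝ (E i)] (B : V →L[ℝ] V →L[ℝ] ℝ)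
    (T : (∀ i, E i) →L[ℝ] V)
    (h : ∀ i j, i ≠ j → ∀ a b, B (T (Pi.single i a)) (T (Pi.single j b)) = 0) (v : ∀ i, E i) :
    B (T v) (T v) = ∑ i, B (T (Pi.single i (v i))) (T (Pi.single i (v i))) := by
  conv_lhs => rw [← Finset.univ_sum_single v]
  simp only [map_sum, _root_.sum_apply]
  refine Finset.sum_congr rfl fun i _ => ?_
  rw [Finset.sum_eq_single i]
  · intro j _ hj
    exact h _ _ hj _ _
  · simp

theorem exists_ne_zero_of_two_le {m : ℕ} (hm : 2 ≤ m) (T : Euc m →ₗ[ℝ] ℝ) :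
    ∃ e : Euc m, e ≠ 0 ∧ T e = 0 := by
  have h : LinearMap.ker T ≠ ⊥ := by
    apply LinearMap.ker_ne_bot_of_finrank_lt
    simp; omega
  obtain ⟨e, he, hne⟩ := Submodule.exists_mem_ne_zero_of_ne_bot h
  exact ⟨e, hne, he⟩

/-- This checks the hypotheses of `mixed_fderiv_eq_zero` at the centre of each product chart. The
assumption that the total dimension is at least three enters here. -/
theorem IsProductIsometry.mixedDerivZero {B : V →L[ℝ] V →L[ℝ] ℝ} (hB : ∀ x y, B x y = B y x)
    {g : ∀ i, RiemMetric (n i) (M i)} {F : (∀ i, M i) → V} (hF : IsProductIsometry B g F)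
    (hn : ∀ i, 1 ≤ n i) (hn3 : 3 ≤ ∑ i, n i) (hnull : ∀ p, B (F p) (F p) = 0)
    (mix : ∀ (p : ∀ i, M i) (i j : Fin k), i ≠ j → ∀ (a : Euc (n i)) (b : Euc (n j)),
      ∃ (s : ℝ) (Z : ∀ i, Euc (n i)),
      fderiv ℝ (fderiv ℝ (F ∘ coordMap (n := n) p)) (coordCenter p) (Pi.single i a)
        (Pi.single j b) = s • F p + fderiv ℝ (F ∘ coordMap (n := n) p) (coordCenter p) Z) :
    MixedDerivZero n F := by
  intro p i j hij a b
  have hU2 : ContDiffAt ℝ 2 (F ∘ coordMap (n := n) p) (coordCenter p) :=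
    contDiffAt_infty.1 (hF.smooth p) 2
  have hdiff : ∀ᶠ y in 𝓝 (coordCenter p), DifferentiableAt ℝ (F ∘ coordMap (n := n) p) y :=
    (hU2.eventually (by simp)).mono fun z hz => hz.differentiableAt (by norm_num)
  have htgt : ∀ᶠ y in 𝓝 (coordCenter (n := n) p),
      ∀ i, y i ∈ (extChartAt (𝓡 (n i)) (p i)).target := by
    rw [eventually_all]
    intro i
    exact (continuous_apply i).continuousAt.eventually (extChartAt_target_mem_nhds (p i))
  have orth : ∀ᶠ y in 𝓝 (coordCenter p), ∀ i j, i ≠ j → ∀ a b,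
      B (fderiv ℝ (F ∘ coordMap (n := n) p) y (Pi.single i a))
        (fderiv ℝ (F ∘ coordMap (n := n) p) y (Pi.single j b)) = 0 := by
    filter_upwards [hdiff, htgt] with y hy hy' i j hij a b
    rw [fderiv_comp_coordMap hF.smooth p y hy' hy, fderiv_comp_coordMap hF.smooth p y hy' hy]
    exact hF.orth _ i j hij _ _
  -- Otherwise `i` and `j` are the only factors and both have dimension at most one, so the total
  -- dimension is at most two.
  have dimcase : (∃ l, l ≠ i ∧ l ≠ j) ∨ 2 ≤ n i ∨ 2 ≤ n j := by
    by_contra hcon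
    push Not at hcon
    obtain ⟨h1, h2, h3⟩ := hcon
    have : ∑ l, n l = n i + n j := by
      rw [← Finset.sum_pair hij]
      symm
      apply Finset.sum_subset (Finset.subset_univ _)
      intro l _ hl
      simp only [Finset.mem_insert, Finset.mem_singleton, not_or] at hl
      exact absurd (h1 l hl.1) hl.2
    omega
  refine mixed_fderiv_eq_zero B hB (hF.smooth p) orth ?_ ?_ ?_ ?_ hij ?_ a b
  · intro i
    -- The coefficient of the `i`-th metric in the chart at `p i`, a function of the `i`-th
    -- coordinate alone.
    refine ⟨fun z a b => metricAt (g i) ((extChartAt (𝓡 (n i)) (p i)).symm z)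
      (chartFrame (n i) (p i) z a) (chartFrame (n i) (p i) z b), ?_⟩
    filter_upwards [hdiff, htgt] with y hy hy' a b
    rw [fderiv_comp_coordMap hF.smooth p y hy' hy, fderiv_comp_coordMap hF.smooth p y hy' hy]
    exact hF.diag _ i _ _
  · exact Eventually.of_forall fun y => hnull _
  · intro v hv
    rw [bilin_sum_single B _ orth.self_of_nhds]
    simp only [← chartDeriv_slice hF.smooth, hF.diag]
    obtain ⟨l, hl⟩ := Function.ne_iff.1 hv
    refine Finset.sum_pos' (fun l _ => ?_) ⟨l, Finset.mem_univ l, metricAt_pos _ _ hl⟩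
    by_cases h : v l = 0
    · rw [h, metricAt_zero_right]
    · exact (metricAt_pos _ _ h).le
  · intro i j hij a b
    obtain ⟨s, Z, h⟩ := mix p i j hij a b
    refine ⟨s, Z, ?_⟩
    rw [h, Function.comp_apply, coordMap_coordCenter]
  · have hcase : ∀ i, 2 ≤ n i → ∀ a : Euc (n i), ∃ e : Euc (n i), e ≠ 0 ∧
        B (fderiv ℝ (F ∘ coordMap (n := n) p) (coordCenter p) (Pi.single i a))
          (fderiv ℝ (F ∘ coordMap (n := n) p) (coordCenter p) (Pi.single i e)) = 0 := by
      intro i hi a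
      exact exists_ne_zero_of_two_le hi
        (((B (fderiv ℝ (F ∘ coordMap (n := n) p) (coordCenter p) (Pi.single i a))).comp
          (fderiv ℝ (F ∘ coordMap (n := n) p) (coordCenter p))).comp
          (ContinuousLinearMap.single ℝ (fun i => Euc (n i)) i)).toLinearMap
    rcases dimcase with ⟨l, hli, hlj⟩ | h | h
    · have : Nonempty (Fin (n l)) := ⟨⟨0, hn l⟩⟩
      exact Or.inl ⟨l, hli, hlj, inferInstance⟩
    · exact Or.inr (Or.inl (hcase i h))
    · exact Or.inr (Or.inr (hcase j h))

end Isometric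

/-! ### Linear algebra of the Lorentz product -/

section Lorentz

variable {d : ℕ}

/-- The Lorentz product as a continuous bilinear form. -/
def lorForm (d : ℕ) : Mink d →L[ℝ] Mink d →L[ℝ] ℝ :=
  let b : Euc d →L[ℝ] Euc d →L[ℝ] ℝ := innerSL ℝ
  b.bilinearComp (ContinuousLinearMap.fst ℝ (Euc d) ℝ)
      (ContinuousLinearMap.fst ℝ (Euc d) ℝ) -
    (ContinuousLinearMap.mul ℝ ℝ).bilinearComp (ContinuousLinearMap.snd ℝ (Euc d) ℝ)
      (ContinuousLinearMap.snd ℝ (Euc d) ℝ)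

theorem lorForm_apply (X Y : Mink d) : lorForm d X Y = lor X Y := rfl

theorem lor_eq (X Y : Mink d) : lor X Y = inner ℝ X.1 Y.1 - X.2 * Y.2 := rfl

theorem lor_comm (X Y : Mink d) : lor X Y = lor Y X := by
  rw [lor_eq, lor_eq, real_inner_comm, mul_comm]

@[simp] theorem lor_add_left (X Y Z : Mink d) : lor (X + Y) Z = lor X Z + lor Y Z := by
  simp [← lorForm_apply]

@[simp] theorem lor_add_right (X Y Z : Mink d) : lor X (Y + Z) = lor X Y + lor X Z := by
  simp [← lorForm_apply]

@[simp] theorem lor_sub_left (X Y Z : Mink d) : lor (X - Y) Z = lor X Z - lor Y Z := by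
  simp [← lorForm_apply]

@[simp] theorem lor_sub_right (X Y Z : Mink d) : lor X (Y - Z) = lor X Y - lor X Z := by
  simp [← lorForm_apply]

@[simp] theorem lor_smul_left (a : ℝ) (X Y : Mink d) : lor (a • X) Y = a * lor X Y := by
  simp [← lorForm_apply]

@[simp] theorem lor_smul_right (a : ℝ) (X Y : Mink d) : lor X (a • Y) = a * lor X Y := by
  simp [← lorForm_apply]

@[simp] theorem lor_neg_left (X Y : Mink d) : lor (-X) Y = - lor X Y := by
  simp [← lorForm_apply]

@[simp] theorem lor_neg_right (X Y : Mink d) : lor X (-Y) = - lor X Y := by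
  simp [← lorForm_apply]

@[simp] theorem lor_zero_left (Y : Mink d) : lor 0 Y = 0 := by
  simp [← lorForm_apply]

@[simp] theorem lor_zero_right (Y : Mink d) : lor Y 0 = 0 := by
  simp [← lorForm_apply]

theorem lor_sum_left {ι : Type*} (s : Finset ι) (X : ι → Mink d) (Y : Mink d) :
    lor (∑ i ∈ s, X i) Y = ∑ i ∈ s, lor (X i) Y := by
  simp [← lorForm_apply]

theorem lor_sum_right {ι : Type*} (s : Finset ι) (X : ι → Mink d) (Y : Mink d) :
    lor Y (∑ i ∈ s, X i) = ∑ i ∈ s, lor Y (X i) := by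
  simp [← lorForm_apply]

theorem eq_zero_of_lor_eq_zero {X : Mink d} (h : ∀ Y, lor X Y = 0) : X = 0 := by
  -- Testing with the time reflection of `X` turns the Lorentz product into ‖X.1‖² + X.2².
  have h1 := h (X.1, -X.2)
  rw [lor_eq] at h1
  simp only [real_inner_self_eq_norm_sq] at h1
  have h2 : X.2 = 0 := by nlinarith [sq_nonneg ‖X.1‖, sq_nonneg X.2]
  have h3 : ‖X.1‖ = 0 := by rw [h2] at h1; nlinarith [norm_nonneg X.1]
  exact Prod.ext (norm_eq_zero.1 h3) h2

/-- A nonzero vector that is orthogonal to a time-like vector is space-like. -/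
theorem lor_self_pos_of_timelike {v x : Mink d} (hv : lor v v < 0) (hvx : lor v x = 0)
    (hx : x ≠ 0) : 0 < lor x x := by
  rw [lor_eq] at *
  simp only [real_inner_self_eq_norm_sq] at *
  -- If ⟨x, x⟩ ≤ 0, the Cauchy–Schwarz inequality for the space parts, whose product is `v.2 * x.2`,
  -- forces `x.2 = 0` and then `x.1 = 0`.
  by_contra hcon
  push Not at hcon
  have hcs := abs_real_inner_le_norm v.1 x.1
  have h1 : |inner ℝ v.1 x.1| ^ 2 ≤ (‖v.1‖ * ‖x.1‖) ^ 2 := by gcongr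
  rw [sq_abs] at h1
  have h2 : inner ℝ v.1 x.1 = v.2 * x.2 := by linarith
  rw [h2] at h1
  have h3 : x.2 ^ 2 * (v.2 ^ 2 - ‖v.1‖ ^ 2) ≤ ‖v.1‖ ^ 2 * (‖x.1‖ ^ 2 - x.2 ^ 2) := by nlinarith
  have h4 : ‖v.1‖ ^ 2 * (‖x.1‖ ^ 2 - x.2 ^ 2) ≤ 0 :=
    mul_nonpos_of_nonneg_of_nonpos (sq_nonneg _) (by nlinarith)
  have h5 : 0 < v.2 ^ 2 - ‖v.1‖ ^ 2 := by nlinarith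
  have h6 : x.2 ^ 2 = 0 := by
    by_contra h
    have : 0 < x.2 ^ 2 := lt_of_le_of_ne (sq_nonneg _) (Ne.symm h)
    nlinarith [mul_pos this h5]
  have h7 : x.2 = 0 := by simpa using h6
  have h8 : ‖x.1‖ = 0 := by rw [h7] at hcon; nlinarith [norm_nonneg x.1]
  exact hx (Prod.ext (norm_eq_zero.1 h8) h7)

/-- Orthogonal light-like vectors are proportional. -/
theorem exists_smul_of_null {z x : Mink d} (hz : lor z z = 0) (hz0 : z ≠ 0) (hx : lor x x = 0)
    (hzx : lor z x = 0) : ∃ a : ℝ, x = a • z := by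
  have hz2 : z.2 ≠ 0 := by
    intro h
    rw [lor_eq, real_inner_self_eq_norm_sq, h] at hz
    have : ‖z.1‖ = 0 := by nlinarith [norm_nonneg z.1]
    exact hz0 (Prod.ext (norm_eq_zero.1 this) h)
  -- This multiple removes the time coordinate; the difference is still light-like, hence zero.
  refine ⟨x.2 / z.2, ?_⟩
  have h2 : (x - (x.2 / z.2) • z).2 = 0 := by
    simp [hz2]
  have h3 : lor (x - (x.2 / z.2) • z) (x - (x.2 / z.2) • z) = 0 := by
    simp [hz, hx, hzx, lor_comm x z]
  rw [lor_eq, real_inner_self_eq_norm_sq, h2] at h3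
  have h4 : ‖(x - (x.2 / z.2) • z).1‖ = 0 := by
    nlinarith [norm_nonneg (x - (x.2 / z.2) • z).1]
  exact sub_eq_zero.1 (Prod.ext (norm_eq_zero.1 h4) h2)

/-- A light-like vector of a positive semidefinite subspace is orthogonal to it. -/
theorem lor_eq_zero_of_null {S : Submodule ℝ (Mink d)} (hS : ∀ x ∈ S, 0 ≤ lor x x) {z : Mink d}
    (hz : z ∈ S) (hz0 : lor z z = 0) {x : Mink d} (hx : x ∈ S) : lor z x = 0 := by
  by_contra hne
  -- The coefficient of `z` is chosen so that the sum has square -1.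
  have h := hS (x + (-(lor x x + 1) / (2 * lor z x)) • z)
    (S.add_mem hx (S.smul_mem _ hz))
  simp only [lor_add_left, lor_add_right, lor_smul_left, lor_smul_right, hz0, lor_comm x z] at h
  have : -(lor x x + 1) / (2 * lor z x) * lor z x = -(lor x x + 1) / 2 := by field_simp
  nlinarith

/-- The adjoint of a linear map `ℝ^m → 𝕃^{d+1}`. -/
def lorAdjoint {m : ℕ} (K : Euc m →ₗ[ℝ] Mink d) : Mink d →L[ℝ] Euc m :=
  LinearMap.toContinuousLinearMap
    { toFun := fun Z => WithLp.toLp 2 fun i => lor Z (K (EuclideanSpace.single i 1))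
      map_add' := fun X Y => by ext i; simp
      map_smul' := fun a X => by ext i; simp }

theorem inner_lorAdjoint {m : ℕ} (K : Euc m →ₗ[ℝ] Mink d) (Z : Mink d) (x : Euc m) :
    inner ℝ (lorAdjoint K Z) x = lor Z (K x) := by
  have hx : x = ∑ i, x i • EuclideanSpace.single i (1 : ℝ) := by
    ext j
    simp [Finset.sum_apply, Pi.single_apply]
  conv_rhs => rw [hx]
  rw [map_sum, lor_sum_right, PiLp.inner_apply]
  refine Finset.sum_congr rfl fun i _ => ?_
  simp [lorAdjoint]

theorem lorAdjoint_apply_self {m : ℕ} {K : Euc m →ₗ[ℝ] Mink d}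
    (hK : ∀ x y, lor (K x) (K y) = inner ℝ x y) (x : Euc m) : lorAdjoint K (K x) = x := by
  refine ext_inner_right ℝ fun y => ?_
  rw [inner_lorAdjoint, hK]

theorem lorAdjoint_eq_zero {m : ℕ} {K : Euc m →ₗ[ℝ] Mink d} {Z : Mink d}
    (h : ∀ x, lor Z (K x) = 0) : lorAdjoint K Z = 0 := by
  refine ext_inner_right ℝ fun y => ?_
  rw [inner_lorAdjoint, h, inner_zero_left]

end Lorentz

/-! ### The flat section of the light cone -/

section LightCone

variable {N : ℕ}

/-- As `p₀` and `w` are light-like with product one, the coefficient of each is the product with the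
other. Pairings recover all coefficients, so the combinations are independent, and they span because
2 + N is the dimension of 𝕃^{N+2}. -/
theorem ConeTriple.decomp (τ : ConeTriple N) (Z : Mink (N + 1)) :
    Z = lor Z τ.w • τ.p₀ + τ.A (lorAdjoint τ.A Z) + lor Z τ.p₀ • τ.w := by
  let Φ : (ℝ × ℝ) × Euc N →ₗ[ℝ] Mink (N + 1) :=
    ((LinearMap.toSpanSingleton ℝ _ τ.p₀).coprod (LinearMap.toSpanSingleton ℝ _ τ.w)).coprod τ.A
  have hΦ : ∀ a b x, Φ ((a, b), x) = a • τ.p₀ + b • τ.w + τ.A x := fun a b x => by simp [Φ]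
  have hwp : lor τ.w τ.p₀ = 1 := by rw [lor_comm, τ.p₀_w]
  have h1 : ∀ a b x, lor (Φ ((a, b), x)) τ.w = a := fun a b x => by
    simp [hΦ, τ.p₀_w, τ.w_null, τ.A_w]
  have h2 : ∀ a b x, lor (Φ ((a, b), x)) τ.p₀ = b := fun a b x => by
    simp [hΦ, hwp, τ.p₀_null, τ.A_p₀]
  have h3 : ∀ a b x, lorAdjoint τ.A (Φ ((a, b), x)) = x := fun a b x => by
    rw [hΦ, map_add, lorAdjoint_apply_self τ.A_isom, lorAdjoint_eq_zero, zero_add]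
    intro y
    rw [lor_comm]
    simp [τ.A_w, τ.A_p₀]
  have hinj : Function.Injective Φ := by
    rintro ⟨⟨a, b⟩, x⟩ ⟨⟨a', b'⟩, x'⟩ h
    have e1 := h1 a b x
    have e2 := h2 a b x
    have e3 := h3 a b x
    rw [h] at e1 e2 e3
    rw [h1] at e1; rw [h2] at e2; rw [h3] at e3
    subst e1 e2 e3; rfl
  have hdim : Module.finrank ℝ ((ℝ × ℝ) × Euc N) = Module.finrank ℝ (Mink (N + 1)) := by
    simp; ring
  have hsurj := (LinearMap.injective_iff_surjective_of_finrank_eq_finrank hdim).1 hinj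
  obtain ⟨⟨⟨a, b⟩, x⟩, rfl⟩ := hsurj Z
  rw [h1, h2, h3, hΦ]
  abel

theorem ConeTriple.lor_eq_of_decomp (τ : ConeTriple N) (Z Y : Mink (N + 1)) :
    lor Z Y = lor Z τ.w * lor Y τ.p₀ + lor Z τ.p₀ * lor Y τ.w +
      inner ℝ (lorAdjoint τ.A Z) (lorAdjoint τ.A Y) := by
  conv_lhs => rw [τ.decomp Z]
  simp only [lor_add_left, lor_smul_left]
  rw [lor_comm (τ.A _) Y, ← inner_lorAdjoint, lor_comm τ.p₀ Y, lor_comm τ.w Y, real_inner_comm]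
  ring

theorem ConeTriple.lor_embed_w (τ : ConeTriple N) (x : Euc N) : lor (τ.embed x) τ.w = 1 := by
  simp [ConeTriple.embed, τ.p₀_w, τ.A_w, τ.w_null]

/-- Lorentz products on the section encode Euclidean distances. This produces the inversion in the
flat case and compares two lifts in the uniqueness proof. -/
theorem ConeTriple.lor_embed_embed (τ : ConeTriple N) (x y : Euc N) :
    lor (τ.embed x) (τ.embed y) = -(‖x - y‖ ^ 2 / 2) := by
  simp only [ConeTriple.embed, lor_add_left, lor_add_right, lor_sub_left, lor_sub_right,
    lor_smul_left, lor_smul_right, τ.p₀_null, τ.w_null,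
    τ.p₀_w, τ.A_isom, τ.A_p₀, τ.A_w, lor_comm τ.p₀ (τ.A _), lor_comm τ.w (τ.A _),
    lor_comm τ.w τ.p₀]
  rw [norm_sub_sq_real]
  ring

theorem ConeTriple.lorAdjoint_embed (τ : ConeTriple N) (x : Euc N) :
    lorAdjoint τ.A (τ.embed x) = x := by
  have h : ∀ Z, (∀ y, lor (τ.A y) Z = 0) → lorAdjoint τ.A Z = 0 := fun Z hZ =>
    lorAdjoint_eq_zero fun y => by rw [lor_comm]; exact hZ y
  rw [ConeTriple.embed, map_sub, map_add, map_smul, h _ τ.A_p₀, h _ τ.A_w,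
    lorAdjoint_apply_self τ.A_isom]
  simp

/-- Nullity fixes the coefficient of `w` once the component in the image of `A` is known. -/
theorem ConeTriple.embed_lorAdjoint (τ : ConeTriple N) {Y : Mink (N + 1)} (h0 : lor Y Y = 0)
    (h1 : lor Y τ.w = 1) : τ.embed (lorAdjoint τ.A Y) = Y := by
  have h2 := τ.lor_eq_of_decomp Y Y
  rw [h0, h1, real_inner_self_eq_norm_sq] at h2
  conv_rhs => rw [τ.decomp Y, h1]
  have h3 : lor Y τ.p₀ = -(‖lorAdjoint τ.A Y‖ ^ 2 / 2) := by linarith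
  rw [h3, ConeTriple.embed]
  simp [sub_eq_add_neg]

/-- `p₀` and `w` span the two null lines in the plane of the last space axis and the time axis; `A`
is the inclusion of the remaining axes. -/
theorem nonempty_coneTriple (N : ℕ) : Nonempty (ConeTriple N) := by
  let A₀ : Euc N →ₗ[ℝ] Euc (N + 1) :=
    { toFun := fun x => WithLp.toLp 2 (Fin.snoc (α := fun _ => ℝ) (fun i => x i) 0)
      map_add' := fun x y => by
        ext i
        refine Fin.lastCases ?_ (fun j => ?_) i <;> simp
      map_smul' := fun a x => by
        ext i
        refine Fin.lastCases ?_ (fun j => ?_) i <;> simp }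
  have hA₀ : ∀ x y, inner ℝ (A₀ x) (A₀ y) = inner ℝ x y := by
    intro x y
    rw [PiLp.inner_apply, Fin.sum_univ_castSucc, PiLp.inner_apply]
    simp [A₀]
  let e : Euc (N + 1) := EuclideanSpace.single (Fin.last N) 1
  have he : inner ℝ e e = (1 : ℝ) := by simp [e]
  have hAe : ∀ x, inner ℝ (A₀ x) e = (0 : ℝ) := by
    intro x
    simp [e, A₀, EuclideanSpace.inner_single_right]
  exact ⟨{
    p₀ := ((1 / 2 : ℝ) • e, 1 / 2)
    w := (e, -1)
    A := (LinearMap.inl ℝ (Euc (N + 1)) ℝ).comp A₀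
    p₀_null := by simp only [lor_eq, inner_smul_left, inner_smul_right, he]; simp
    w_null := by simp only [lor_eq, he]; simp
    p₀_w := by simp only [lor_eq, inner_smul_left, he]; norm_num
    A_isom := fun x y => by simp [lor_eq, hA₀]
    A_p₀ := fun x => by simp [lor_eq, inner_smul_right, hAe]
    A_w := fun x => by simp [lor_eq, hAe] }⟩

end LightCone

/-! ### Derivatives of lifts to the light cone -/

section Lift

variable {N : ℕ} {V : Type*} [NormedAddCommGroup V] [NormedSpace ℝ V]

/-- The differential of `τ.embed` at `u`. -/
def ConeTriple.dEmbed (τ : ConeTriple N) (u x : Euc N) : Mink (N + 1) :=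
  τ.A x - inner ℝ u x • τ.w

theorem ConeTriple.dEmbed_add (τ : ConeTriple N) (u x y : Euc N) :
    τ.dEmbed u (x + y) = τ.dEmbed u x + τ.dEmbed u y := by
  simp only [ConeTriple.dEmbed, map_add, inner_add_right, add_smul]
  abel

theorem ConeTriple.dEmbed_smul (τ : ConeTriple N) (a : ℝ) (u x : Euc N) :
    τ.dEmbed u (a • x) = a • τ.dEmbed u x := by
  simp only [ConeTriple.dEmbed, map_smul, inner_smul_right, smul_sub, smul_smul]

theorem ConeTriple.lor_embed_dEmbed (τ : ConeTriple N) (u x : Euc N) :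
    lor (τ.embed u) (τ.dEmbed u x) = 0 := by
  simp only [ConeTriple.dEmbed, ConeTriple.embed, lor_add_left, lor_sub_left, lor_sub_right,
    lor_smul_left, lor_smul_right, τ.w_null,
    τ.p₀_w, τ.A_isom, τ.A_p₀, τ.A_w, lor_comm τ.p₀ (τ.A _), lor_comm τ.w (τ.A _)]
  ring

theorem ConeTriple.lor_dEmbed_dEmbed (τ : ConeTriple N) (u x y : Euc N) :
    lor (τ.dEmbed u x) (τ.dEmbed u y) = inner ℝ x y := by
  simp only [ConeTriple.dEmbed, lor_sub_left, lor_sub_right,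
    lor_smul_left, lor_smul_right, τ.w_null, τ.A_isom, τ.A_w, lor_comm τ.w (τ.A _)]
  ring

theorem ConeTriple.contDiff_embed (τ : ConeTriple N) {m : WithTop ℕ∞} :
    ContDiff ℝ m τ.embed := by
  have hA : ContDiff ℝ m τ.A := (LinearMap.toContinuousLinearMap τ.A).contDiff
  unfold ConeTriple.embed
  exact (contDiff_const.add hA).sub (((contDiff_norm_sq ℝ).div_const 2).smul contDiff_const)

theorem ConeTriple.hasDerivAt_embed (τ : ConeTriple N) {γ : ℝ → Euc N} {γ' : Euc N} {t : ℝ}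
    (hγ : HasDerivAt γ γ' t) :
    HasDerivAt (fun s => τ.embed (γ s)) (τ.dEmbed (γ t) γ') t := by
  have h1 : HasDerivAt (fun s => τ.A (γ s)) (τ.A γ') t :=
    (LinearMap.toContinuousLinearMap τ.A).hasFDerivAt.comp_hasDerivAt t hγ
  have h2 := ((hγ.norm_sq.div_const 2).smul_const τ.w)
  have h3 := (h1.const_add τ.p₀).sub h2
  exact h3.congr_deriv (by simp [ConeTriple.dEmbed])

theorem ConeTriple.hasDerivAt_dEmbed (τ : ConeTriple N) {γ β : ℝ → Euc N} {γ' β' : Euc N} {t : ℝ}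
    (hγ : HasDerivAt γ γ' t) (hβ : HasDerivAt β β' t) :
    HasDerivAt (fun s => τ.dEmbed (γ s) (β s))
      (τ.dEmbed (γ t) β' - inner ℝ γ' (β t) • τ.w) t := by
  have h1 : HasDerivAt (fun s => τ.A (β s)) (τ.A β') t :=
    (LinearMap.toContinuousLinearMap τ.A).hasFDerivAt.comp_hasDerivAt t hβ
  have h2 := (hγ.inner ℝ hβ).smul_const τ.w
  have h3 := h1.sub h2
  refine h3.congr_deriv ?_
  simp only [ConeTriple.dEmbed, add_smul]
  abel

theorem hasDerivAt_line {W : Type*} [NormedAddCommGroup W] [NormedSpace ℝ W] {u : V → W} {y : V}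
    (hu : DifferentiableAt ℝ u y) (v : V) :
    HasDerivAt (fun t : ℝ => u (y + t • v)) (fderiv ℝ u y v) 0 := by
  simpa [HasLineDerivAt] using hu.hasFDerivAt.hasLineDerivAt v

/-- The first derivative of a lift to the light cone. -/
theorem ConeTriple.fderiv_lift (τ : ConeTriple N) {ψ : V → ℝ} {u : V → Euc N} {y : V}
    (hψ : DifferentiableAt ℝ ψ y) (hu : DifferentiableAt ℝ u y) (v : V) :
    fderiv ℝ (fun y => ψ y • τ.embed (u y)) y v =
      fderiv ℝ ψ y v • τ.embed (u y) + ψ y • τ.dEmbed (u y) (fderiv ℝ u y v) := by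
  have hE : DifferentiableAt ℝ τ.embed (u y) :=
    (τ.contDiff_embed (m := 1)).differentiable (by norm_num) _
  have h1 := hasDerivAt_line (hψ.smul (hE.comp y hu)) v
  have h2 := (hasDerivAt_line hψ v).smul (τ.hasDerivAt_embed (hasDerivAt_line hu v))
  have h3 := h1.unique h2
  simp only [zero_smul, add_zero] at h3
  exact h3.trans (add_comm _ _)

/-- The derivative of `ψ` contributes only multiples of the position vector, which is orthogonal to
itself and to the image of `dEmbed`. For `ψ` the inverse conformal factor, the lift becomes
isometric. -/
theorem ConeTriple.lor_fderiv_lift (τ : ConeTriple N) {ψ : V → ℝ} {u : V → Euc N} {y : V}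
    (hψ : DifferentiableAt ℝ ψ y) (hu : DifferentiableAt ℝ u y) (v v' : V) :
    lor (fderiv ℝ (fun y => ψ y • τ.embed (u y)) y v)
      (fderiv ℝ (fun y => ψ y • τ.embed (u y)) y v') =
      ψ y ^ 2 * inner ℝ (fderiv ℝ u y v) (fderiv ℝ u y v') := by
  rw [τ.fderiv_lift hψ hu, τ.fderiv_lift hψ hu]
  simp only [lor_add_left, lor_add_right, lor_smul_left, lor_smul_right, τ.lor_embed_dEmbed,
    lor_comm (τ.dEmbed _ _) (τ.embed _), τ.lor_dEmbed_dEmbed, τ.lor_embed_embed]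
  simp
  ring

/-- If the second derivative of `u` in two orthogonal directions is tangential, then that of a lift
of `u` to the light cone lies in the span of the position vector and the tangent space. -/
theorem ConeTriple.fderiv_fderiv_lift (τ : ConeTriple N) {ψ : V → ℝ} {u : V → Euc N} {c : V}
    (hψ : ContDiffAt ℝ 2 ψ c) (hu : ContDiffAt ℝ 2 u c) (hψ0 : ψ c ≠ 0) {a b Z : V}
    (hab : inner ℝ (fderiv ℝ u c a) (fderiv ℝ u c b) = 0)
    (hZ : fderiv ℝ (fderiv ℝ u) c a b = fderiv ℝ u c Z) :
    ∃ (s : ℝ) (Y : V), fderiv ℝ (fderiv ℝ (fun y => ψ y • τ.embed (u y))) c a b =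
      s • (ψ c • τ.embed (u c)) + fderiv ℝ (fun y => ψ y • τ.embed (u y)) c Y := by
  have hU2 : ContDiffAt ℝ 2 (fun y => ψ y • τ.embed (u y)) c :=
    hψ.smul (τ.contDiff_embed.contDiffAt.comp c hu)
  have hψ1 := hψ.differentiableAt (by norm_num)
  have hu1 := hu.differentiableAt (by norm_num)
  have hev : (fun y => fderiv ℝ (fun y => ψ y • τ.embed (u y)) y b) =ᶠ[𝓝 c] fun y =>
      fderiv ℝ ψ y b • τ.embed (u y) + ψ y • τ.dEmbed (u y) (fderiv ℝ u y b) := by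
    filter_upwards [hψ.eventually (by simp), hu.eventually (by simp)] with y h1 h2
    exact τ.fderiv_lift (h1.differentiableAt (by norm_num)) (h2.differentiableAt (by norm_num)) b
  have h1 := hasDerivAt_line (hasFDerivAt_fderiv_apply hU2 b).differentiableAt a
  rw [(hasFDerivAt_fderiv_apply hU2 b).fderiv] at h1
  have h2 := hasDerivAt_line (hasFDerivAt_fderiv_apply hψ b).differentiableAt a
  rw [(hasFDerivAt_fderiv_apply hψ b).fderiv] at h2
  have h3 := hasDerivAt_line (hasFDerivAt_fderiv_apply hu b).differentiableAt a
  rw [(hasFDerivAt_fderiv_apply hu b).fderiv] at h3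
  have h4 := (h2.smul (τ.hasDerivAt_embed (hasDerivAt_line hu1 a))).add
    ((hasDerivAt_line hψ1 a).smul (τ.hasDerivAt_dEmbed (hasDerivAt_line hu1 a) h3))
  have hc : Tendsto (fun t : ℝ => c + t • a) (𝓝 0) (𝓝 c) := by
    have : Continuous fun t : ℝ => c + t • a := by fun_prop
    simpa using this.tendsto 0
  have h5 := h1.unique (h4.congr_of_eventuallyEq (hc.eventually hev))
  -- Orthogonality of the two directions removes the component along `w`, which comes from the
  -- curvature of the section.
  simp only [zero_smul, add_zero, ContinuousLinearMap.flip_apply, hab, sub_zero, hZ] at h5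
  -- `Y` is chosen to match the `dEmbed` terms; `s` collects the remaining multiple of the position
  -- vector.
  refine ⟨(fderiv ℝ (fderiv ℝ ψ) c a b - fderiv ℝ ψ c ((ψ c)⁻¹ • (fderiv ℝ ψ c b • a +
    fderiv ℝ ψ c a • b + ψ c • Z))) / ψ c, (ψ c)⁻¹ • (fderiv ℝ ψ c b • a +
    fderiv ℝ ψ c a • b + ψ c • Z), ?_⟩
  rw [h5, τ.fderiv_lift hψ1 hu1, smul_smul, div_mul_cancel₀ _ hψ0, sub_smul]
  have h6 : ψ c • τ.dEmbed (u c) (fderiv ℝ u c ((ψ c)⁻¹ • (fderiv ℝ ψ c b • a +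
      fderiv ℝ ψ c a • b + ψ c • Z))) = fderiv ℝ ψ c b • τ.dEmbed (u c) (fderiv ℝ u c a) +
      fderiv ℝ ψ c a • τ.dEmbed (u c) (fderiv ℝ u c b) +
      ψ c • τ.dEmbed (u c) (fderiv ℝ u c Z) := by
    rw [map_smul, τ.dEmbed_smul, smul_smul, mul_inv_cancel₀ hψ0, one_smul]
    simp only [map_add, map_smul, τ.dEmbed_add, τ.dEmbed_smul]
  rw [h6]
  abel

end Lift

/-! ### Adaptedness and the isometric lift of `f` -/

section Product

variable {k N : ℕ} {n : Fin k → ℕ} {M : Fin k → Type*} [∀ i, TopologicalSpace (M i)]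
  [∀ i, ChartedSpace (Euc (n i)) (M i)] [∀ i, IsManifold (𝓡 (n i)) ∞ (M i)]

/-- Adaptedness to the product net: mixed second derivatives are tangential. -/
theorem exists_mixed_eq_of_adapted {f : (∀ i, M i) → Euc N}
    (hf : ContMDiff (prodModel n) 𝓘(ℝ, Euc N) ∞ f)
    (horth : ∀ (p : ∀ i, M i) (i j : Fin k), i ≠ j → ∀ (a : Euc (n i)) (b : Euc (n j)),
      inner ℝ (fderiv ℝ (f ∘ coordMap (n := n) p) (coordCenter p) (Pi.single i a))
        (fderiv ℝ (f ∘ coordMap (n := n) p) (coordCenter p) (Pi.single j b)) = 0)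
    (hadapted : IsAdaptedToProductNet n f) (p : ∀ i, M i) {i j : Fin k} (hij : i ≠ j)
    (a : Euc (n i)) (b : Euc (n j)) :
    ∃ Z : ∀ i, Euc (n i), fderiv ℝ (fderiv ℝ (f ∘ coordMap (n := n) p)) (coordCenter p)
      (Pi.single i a) (Pi.single j b) = fderiv ℝ (f ∘ coordMap (n := n) p) (coordCenter p) Z := by
  set D := fderiv ℝ (fderiv ℝ (f ∘ coordMap (n := n) p)) (coordCenter p)
      (Pi.single i a) (Pi.single j b) with hD
  have hsff : (normalSpace (n := n) f p).starProjection D =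
    secondFundamentalForm (n := n) f p (Pi.single i a) (Pi.single j b) := rfl
  have hproj : (normalSpace (n := n) f p).starProjection D = 0 := by
    -- The shape operator is taken in the normal direction ξ = α(a, b) itself. Then ⟨ξ, ξ⟩ = ⟨A_ξ a,
    -- b⟩ = 0, because A_ξ a stays in the `i`-th factor.
    have hmem : (normalSpace (n := n) f p).starProjection D ∈ normalSpace (n := n) f p :=
      Submodule.starProjection_apply_mem _ _
    obtain ⟨Z, hZ, hval⟩ := hadapted p i _ hmem (Pi.single i a)
      (fun l hl => Pi.single_eq_of_ne hl _)
    have h1 := hval (Pi.single j b)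
    rw [← hsff, prodDeriv_apply hf, prodDeriv_apply hf] at h1
    have hZ' : Z = Pi.single i (Z i) := by
      funext l
      by_cases hl : l = i
      · subst hl; simp
      · rw [Pi.single_eq_of_ne hl]; exact hZ l hl
    rw [hZ'] at h1
    have h2 := h1.symm.trans (horth p i j hij (Z i) b)
    exact inner_self_eq_zero.1 h2
  have hmem : D ∈ (normalSpace (n := n) f p)ᗮ :=
    (Submodule.starProjection_apply_eq_zero_iff _).1 hproj
  rw [normalSpace, Submodule.orthogonal_orthogonal] at hmem
  obtain ⟨Z, hZ⟩ := hmem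
  exact ⟨Z, by rw [← hZ, prodDeriv_apply hf]⟩

/-- The product metric, with the tangent spaces identified with Euclidean spaces. -/
def prodMetricAt (g : ∀ i, RiemMetric (n i) (M i)) (p : ∀ i, M i) (v v' : ∀ i, Euc (n i)) : ℝ :=
  ∑ i, metricAt (g i) (p i) (v i) (v' i)

theorem prodMetricAt_single_of_ne (g : ∀ i, RiemMetric (n i) (M i)) (p : ∀ i, M i) {i j : Fin k}
    (hij : i ≠ j) (X : Euc (n i)) (Y : Euc (n j)) :
    prodMetricAt g p (Pi.single i X) (Pi.single j Y) = 0 := by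
  refine Finset.sum_eq_zero fun l _ => ?_
  by_cases hl : l = i
  · subst hl
    rw [Pi.single_eq_of_ne (i' := l) hij, metricAt_zero_right]
  · rw [Pi.single_eq_of_ne (i' := l) hl, metricAt_zero_left]

theorem prodMetricAt_single (g : ∀ i, RiemMetric (n i) (M i)) (p : ∀ i, M i) (i : Fin k)
    (X Y : Euc (n i)) :
    prodMetricAt g p (Pi.single i X) (Pi.single i Y) = metricAt (g i) (p i) X Y := by
  unfold prodMetricAt
  rw [Finset.sum_eq_single i]
  · rw [Pi.single_eq_same, Pi.single_eq_same]
  · intro l _ hl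
    rw [Pi.single_eq_of_ne (i' := l) hl, metricAt_zero_left]
  · simp

section Conformal

variable (τ : ConeTriple N) {g : ∀ i, RiemMetric (n i) (M i)}
    {f : (∀ i, M i) → Euc N} {φ : (∀ i, M i) → ℝ}

theorem inner_fderiv_coordMap (hf : ContMDiff (prodModel n) 𝓘(ℝ, Euc N) ∞ f)
    (hconf : ∀ (p : ∀ i, M i) (X Y : ∀ i, TangentSpace (𝓡 (n i)) (p i)),
      inner ℝ (prodDeriv f p X) (prodDeriv f p Y) = φ p ^ 2 * prodMetric g p X Y)
    (p : ∀ i, M i) (v v' : ∀ i, Euc (n i)) :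
    inner ℝ (fderiv ℝ (f ∘ coordMap (n := n) p) (coordCenter p) v)
      (fderiv ℝ (f ∘ coordMap (n := n) p) (coordCenter p) v') = φ p ^ 2 * prodMetricAt g p v v' :=
  (congrArg₂ (fun x y : Euc N => inner ℝ x y) (prodDeriv_apply hf p v).symm
    (prodDeriv_apply hf p v').symm).trans (hconf p v v')

theorem contDiffAt_inv_factor
    (hφ : ContMDiff (prodModel n) 𝓘(ℝ, ℝ) ∞ φ) (hφ0 : ∀ p, 0 < φ p) (p : ∀ i, M i) :
    ContDiffAt ℝ ∞ (fun y => (φ (coordMap (n := n) p y))⁻¹) (coordCenter p) :=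
  (smoothInCharts_of_contMDiff hφ p).inv (hφ0 _).ne'

theorem smoothInCharts_lift
    (hf : ContMDiff (prodModel n) 𝓘(ℝ, Euc N) ∞ f)
    (hφ : ContMDiff (prodModel n) 𝓘(ℝ, ℝ) ∞ φ) (hφ0 : ∀ p, 0 < φ p) :
    SmoothInCharts n (fun p => (φ p)⁻¹ • τ.embed (f p)) := fun p =>
  (contDiffAt_inv_factor hφ hφ0 p).smul
    (τ.contDiff_embed.contDiffAt.comp _ (smoothInCharts_of_contMDiff hf p))

theorem lor_fderiv_lift_coordMap
    (hf : ContMDiff (prodModel n) 𝓘(ℝ, Euc N) ∞ f)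
    (hφ : ContMDiff (prodModel n) 𝓘(ℝ, ℝ) ∞ φ) (hφ0 : ∀ p, 0 < φ p)
    (hconf : ∀ (p : ∀ i, M i) (X Y : ∀ i, TangentSpace (𝓡 (n i)) (p i)),
      inner ℝ (prodDeriv f p X) (prodDeriv f p Y) = φ p ^ 2 * prodMetric g p X Y)
    (p : ∀ i, M i) (v v' : ∀ i, Euc (n i)) :
    lor (fderiv ℝ ((fun p => (φ p)⁻¹ • τ.embed (f p)) ∘ coordMap (n := n) p) (coordCenter p) v)
      (fderiv ℝ ((fun p => (φ p)⁻¹ • τ.embed (f p)) ∘ coordMap (n := n) p) (coordCenter p) v') =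
      prodMetricAt g p v v' := by
  have h := τ.lor_fderiv_lift ((contDiffAt_inv_factor hφ hφ0 p).differentiableAt (by simp))
    ((smoothInCharts_of_contMDiff hf p).differentiableAt (by simp)) v v'
  refine h.trans ?_
  rw [inner_fderiv_coordMap hf hconf, coordMap_coordCenter, ← mul_assoc, ← mul_pow,
    inv_mul_cancel₀ (hφ0 p).ne']
  simp

/-- The lift of a conformal immersion to the light cone is isometric. -/
theorem lift_isProductIsometry
    (hf : ContMDiff (prodModel n) 𝓘(ℝ, Euc N) ∞ f)
    (hφ : ContMDiff (prodModel n) 𝓘(ℝ, ℝ) ∞ φ) (hφ0 : ∀ p, 0 < φ p)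
    (hconf : ∀ (p : ∀ i, M i) (X Y : ∀ i, TangentSpace (𝓡 (n i)) (p i)),
      inner ℝ (prodDeriv f p X) (prodDeriv f p Y) = φ p ^ 2 * prodMetric g p X Y) :
    IsProductIsometry (lorForm (N + 1)) g (fun p => (φ p)⁻¹ • τ.embed (f p)) := by
  have hs := smoothInCharts_lift (n := n) τ hf hφ hφ0
  refine ⟨hs, fun p i j hij X Y => ?_, fun p i X Y => ?_⟩
  · rw [chartDeriv_slice hs, chartDeriv_slice hs, lorForm_apply,
      lor_fderiv_lift_coordMap τ hf hφ hφ0 hconf, prodMetricAt_single_of_ne g p hij]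
  · rw [chartDeriv_slice hs, chartDeriv_slice hs, lorForm_apply,
      lor_fderiv_lift_coordMap τ hf hφ hφ0 hconf, prodMetricAt_single]

/-- Adaptedness makes the mixed second derivatives of `f` tangential, and the factors are
orthogonal, so `fderiv_fderiv_lift` supplies the hypothesis `mix`. -/
theorem lift_mixedDerivZero
    (hf : ContMDiff (prodModel n) 𝓘(ℝ, Euc N) ∞ f)
    (hφ : ContMDiff (prodModel n) 𝓘(ℝ, ℝ) ∞ φ) (hφ0 : ∀ p, 0 < φ p)
    (hconf : ∀ (p : ∀ i, M i) (X Y : ∀ i, TangentSpace (𝓡 (n i)) (p i)),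
      inner ℝ (prodDeriv f p X) (prodDeriv f p Y) = φ p ^ 2 * prodMetric g p X Y)
    (hn : ∀ i, 1 ≤ n i) (hn3 : 3 ≤ ∑ i, n i)
    (hadapted : IsAdaptedToProductNet n f) :
    MixedDerivZero n (fun p => (φ p)⁻¹ • τ.embed (f p)) := by
  refine (lift_isProductIsometry τ hf hφ hφ0 hconf).mixedDerivZero (fun X Y => lor_comm X Y)
    hn hn3 (fun p => ?_) (fun p i j hij a b => ?_)
  · simp [lorForm_apply, τ.lor_embed_embed]
  · have horth : ∀ (p : ∀ i, M i) (i j : Fin k), i ≠ j → ∀ (a : Euc (n i)) (b : Euc (n j)),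
        inner ℝ (fderiv ℝ (f ∘ coordMap (n := n) p) (coordCenter p) (Pi.single i a))
          (fderiv ℝ (f ∘ coordMap (n := n) p) (coordCenter p) (Pi.single j b)) = 0 := by
      intro p i j hij a b
      rw [inner_fderiv_coordMap hf hconf, prodMetricAt_single_of_ne g p hij, mul_zero]
    obtain ⟨Z, hZ⟩ := exists_mixed_eq_of_adapted hf horth hadapted p hij a b
    obtain ⟨s, Y, hY⟩ := τ.fderiv_fderiv_lift
      (contDiffAt_infty.1 (contDiffAt_inv_factor hφ hφ0 p) 2)
      (contDiffAt_infty.1 (smoothInCharts_of_contMDiff hf p) 2) (inv_ne_zero (hφ0 _).ne')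
      (horth p i j hij a b) hZ
    refine ⟨s, Y, hY.trans ?_⟩
    rw [Function.comp_apply, coordMap_coordCenter]
    rfl

end Conformal

end Product

/-! ### Isometric immersions composed with linear maps -/

section Immersion

variable {n : ℕ} {M : Type*} [TopologicalSpace M] [ChartedSpace (Euc n) M]
  {V W : Type*} [NormedAddCommGroup V] [NormedSpace ℝ V]
  [NormedAddCommGroup W] [NormedSpace ℝ W]

theorem hasFDerivAt_chartDeriv {G : M → V} {x : M} (hG : MDifferentiableAt (𝓡 n) 𝓘(ℝ, V) G x) :
    HasFDerivAt (G ∘ (extChartAt (𝓡 n) x).symm) (chartDeriv n G x) (extChartAt (𝓡 n) x x) :=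
  hasFDerivAt_of_hasMFDerivAt (hasMFDerivAt_chartDeriv hG)

theorem chartDeriv_clm_add {G : M → V} {x : M} (hG : MDifferentiableAt (𝓡 n) 𝓘(ℝ, V) G x)
    (T : V →L[ℝ] W) (c : W) (X : Euc n) :
    chartDeriv n (fun y => T (G y) + c) x X = T (chartDeriv n G x X) := by
  have h := (T.hasFDerivAt.comp _ (hasFDerivAt_chartDeriv hG)).add_const c
  exact congrArg (fun D : Euc n →L[ℝ] W => D X) h.fderiv

theorem contMDiff_clm_add {G : M → V} (hG : ContMDiff (𝓡 n) 𝓘(ℝ, V) ∞ G)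
    (T : V →L[ℝ] W) (c : W) : ContMDiff (𝓡 n) 𝓘(ℝ, W) ∞ fun y => T (G y) + c :=
  ContDiff.comp_contMDiff (g := fun v => T v + c) (T.contDiff.add contDiff_const) hG

theorem eq_of_chartDeriv_eq_zero [IsManifold (𝓡 n) ∞ M] [ConnectedSpace M] {G : M → V}
    (hG : ContMDiff (𝓡 n) 𝓘(ℝ, V) ∞ G) (h : ∀ x X, chartDeriv n G x X = 0) (x y : M) :
    G x = G y := by
  have : IsManifold (𝓡 n) 1 M := IsManifold.of_le (n := ∞) (by simp)
  refine eq_of_hasMFDerivAt_zero (n := n) (fun z => ?_) x y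
  have h1 := hasMFDerivAt_chartDeriv ((hG z).mdifferentiableAt (by simp))
  have h2 : chartDeriv (V := V) n G z = 0 := by ext1 X; exact h z X
  rw [h2] at h1
  exact h1

theorem isIsometricImmersion_of_chartDeriv [IsManifold (𝓡 n) ∞ M] {g : RiemMetric n M}
    {B : V → V → ℝ} {G : M → V} (hG : ContMDiff (𝓡 n) 𝓘(ℝ, V) ∞ G)
    (h : ∀ x X Y, B (chartDeriv n G x X) (chartDeriv n G x Y) = metricAt g x X Y) :
    IsIsometricImmersion g B G := by
  refine ⟨hG, fun p u v => ?_⟩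
  have hd := (hG p).mdifferentiableAt (by simp)
  have h1 := h p u v
  exact (congrArg₂ B (mfderiv_apply_eq_chartDeriv hd u) (mfderiv_apply_eq_chartDeriv hd v)).trans h1

theorem IsIsometricImmersion.chartDeriv_eq [IsManifold (𝓡 n) ∞ M] {g : RiemMetric n M}
    {B : V → V → ℝ} {G : M → V} (hG : IsIsometricImmersion g B G) (x : M) (X Y : Euc n) :
    B (chartDeriv n G x X) (chartDeriv n G x Y) = metricAt g x X Y := by
  have hd := (hG.1 x).mdifferentiableAt (by simp)
  exact (congrArg₂ B (mfderiv_apply_eq_chartDeriv hd X).symm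
    (mfderiv_apply_eq_chartDeriv hd Y).symm).trans (hG.2 x X Y)

/-- An isometric immersion with values in the image of a linear isometry `K` remains isometric when
it is composed with a left inverse of `K`. -/
theorem isIsometricImmersion_clm_add [IsManifold (𝓡 n) ∞ M] {g : RiemMetric n M}
    {B : V → V → ℝ} {B' : W → W → ℝ} {G : M → V} (hG : ContMDiff (𝓡 n) 𝓘(ℝ, V) ∞ G)
    (hmet : ∀ x X Y, B (chartDeriv n G x X) (chartDeriv n G x Y) = metricAt g x X Y)
    (K : W →L[ℝ] V) (hK : ∀ x y, B (K x) (K y) = B' x y) (T : V →L[ℝ] W)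
    (hKT : ∀ x, K (T (G x)) = G x) (c : W) :
    IsIsometricImmersion g B' fun x => T (G x) + c := by
  refine isIsometricImmersion_of_chartDeriv (contMDiff_clm_add hG T c) fun x X Y => ?_
  have hd := (hG x).mdifferentiableAt (by simp)
  -- Differentiating K ∘ T ∘ G = G shows that tangent vectors, too, are fixed by K ∘ T.
  have h1 : ∀ X, K (T (chartDeriv n G x X)) = chartDeriv n G x X := by
    intro X
    have h2 := chartDeriv_clm_add hd (K.comp T) 0 X
    simp only [ContinuousLinearMap.comp_apply, hKT, add_zero] at h2
    exact h2.symm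
  rw [chartDeriv_clm_add hd, chartDeriv_clm_add hd, ← hK, h1, h1, hmet]

theorem exists_ne_zero_euc (hn : 1 ≤ n) : ∃ X : Euc n, X ≠ 0 := by
  have : Nonempty (Fin n) := ⟨⟨0, hn⟩⟩
  exact exists_ne 0

theorem IsIsometricImmersion.exists_chartDeriv [IsManifold (𝓡 n) ∞ M] {g : RiemMetric n M}
    {B : V → V → ℝ} {G : M → V} (hG : IsIsometricImmersion g B G) (hn : 1 ≤ n) (x : M) :
    ∃ X, 0 < B (chartDeriv n G x X) (chartDeriv n G x X) := by
  obtain ⟨X, hX⟩ := exists_ne_zero_euc hn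
  exact ⟨X, by rw [hG.chartDeriv_eq]; exact metricAt_pos g x hX⟩

theorem two_le_of_inner_eq_zero {m : ℕ} {x y : Euc m} (hx : x ≠ 0) (hy : y ≠ 0)
    (hxy : inner ℝ x y = 0) : 2 ≤ m := by
  have h : LinearIndependent ℝ ![x, y] := by
    refine linearIndependent_of_ne_zero_of_inner_eq_zero ?_ ?_
    · intro i; fin_cases i <;> simp [hx, hy]
    · intro i j hij
      fin_cases i <;> fin_cases j <;> simp_all [real_inner_comm]
  simpa using h.fintype_card_le_finrank

/-- An isometric immersion of constant norm into `ℝ^m` takes values in a sphere of positive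
radius, and `m ≥ 2`. -/
theorem IsIsometricImmersion.of_norm_const [IsManifold (𝓡 n) ∞ M] {g : RiemMetric n M} {m : ℕ}
    {h : M → Euc m} (hh : IsIsometricImmersion g (inner ℝ) h) (hn : 1 ≤ n) (x : M) {ρ : ℝ}
    (hρ : ∀ y, inner ℝ (h y) (h y) = ρ) : 0 < ρ ∧ 2 ≤ m := by
  obtain ⟨X, hX⟩ := hh.exists_chartDeriv hn x
  have hd := hasFDerivAt_chartDeriv ((hh.1 x).mdifferentiableAt (by simp))
  have hX0 : chartDeriv n h x X ≠ 0 := by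
    intro h0; rw [h0] at hX; simp at hX
  -- If `h` vanished at one point, its constant norm would be zero, contradicting that it is an
  -- immersion of a manifold of positive dimension.
  have hx0 : h x ≠ 0 := by
    intro h0
    have hρ0 : ρ = 0 := by rw [← hρ x, h0]; simp
    have hz : ∀ y, h y = 0 := fun y => inner_self_eq_zero.1 ((hρ y).trans hρ0)
    have : h ∘ (extChartAt (𝓡 n) x).symm = fun _ => 0 := by funext y; exact hz _
    rw [this] at hd
    have h1 := hd.unique (hasFDerivAt_const _ _)
    rw [h1] at hX0
    exact hX0 rfl
  -- The position vector and a nonzero tangent vector are orthogonal, so the dimension is at least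
  -- two.
  refine ⟨?_, two_le_of_inner_eq_zero hx0 hX0 ?_⟩
  · rw [← hρ x]; exact real_inner_self_pos.2 hx0
  · have h1 := hd.inner ℝ hd
    have h2 : (fun t => inner ℝ ((h ∘ (extChartAt (𝓡 n) x).symm) t)
        ((h ∘ (extChartAt (𝓡 n) x).symm) t)) = fun _ => ρ := by funext t; exact hρ _
    rw [h2] at h1
    have h3 := congrArg (fun D : Euc n →L[ℝ] ℝ => D X) (h1.unique (hasFDerivAt_const _ _))
    simp [fderivInnerCLM_apply] at h3
    rw [real_inner_comm (h x)] at h3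
    linarith

end Immersion

/-! ### Extrinsic products from orthogonal isometric immersions -/

section Extrinsic

variable {ι : Type} [Fintype ι] [DecidableEq ι] {n : ι → ℕ} {M : ι → Type*}
  [∀ i, TopologicalSpace (M i)] [∀ i, ChartedSpace (Euc (n i)) (M i)]
  [∀ i, IsManifold (𝓡 (n i)) ∞ (M i)] {g : ∀ i, RiemMetric (n i) (M i)} {d : ℕ}

theorem exists_linearIsometry_range (S : Submodule ℝ (Euc d)) :
    ∃ (m : ℕ) (L : Euc m →ₗᵢ[ℝ] Euc d), LinearMap.range L.toLinearMap = S := by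
  refine ⟨Module.finrank ℝ S,
    S.subtypeₗᵢ.comp (stdOrthonormalBasis ℝ S).repr.symm.toLinearIsometry, ?_⟩
  ext x
  constructor
  · rintro ⟨y, rfl⟩
    exact ((stdOrthonormalBasis ℝ S).repr.symm y).2
  · intro hx
    exact ⟨(stdOrthonormalBasis ℝ S).repr ⟨x, hx⟩, by simp⟩

theorem inner_adjoint_isometry {m : ℕ} (L : Euc m →ₗᵢ[ℝ] Euc d) (y : Euc d) (x : Euc m) :
    inner ℝ (L.toContinuousLinearMap.adjoint y) x = inner ℝ y (L x) := by
  rw [ContinuousLinearMap.adjoint_inner_left]; rfl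

/-- A sum of isometric immersions with mutually orthogonal values, and a constant vector, is an
extrinsic product of isometric immersions. -/
theorem exists_extrinsicProduct {H : ∀ i, M i → Euc d}
    (hH : ∀ i, IsIsometricImmersion (g i) (inner ℝ) (H i))
    (horth : ∀ i j, i ≠ j → ∀ x y, inner ℝ (H i x) (H j y) = 0) (b : Euc d) :
    ∃ (Ψ : ExtrinsicProduct ι d) (h : ∀ i, M i → Euc (Ψ.m i)), (∀ i, Ψ.N i = Set.univ) ∧
      (∀ i, IsIsometricImmersion (g i) (inner ℝ) (h i)) ∧
      ∀ p : ∀ i, M i, Ψ.map (fun i => h i (p i)) = ∑ i, H i (p i) + b := by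
  -- The summands of the orthogonal decomposition are the spans of the images of the `H i`.
  choose m L hL using fun i => exists_linearIsometry_range (Submodule.span ℝ (Set.range (H i)))
  have hspan : ∀ i j, i ≠ j → ∀ x ∈ Submodule.span ℝ (Set.range (H i)),
      ∀ y ∈ Submodule.span ℝ (Set.range (H j)), inner ℝ x y = 0 := by
    intro i j hij x hx y hy
    refine Submodule.span_induction ?_ ?_ ?_ ?_ hx
    · rintro _ ⟨x, rfl⟩
      refine Submodule.span_induction ?_ ?_ ?_ ?_ hy
      · rintro _ ⟨y, rfl⟩; exact horth i j hij x y
      · simp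
      · intro y z _ _ h1 h2; rw [inner_add_right, h1, h2, add_zero]
      · intro a y _ h1; rw [inner_smul_right, h1, mul_zero]
    · simp
    · intro y z _ _ h1 h2; rw [inner_add_left, h1, h2, add_zero]
    · intro a y _ h1; rw [inner_smul_left, h1, mul_zero]
  have hmem : ∀ i x, L i x ∈ Submodule.span ℝ (Set.range (H i)) := by
    intro i x; rw [← hL i]; exact ⟨x, rfl⟩
  have orth : ∀ i j, i ≠ j → ∀ x y, inner ℝ (L i x) (L j y) = 0 := fun i j hij x y =>
    hspan i j hij _ (hmem i x) _ (hmem j y)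
  have hLL : ∀ i (z : Euc d), z ∈ Submodule.span ℝ (Set.range (H i)) →
      L i ((L i).toContinuousLinearMap.adjoint z) = z := by
    intro i z hz
    rw [← hL i] at hz
    obtain ⟨y, rfl⟩ := hz
    have h1 : (L i).toContinuousLinearMap.adjoint (L i y) = y := by
      refine ext_inner_right ℝ fun x => ?_
      rw [inner_adjoint_isometry]
      exact (L i).inner_map_map y x
    exact congrArg (L i) h1
  -- The components of `b` in the summands are absorbed into the immersions as translations; the
  -- rest is the constant vector.
  let v : Euc d := b - ∑ i, L i ((L i).toContinuousLinearMap.adjoint b)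
  have hv : ∀ i x, inner ℝ (L i x) v = 0 := by
    intro i x
    simp only [v, inner_sub_right, inner_sum]
    rw [Finset.sum_eq_single i (fun j _ hj => orth i j hj.symm _ _) (by simp),
      (L i).inner_map_map, real_inner_comm _ x, inner_adjoint_isometry, real_inner_comm, sub_self]
  refine ⟨⟨m, L, orth, v, hv, fun _ => Set.univ, fun _ => Or.inl rfl⟩,
    fun i x => (L i).toContinuousLinearMap.adjoint (H i x) +
      (L i).toContinuousLinearMap.adjoint b, fun _ => rfl, fun i => ?_, fun p => ?_⟩
  · exact isIsometricImmersion_clm_add (hH i).1 (hH i).chartDeriv_eq (L i).toContinuousLinearMap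
      (fun x y => (L i).inner_map_map x y) _
      (fun x => hLL i _ (Submodule.subset_span ⟨x, rfl⟩)) _
  · simp only [ExtrinsicProduct.map, map_add, Finset.sum_add_distrib, v]
    rw [Finset.sum_congr rfl fun i _ => hLL i (H i (p i)) (Submodule.subset_span ⟨p i, rfl⟩)]
    abel

theorem ExtrinsicProduct.inner_map_self (Ψ : ExtrinsicProduct ι d) (x : ∀ i, Euc (Ψ.m i)) :
    inner ℝ (Ψ.map x) (Ψ.map x) = ∑ i, inner ℝ (x i) (x i) + inner ℝ Ψ.v Ψ.v := by
  have h1 : inner ℝ (∑ i, Ψ.L i (x i)) Ψ.v = 0 := by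
    rw [sum_inner]; exact Finset.sum_eq_zero fun i _ => Ψ.v_orth i _
  have h2 : inner ℝ (∑ i, Ψ.L i (x i)) (∑ i, Ψ.L i (x i)) = ∑ i, inner ℝ (x i) (x i) := by
    rw [sum_inner]
    refine Finset.sum_congr rfl fun i _ => ?_
    rw [inner_sum, Finset.sum_eq_single i (fun j _ hj => Ψ.orth i j hj.symm _ _) (by simp)]
    exact (Ψ.L i).inner_map_map _ _
  rw [ExtrinsicProduct.map, inner_add_left, inner_add_right, inner_add_right, h2, h1,
    real_inner_comm, h1]
  ring

/-- The spherical case of `exists_extrinsicProduct`. -/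
theorem exists_spherical_extrinsicProduct [∀ i, Nonempty (M i)] (hn : ∀ i, 1 ≤ n i)
    {H : ∀ i, M i → Euc d}
    (hH : ∀ i, IsIsometricImmersion (g i) (inner ℝ) (H i))
    (horth : ∀ i j, i ≠ j → ∀ x y, inner ℝ (H i x) (H j y) = 0) (b : Euc d) {c : ℝ}
    (hc : ∀ p : ∀ i, M i, ∑ i, H i (p i) + b ∈ sphereCurv d c) :
    ∃ (Ψ : ExtrinsicProduct ι d) (h : ∀ i, M i → Euc (Ψ.m i)), Ψ.IsSpherical c ∧
      (∀ i, IsIsometricImmersion (g i) (inner ℝ) (h i) ∧ ∀ q, h i q ∈ Ψ.N i) ∧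
      ∀ p : ∀ i, M i, Ψ.map (fun i => h i (p i)) = ∑ i, H i (p i) + b := by
  obtain ⟨Ψ, h, -, hh, hmap⟩ := exists_extrinsicProduct hH horth b
  let o : ∀ i, M i := fun i => Classical.arbitrary (M i)
  have hsum : ∀ p : ∀ i, M i,
      ∑ i, inner ℝ (h i (p i)) (h i (p i)) + inner ℝ Ψ.v Ψ.v = 1 / c := by
    intro p
    have h1 := hc p
    rw [← hmap p, sphereCurv, Set.mem_ofPred_eq, Ψ.inner_map_self] at h1
    exact h1
  -- In the constant sum of squared norms only the `i`-th term changes when the `i`-th coordinate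
  -- varies.
  have hconst : ∀ i x, inner ℝ (h i x) (h i x) = inner ℝ (h i (o i)) (h i (o i)) := by
    intro i x
    have h1 := hsum (Function.update o i x)
    have h2 := hsum o
    rw [← Finset.add_sum_erase _ _ (Finset.mem_univ i)] at h1 h2
    have h3 : ∑ l ∈ Finset.univ.erase i, inner ℝ (h l (Function.update o i x l))
        (h l (Function.update o i x l)) =
        ∑ l ∈ Finset.univ.erase i, inner ℝ (h l (o l)) (h l (o l)) := by
      refine Finset.sum_congr rfl fun l hl => ?_
      rw [Function.update_of_ne (Finset.ne_of_mem_erase hl)]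
    rw [h3, Function.update_self] at h1
    linarith
  have hpos := fun i => (hh i).of_norm_const (hn i) (o i) (hconst i)
  have hcurv : ∀ i, 0 < 1 / inner ℝ (h i (o i)) (h i (o i)) := fun i =>
    one_div_pos.2 (hpos i).1
  -- The linear data are kept; the full summands are replaced by the spheres on which the `h i` take
  -- their values.
  let Ψ' : ExtrinsicProduct ι d :=
    { Ψ with
      N := fun i => sphereCurv (Ψ.m i) (1 / inner ℝ (h i (o i)) (h i (o i)))
      N_eq := fun i => Or.inr ⟨(hpos i).2, _, hcurv i, rfl⟩ }
  refine ⟨Ψ', h, ⟨fun i => ⟨(hpos i).2, _, hcurv i, rfl⟩, fun x hx => ?_⟩,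
    fun i => ⟨hh i, fun q => ?_⟩, hmap⟩
  · rw [sphereCurv, Set.mem_ofPred_eq, Ψ'.inner_map_self, ← hsum o]
    congr 1
    refine Finset.sum_congr rfl fun i _ => ?_
    have := hx i
    change inner ℝ (x i) (x i) = 1 / (1 / inner ℝ (h i (o i)) (h i (o i))) at this
    rw [this, one_div_one_div]
  · change inner ℝ (h i q) (h i q) = 1 / (1 / inner ℝ (h i (o i)) (h i (o i)))
    rw [one_div_one_div, hconst]

end Extrinsic

/-! ### Time-like splittings and stereographic projection -/

section LorentzSubspaces

variable {d : ℕ}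

/-- A positive definite subspace is the image of a linear isometry of a Euclidean space. -/
theorem exists_isometry_of_posDef (S : Submodule ℝ (Mink d))
    (hS : ∀ x ∈ S, x ≠ 0 → 0 < lor x x) :
    ∃ (m : ℕ) (K : Euc m →ₗ[ℝ] Mink d), (∀ x y, lor (K x) (K y) = inner ℝ x y) ∧
      LinearMap.range K = S := by
  let B : LinearMap.BilinForm ℝ S :=
    LinearMap.mk₂ ℝ (fun x y : S => lor (x : Mink d) (y : Mink d)) (by simp) (by simp) (by simp)
      (by simp)
  have hB : LinearMap.IsSymm B := ⟨fun x y => lor_comm _ _⟩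
  obtain ⟨v, hv⟩ := LinearMap.BilinForm.exists_orthogonal_basis (B := B) hB
  have hpos : ∀ i, 0 < lor (v i : Mink d) (v i) := fun i =>
    hS _ (v i).2 (by simpa using v.ne_zero i)
  let e : Fin (Module.finrank ℝ S) → Mink d := fun i =>
    (√(lor (v i : Mink d) (v i)))⁻¹ • (v i : Mink d)
  have he : ∀ i j, lor (e i) (e j) = if i = j then 1 else 0 := by
    intro i j
    by_cases hij : i = j
    · subst hij
      simp only [e, lor_smul_left, lor_smul_right, if_true]
      rw [← mul_assoc, ← mul_inv, Real.mul_self_sqrt (hpos i).le, inv_mul_cancel₀ (hpos i).ne']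
    · have h0 : lor (v i : Mink d) (v j) = 0 := hv hij
      simp [e, h0, hij]
  let K : Euc (Module.finrank ℝ S) →ₗ[ℝ] Mink d :=
    (Fintype.linearCombination ℝ e).comp (WithLp.linearEquiv 2 ℝ (Fin _ → ℝ)).toLinearMap
  have hKa : ∀ x, K x = ∑ i, x i • e i := fun x => by
    simp [K, Fintype.linearCombination_apply]
  refine ⟨_, K, fun x y => ?_, le_antisymm ?_ ?_⟩
  · rw [hKa, hKa, lor_sum_left, PiLp.inner_apply]
    refine Finset.sum_congr rfl fun i _ => ?_
    rw [lor_sum_right, Finset.sum_eq_single i]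
    · simp [he, mul_comm]
    · intro j _ hj; simp [he, hj.symm]
    · simp
  · rintro _ ⟨x, rfl⟩
    rw [hKa]
    exact S.sum_mem fun i _ => S.smul_mem _ (S.smul_mem _ (v i).2)
  · intro x hx
    refine ⟨WithLp.toLp 2 fun i => v.repr ⟨x, hx⟩ i * √(lor (v i : Mink d) (v i)), ?_⟩
    rw [hKa]
    have h1 := congrArg Subtype.val (v.sum_repr ⟨x, hx⟩)
    rw [Submodule.coe_sum] at h1
    refine Eq.trans ?_ h1
    refine Finset.sum_congr rfl fun i _ => ?_
    have : √(lor (v i : Mink d) (v i)) ≠ 0 := (Real.sqrt_pos.2 (hpos i)).ne'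
    simp [e, smul_smul, mul_assoc, mul_inv_cancel₀ this]

theorem apply_lorAdjoint_of_mem {m : ℕ} {K : Euc m →ₗ[ℝ] Mink d}
    (hK : ∀ x y, lor (K x) (K y) = inner ℝ x y) {Z : Mink d} (hZ : Z ∈ LinearMap.range K) :
    K (lorAdjoint K Z) = Z := by
  obtain ⟨y, rfl⟩ := hZ
  rw [lorAdjoint_apply_self hK]

/-- The orthogonal complement with respect to the Lorentz product. -/
def lorOrth (S : Submodule ℝ (Mink d)) : Submodule ℝ (Mink d) where
  carrier := {x | ∀ y ∈ S, lor x y = 0}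
  add_mem' := fun {x x'} hx hx' y hy => by rw [lor_add_left, hx y hy, hx' y hy, add_zero]
  zero_mem' := fun y _ => lor_zero_left y
  smul_mem' := fun a x hx y hy => by rw [lor_smul_left, hx y hy, mul_zero]

theorem mem_lorOrth {S : Submodule ℝ (Mink d)} {x : Mink d} :
    x ∈ lorOrth S ↔ ∀ y ∈ S, lor x y = 0 := Iff.rfl

/-- An orthogonal decomposition of a Lorentz space into a time-like subspace, which is parametrized
by a Lorentz space, and its space-like complement. -/
theorem exists_decomp_of_timelike (S : Submodule ℝ (Mink d)) {v : Mink d} (hv : v ∈ S)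
    (hvv : lor v v < 0) :
    ∃ (m l : ℕ) (C : Mink m →ₗ[ℝ] Mink d) (T : Mink d →L[ℝ] Mink m) (D : Euc l →ₗ[ℝ] Mink d),
      (∀ X Y, lor (C X) (C Y) = lor X Y) ∧ (∀ x y, lor (D x) (D y) = inner ℝ x y) ∧
      (∀ X y, lor (C X) (D y) = 0) ∧ LinearMap.range C = S ∧ LinearMap.range D = lorOrth S ∧
      (∀ Z, Z = C (T Z) + D (lorAdjoint D Z)) ∧ m + l = d := by
  obtain ⟨u, huS, huu⟩ : ∃ u ∈ S, lor u u = -1 := by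
    refine ⟨(√(-lor v v))⁻¹ • v, S.smul_mem _ hv, ?_⟩
    rw [lor_smul_left, lor_smul_right, ← mul_assoc, ← mul_inv,
      Real.mul_self_sqrt (by linarith), inv_neg, neg_mul, inv_mul_cancel₀ hvv.ne]
  have huu' : lor u u < 0 := by rw [huu]; norm_num
  -- `S` is the sum of the line of `u` and its complement in `S`, which is positive definite. `C`
  -- sends the time axis to `u` and the space axes to this complement.
  obtain ⟨m, K, hK, hKr⟩ := exists_isometry_of_posDef (S ⊓ lorOrth (Submodule.span ℝ {u}))
    (fun x hx hx0 => lor_self_pos_of_timelike huu'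
      (by rw [lor_comm]; exact hx.2 u (Submodule.mem_span_singleton_self u)) hx0)
  obtain ⟨l, D, hD, hDr⟩ := exists_isometry_of_posDef (lorOrth S)
    (fun x hx hx0 => lor_self_pos_of_timelike huu' (by rw [lor_comm]; exact hx u huS) hx0)
  have hKm : ∀ x, K x ∈ S ⊓ lorOrth (Submodule.span ℝ {u}) := fun x => by
    rw [← hKr]; exact ⟨x, rfl⟩
  have hKu : ∀ x, lor (K x) u = 0 := fun x =>
    (hKm x).2 u (Submodule.mem_span_singleton_self u)
  have hDm : ∀ x, ∀ y ∈ S, lor (D x) y = 0 := fun x => by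
    rw [← mem_lorOrth, ← hDr]; exact ⟨x, rfl⟩
  let C : Mink m →ₗ[ℝ] Mink d := K.coprod (LinearMap.toSpanSingleton ℝ _ u)
  have hCa : ∀ X, C X = K X.1 + X.2 • u := fun X => by simp [C]
  have hCS : ∀ X, C X ∈ S := fun X => by
    rw [hCa]; exact S.add_mem (hKm _).1 (S.smul_mem _ huS)
  -- `T` is the inverse of `C` on `S`; the time coordinate carries a minus sign because ⟨u, u⟩ = -1.
  let T : Mink d →L[ℝ] Mink m := (lorAdjoint K).prod (-(lorForm d u))
  have hTa : ∀ Z, T Z = (lorAdjoint K Z, -lor Z u) := fun Z => by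
    rw [lor_comm]; rfl
  have hCC : ∀ X Y, lor (C X) (C Y) = lor X Y := by
    intro X Y
    rw [hCa, hCa]
    simp only [lor_add_left, lor_add_right, lor_smul_left, lor_smul_right, hK, hKu, huu,
      lor_comm u (K _)]
    rw [lor_eq]; ring
  have hCD : ∀ X y, lor (C X) (D y) = 0 := fun X y => by
    rw [lor_comm]; exact hDm y _ (hCS X)
  have hCT : ∀ Z ∈ S, C (T Z) = Z := by
    intro Z hZ
    have h1 : Z + lor Z u • u ∈ LinearMap.range K := by
      rw [hKr]
      refine ⟨S.add_mem hZ (S.smul_mem _ huS), ?_⟩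
      intro y hy
      obtain ⟨a, rfl⟩ := Submodule.mem_span_singleton.1 hy
      simp [huu]
    have h2 := apply_lorAdjoint_of_mem hK h1
    have h3 : lorAdjoint K u = 0 := lorAdjoint_eq_zero fun x => by rw [lor_comm]; exact hKu x
    rw [map_add, map_smul, h3, smul_zero, add_zero] at h2
    rw [hTa, hCa, h2]
    simp
  have hdecomp : ∀ Z, Z = C (T Z) + D (lorAdjoint D Z) := by
    intro Z
    have h1 : Z - C (T Z) ∈ LinearMap.range D := by
      rw [hDr]
      intro y hy
      rw [← hCT y hy, lor_sub_left, hCC, hTa Z, hTa y, hCa, lor_add_right, lor_smul_right,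
        ← inner_lorAdjoint]
      have h1 : lor ((lorAdjoint K Z, -lor Z u) : Mink m) (lorAdjoint K y, -lor y u) =
          inner ℝ (lorAdjoint K Z) (lorAdjoint K y) - lor Z u * lor y u := by
        rw [lor_eq]; ring
      rw [h1]
      ring
    have h2 := apply_lorAdjoint_of_mem hD h1
    have h3 : lorAdjoint D (C (T Z)) = 0 := lorAdjoint_eq_zero fun x => hCD _ x
    rw [map_sub, h3, sub_zero] at h2
    rw [h2]; abel
  refine ⟨m, l, C, T, D, hCC, hD, hCD, le_antisymm ?_ ?_, hDr, hdecomp, ?_⟩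
  · rintro _ ⟨X, rfl⟩; exact hCS X
  · intro Z hZ; exact ⟨T Z, hCT Z hZ⟩
  -- The dimension formula follows from the bijection: (m + 1) + l = d + 1.
  · have hbij : Function.Bijective (C.coprod D) := by
      constructor
      · rw [← LinearMap.ker_eq_bot, LinearMap.ker_eq_bot']
        rintro ⟨X, y⟩ h
        rw [LinearMap.coprod_apply] at h
        have hX : X = 0 := eq_zero_of_lor_eq_zero fun Y => by
          have h1 : lor (C X + D y) (C Y) = 0 := by rw [h]; simp
          rw [lor_add_left, hCC, lor_comm (D y), hCD, add_zero] at h1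
          exact h1
        have hy : y = 0 := by
          have h1 : lor (C X + D y) (D y) = 0 := by rw [h]; simp
          rw [lor_add_left, hCD, hD, zero_add] at h1
          exact inner_self_eq_zero.1 h1
        rw [hX, hy]; rfl
      · intro Z
        exact ⟨(T Z, lorAdjoint D Z), (hdecomp Z).symm⟩
    have h1 := (LinearEquiv.ofBijective _ hbij).finrank_eq
    simp at h1
    omega

/-- The orthogonal complement of a time-like unit vector is a Euclidean space. -/
theorem exists_isometry_timelike_orth {u : Mink d} (huu : lor u u = -1) :
    ∃ K : Euc d →ₗ[ℝ] Mink d, (∀ x y, lor (K x) (K y) = inner ℝ x y) ∧ (∀ x, lor (K x) u = 0) ∧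
      ∀ Z, Z = K (lorAdjoint K Z) - lor Z u • u := by
  obtain ⟨m, K, hK, hKr⟩ := exists_isometry_of_posDef (lorOrth (Submodule.span ℝ {u}))
    (fun x hx hx0 => lor_self_pos_of_timelike (v := u) (by rw [huu]; norm_num)
      (by rw [lor_comm]; exact hx u (Submodule.mem_span_singleton_self u)) hx0)
  have hKu : ∀ x, lor (K x) u = 0 := fun x => by
    have : K x ∈ lorOrth (Submodule.span ℝ {u}) := by rw [← hKr]; exact ⟨x, rfl⟩
    exact this u (Submodule.mem_span_singleton_self u)
  have hdecomp : ∀ Z, Z = K (lorAdjoint K Z) - lor Z u • u := by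
    intro Z
    have h1 : Z + lor Z u • u ∈ LinearMap.range K := by
      rw [hKr]
      intro y hy
      obtain ⟨a, rfl⟩ := Submodule.mem_span_singleton.1 hy
      simp [huu]
    have h2 := apply_lorAdjoint_of_mem hK h1
    have h3 : lorAdjoint K u = 0 := lorAdjoint_eq_zero fun x => by rw [lor_comm]; exact hKu x
    rw [map_add, map_smul, h3, smul_zero, add_zero] at h2
    rw [h2]; simp
  have hm : m = d := by
    have hbij : Function.Bijective (K.coprod (LinearMap.toSpanSingleton ℝ _ u)) := by
      constructor
      · rw [← LinearMap.ker_eq_bot, LinearMap.ker_eq_bot']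
        rintro ⟨x, t⟩ h
        rw [LinearMap.coprod_apply, LinearMap.toSpanSingleton_apply] at h
        have ht : t = 0 := by
          have h1 : lor (K x + t • u) u = 0 := by rw [h]; simp
          simpa [hKu, huu] using h1
        have hx : x = 0 := by
          have h1 : lor (K x + t • u) (K x) = 0 := by rw [h]; simp
          rw [ht, zero_smul, add_zero, hK] at h1
          exact inner_self_eq_zero.1 h1
        rw [hx, ht]; rfl
      · intro Z
        refine ⟨(lorAdjoint K Z, -lor Z u), ?_⟩
        conv_rhs => rw [hdecomp Z]
        simp [sub_eq_add_neg]
    have h1 := (LinearEquiv.ofBijective _ hbij).finrank_eq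
    simpa using h1
  subst hm
  exact ⟨K, hK, hKu, hdecomp⟩

/-- The projection of the unit sphere, seen as a section of the light cone, to `ℝ^N` is a
stereographic projection. -/
theorem exists_stereographic {N : ℕ} (τ : ConeTriple N) {u : Mink (N + 1)} (huu : lor u u = -1)
    {K : Euc (N + 1) →ₗ[ℝ] Mink (N + 1)} (hK : ∀ x y, lor (K x) (K y) = inner ℝ x y)
    (hKu : ∀ x, lor (K x) u = 0) (hdecomp : ∀ Z, Z = K (lorAdjoint K Z) - lor Z u • u) :
    ∃ (e : Euc (N + 1)) (P : Euc (N + 1) → Euc N), IsStereographicProjection e P ∧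
      ∀ x y (r : ℝ), r ≠ 0 → ‖x‖ = 1 → K x + u = r • τ.embed y → x ≠ e ∧ P x = y := by
  have huK : ∀ x, lor u (K x) = 0 := fun x => by rw [lor_comm]; exact hKu x
  have hKTu : lorAdjoint K u = 0 := lorAdjoint_eq_zero huK
  -- The coefficient `w₀` is nonzero because the complement of `u` is positive definite and cannot
  -- contain a nonzero light-like vector.
  obtain ⟨w₀, w', hw, hw0, hw'⟩ : ∃ (w₀ : ℝ) (w' : Euc (N + 1)), τ.w = K w' + w₀ • u ∧ w₀ ≠ 0 ∧
      ‖w'‖ ^ 2 = w₀ ^ 2 := by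
    refine ⟨-lor τ.w u, lorAdjoint K τ.w, ?_, ?_, ?_⟩
    · conv_lhs => rw [hdecomp τ.w]
      rw [neg_smul, sub_eq_add_neg]
    · intro h
      have h1 := hdecomp τ.w
      rw [neg_eq_zero.1 h, zero_smul, sub_zero] at h1
      have h2 := τ.w_null
      rw [h1, hK, inner_self_eq_zero] at h2
      rw [h2, map_zero] at h1
      have h3 := τ.p₀_w
      rw [h1, lor_zero_right] at h3
      exact zero_ne_one h3
    · have h2 := τ.w_null
      rw [hdecomp τ.w] at h2
      simp only [lor_sub_left, lor_sub_right, lor_smul_left, lor_smul_right, hK, hKu, huu,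
        huK, real_inner_self_eq_norm_sq] at h2
      linarith
  -- The pole `e` is the point of the unit sphere whose null vector `K e + u` spans the line of `w`,
  -- that is, the point sent to infinity.
  obtain ⟨e, hwe, hee⟩ : ∃ e, τ.w = w₀ • (K e + u) ∧ inner ℝ e e = (1 : ℝ) := by
    refine ⟨w₀⁻¹ • w', ?_, ?_⟩
    · rw [hw, map_smul, smul_add, smul_smul, mul_inv_cancel₀ hw0, one_smul]
    · rw [inner_smul_left, inner_smul_right, real_inner_self_eq_norm_sq, hw']
      simp; field_simp
  have henorm : ‖e‖ = 1 := by
    rw [real_inner_self_eq_norm_sq] at hee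
    nlinarith [norm_nonneg e]
  -- The projection along `w` onto the image of `K`, identified with ℝ^{N+1}: it sends `K x` to `x`
  -- and `u` to `-e`, and preserves lengths on the orthogonal complement of `w`.
  let pr : Mink (N + 1) →ₗ[ℝ] Euc (N + 1) :=
    (lorAdjoint K).toLinearMap + (lorForm (N + 1) u).toLinearMap.smulRight e
  have hpr : ∀ Z, pr Z = lorAdjoint K Z + lor Z u • e := fun Z => by
    rw [lor_comm]; rfl
  have hprK : ∀ x, pr (K x) = x := fun x => by
    rw [hpr, lorAdjoint_apply_self hK, hKu, zero_smul, add_zero]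
  have hpru : pr u = -e := by
    rw [hpr, hKTu, huu]; simp
  have hprw : pr τ.w = 0 := by
    rw [hwe, map_smul, map_add, hprK, hpru]; simp
  have hlorw : ∀ Z, lor Z τ.w = w₀ * inner ℝ (pr Z) e := by
    intro Z
    rw [hwe, lor_smul_right, lor_add_right, ← inner_lorAdjoint, hpr, inner_add_left,
      inner_smul_left, hee]
    simp
  have hprisom : ∀ Z, lor Z τ.w = 0 → inner ℝ (pr Z) (pr Z) = lor Z Z := by
    intro Z hZ
    have h1 : lor Z Z = inner ℝ (lorAdjoint K Z) (lorAdjoint K Z) - lor Z u ^ 2 := by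
      conv_lhs => rw [hdecomp Z]
      simp only [lor_sub_left, lor_sub_right, lor_smul_left, lor_smul_right, hK, hKu, huu, huK]
      ring
    rw [hlorw, mul_eq_zero, or_iff_right hw0, hpr, inner_add_left, inner_smul_left, hee] at hZ
    simp only [conj_trivial, mul_one] at hZ
    rw [h1, hpr, inner_add_left, inner_add_right, inner_add_right, inner_smul_left,
      inner_smul_left, inner_smul_right, inner_smul_right, hee,
      real_inner_comm (lorAdjoint K Z) e]
    have h2 : inner ℝ (lorAdjoint K Z) e = -lor Z u := by linarith
    simp only [conj_trivial, h2]
    ring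
  let L : Euc N →ₗᵢ[ℝ] Euc (N + 1) :=
    (pr.comp τ.A).isometryOfInner (fun x y => by
      have hq : ∀ z, inner ℝ (pr (τ.A z)) (pr (τ.A z)) = inner ℝ z z := fun z => by
        rw [hprisom _ (τ.A_w z), τ.A_isom]
      have h1 := hq (x + y)
      simp only [map_add, inner_add_left, inner_add_right, hq, real_inner_comm (pr (τ.A x)),
        real_inner_comm x y] at h1
      simp only [LinearMap.comp_apply]
      have h2 := real_inner_comm (pr (τ.A x)) (pr (τ.A y))
      have h3 := real_inner_comm x y
      linarith)
  -- The hyperplane is parametrised by y ↦ e + pr (E y). Since pr (K x + u) = x - e, rescaling `K x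
  -- + u` becomes moving on the line through `e` and `x`.
  let J : Euc N →ᵃⁱ[ℝ] Euc (N + 1) :=
    (AffineIsometryEquiv.constVAdd ℝ (Euc (N + 1)) (e + pr τ.p₀)).toAffineIsometry.comp
      L.toAffineIsometry
  have hJ : ∀ y, J y = e + pr τ.p₀ + pr (τ.A y) := fun y => rfl
  have hJe : ∀ y, J y = e + pr (τ.embed y) := fun y => by
    rw [hJ, ConeTriple.embed, map_sub, map_add, map_smul, hprw]
    simp [add_assoc]
  have hne : ∀ x : Euc (N + 1), ‖x‖ = 1 → x ≠ e → inner ℝ x e - 1 ≠ (0 : ℝ) := by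
    intro x hx hxe h
    exact hxe ((inner_eq_one_iff_of_norm_eq_one (𝕜 := ℝ) hx henorm).1 (by linarith))
  have hxw : ∀ x, lor (K x + u) τ.w = w₀ * (inner ℝ x e - 1) := by
    intro x
    rw [hlorw, map_add, hprK, hpru, inner_add_left, inner_neg_left, hee]
    ring
  have hxx : ∀ x, ‖x‖ = 1 → lor (K x + u) (K x + u) = 0 := by
    intro x hx
    simp [hK, hKu, huK, huu, hx]
  -- The height of the hyperplane is 1 + w₀⁻¹, because ⟨E y, w⟩ = 1 and ⟨·, w⟩ = w₀⟨pr ·, e⟩.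
  refine ⟨e, fun x => lorAdjoint τ.A ((lor (K x + u) τ.w)⁻¹ • (K x + u)),
    ⟨henorm, 1 + w₀⁻¹, J, ?_, ?_, ?_⟩, ?_⟩
  · simp [hw0]
  · ext y
    constructor
    · rintro ⟨x, rfl⟩
      change inner ℝ (J x) e = 1 + w₀⁻¹
      have h1 := hlorw (τ.embed x)
      rw [τ.lor_embed_w] at h1
      rw [hJe, inner_add_left, hee]
      congr 1
      field_simp
      linarith
    · intro hy
      change inner ℝ y e = 1 + w₀⁻¹ at hy
      set y' := y - (e + pr τ.p₀) with hy'
      have h0 : inner ℝ (pr τ.p₀) e = w₀⁻¹ := by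
        have h1 := hlorw τ.p₀
        rw [τ.p₀_w] at h1
        field_simp
        linarith
      have h1 : lor (K y') τ.w = 0 := by
        rw [hlorw, hprK, hy', inner_sub_left, inner_add_left, hee, h0, hy]
        simp
      have h2 := congrArg pr (τ.decomp (K y'))
      rw [h1, zero_smul, zero_add, map_add, map_smul, hprw, smul_zero, add_zero, hprK] at h2
      refine ⟨lorAdjoint τ.A (K y'), ?_⟩
      rw [hJ, ← h2, hy']
      abel
  · intro x hx hxe
    have h1 : lor (K x + u) τ.w ≠ 0 := by
      rw [hxw]; exact mul_ne_zero hw0 (hne x hx hxe)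
    refine ⟨(lor (K x + u) τ.w)⁻¹, ?_⟩
    rw [hJe, τ.embed_lorAdjoint, map_smul, map_add, hprK, hpru, AffineMap.lineMap_apply]
    · simp only [vsub_eq_sub, vadd_eq_add, sub_eq_add_neg]
      abel
    · rw [lor_smul_left, lor_smul_right, hxx x hx, mul_zero, mul_zero]
    · rw [lor_smul_left, inv_mul_cancel₀ h1]
  · intro x y r hr hx h
    have h1 : lor (K x + u) τ.w = r := by
      rw [h, lor_smul_left, τ.lor_embed_w, mul_one]
    refine ⟨?_, ?_⟩
    · rintro hxe
      rw [hxw, hxe, hee] at h1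
      simp at h1
      exact hr h1.symm
    · change lorAdjoint τ.A ((lor (K x + u) τ.w)⁻¹ • (K x + u)) = y
      rw [h1, h, smul_smul, inv_mul_cancel₀ hr, one_smul, τ.lorAdjoint_embed]

end LorentzSubspaces

/-! ### The split lift and the spherical case -/

section SplitLift

variable {k N : ℕ} {n : Fin k → ℕ} {M : Fin k → Type*} [∀ i, TopologicalSpace (M i)]
  [∀ i, ChartedSpace (Euc (n i)) (M i)] [∀ i, IsManifold (𝓡 (n i)) ∞ (M i)]

/-- The lift of `f` to the light cone of `𝕃^{N+2}` is the sum of isometric immersions `G i` of the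
factors with mutually orthogonal values, and a constant vector `F₀`. -/
structure IsSplitLift (τ : ConeTriple N) (g : ∀ i, RiemMetric (n i) (M i))
    (f : (∀ i, M i) → Euc N) (F₀ : Mink (N + 1)) (G : ∀ i, M i → Mink (N + 1))
    (o : ∀ i, M i) : Prop where
  isom : ∀ i, IsIsometricImmersion (g i) lor (G i)
  orth : ∀ i j, i ≠ j → ∀ x y, lor (G i x) (G j y) = 0
  base : ∀ i, G i (o i) = 0
  lift : ∀ p : ∀ i, M i, ∃ r : ℝ, 0 < r ∧ F₀ + ∑ i, G i (p i) = r • τ.embed (f p)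

section Existence

variable [∀ i, ConnectedSpace (M i)]

/-- Orthogonality of the differentials is integrated first over one factor and then over the other,
starting at points where the maps vanish. -/
theorem lor_eq_zero_of_chartDeriv {i j : Fin k} {G : M i → Mink N} {G' : M j → Mink N}
    (hG : ContMDiff (𝓡 (n i)) 𝓘(ℝ, Mink N) ∞ G) (hG' : ContMDiff (𝓡 (n j)) 𝓘(ℝ, Mink N) ∞ G')
    {x₀ : M i} {y₀ : M j} (hx₀ : G x₀ = 0) (hy₀ : G' y₀ = 0)
    (h : ∀ x y X Y, lor (chartDeriv (n i) G x X) (chartDeriv (n j) G' y Y) = 0) (x : M i)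
    (y : M j) : lor (G x) (G' y) = 0 := by
  have h1 : ∀ x y Y, lor (G x) (chartDeriv (n j) G' y Y) = 0 := by
    intro x y Y
    have h2 : ∀ z X, chartDeriv (n i)
        (fun z => lorForm N (chartDeriv (n j) G' y Y) (G z) + (0 : ℝ)) z X = 0 := by
      intro z X
      rw [chartDeriv_clm_add ((hG z).mdifferentiableAt (by simp)), lorForm_apply, lor_comm, h]
    have h3 := eq_of_chartDeriv_eq_zero (contMDiff_clm_add hG _ 0) h2 x x₀
    simp only [hx₀, map_zero, add_zero, lorForm_apply] at h3
    rw [lor_comm, h3]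
  have h2 : ∀ z X, chartDeriv (n j) (fun z => lorForm N (G x) (G' z) + (0 : ℝ)) z X = 0 := by
    intro z X
    rw [chartDeriv_clm_add ((hG' z).mdifferentiableAt (by simp)), lorForm_apply, h1]
  have h3 := eq_of_chartDeriv_eq_zero (contMDiff_clm_add hG' _ 0) h2 y y₀
  simpa only [hy₀, map_zero, add_zero, lorForm_apply] using h3

/-- The `G i` are the increments of the lift along the factors through `o`. They carry the tangent
vectors of the lift, so isometry and orthogonality pass to them. -/
theorem exists_isSplitLift (τ : ConeTriple N) (hn : ∀ i, 1 ≤ n i) (hn3 : 3 ≤ ∑ i, n i)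
    {g : ∀ i, RiemMetric (n i) (M i)} {f : (∀ i, M i) → Euc N} (hf : IsConformalImmersion g f)
    (hadapted : IsAdaptedToProductNet n f) (o : ∀ i, M i) :
    ∃ F₀ G, IsSplitLift τ g f F₀ G o := by
  obtain ⟨hf, φ, hφ, hφ0, hconf⟩ := hf
  have hiso := lift_isProductIsometry τ hf hφ hφ0 hconf
  have hmix := lift_mixedDerivZero τ hf hφ hφ0 hconf hn hn3 hadapted
  have hlift : ∀ p, ∃ r : ℝ, 0 < r ∧ (φ p)⁻¹ • τ.embed (f p) = r • τ.embed (f p) :=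
    fun p => ⟨_, inv_pos.2 (hφ0 p), rfl⟩
  set F : (∀ i, M i) → Mink (N + 1) := fun p => (φ p)⁻¹ • τ.embed (f p) with hF
  set G : ∀ i, M i → Mink (N + 1) := fun i x => slice F o i x - F o with hG
  have hsplit : ∀ p, F p = F o + ∑ i, G i (p i) := eq_add_sum_slice hiso.smooth hmix o
  have hGs : ∀ i, ContMDiff (𝓡 (n i)) 𝓘(ℝ, Mink (N + 1)) ∞ (G i) := by
    intro i
    have h := contMDiff_clm_add (contMDiff_slice hiso.smooth o i)
      (ContinuousLinearMap.id ℝ (Mink (N + 1))) (-F o)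
    simpa only [ContinuousLinearMap.id_apply, ← sub_eq_add_neg] using h
  have hbase : ∀ i, G i (o i) = 0 := fun i => by simp [hG, slice]
  have hder : ∀ p i X, chartDeriv (n i) (slice F p i) (p i) X = chartDeriv (n i) (G i) (p i) X := by
    intro p i X
    have h1 : slice F p i = fun x => ContinuousLinearMap.id ℝ (Mink (N + 1)) (G i x) +
        (F o + ∑ l ∈ Finset.univ.erase i, G l (p l)) := by
      funext x
      rw [slice, hsplit, ← Finset.add_sum_erase _ _ (Finset.mem_univ i), Function.update_self]
      have h3 : ∑ l ∈ Finset.univ.erase i, G l (Function.update p i x l) =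
          ∑ l ∈ Finset.univ.erase i, G l (p l) := by
        refine Finset.sum_congr rfl fun l hl => ?_
        rw [Function.update_of_ne (Finset.ne_of_mem_erase hl)]
      rw [h3, ContinuousLinearMap.id_apply]
      abel
    rw [h1, chartDeriv_clm_add ((hGs i _).mdifferentiableAt (by simp))]
    rfl
  refine ⟨F o, G, ⟨fun i => ?_, fun i j hij x y => ?_, hbase, fun p => ?_⟩⟩
  · refine isIsometricImmersion_of_chartDeriv (hGs i) fun x X Y => ?_
    have h1 := hiso.diag (Function.update o i x) i X Y
    rw [hder, hder, Function.update_self] at h1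
    exact h1
  · refine lor_eq_zero_of_chartDeriv (hGs i) (hGs j) (hbase i) (hbase j) (fun x y X Y => ?_) x y
    -- Both differentials are read at one point of the product, with components `x` and `y`.
    have h1 := hiso.orth (Function.update (Function.update o i x) j y) i j hij X Y
    rw [hder, hder, Function.update_self, Function.update_of_ne hij, Function.update_self] at h1
    exact h1
  · rw [← hsplit]
    exact hlift p

end Existence

namespace IsSplitLift

variable {τ : ConeTriple N} {g : ∀ i, RiemMetric (n i) (M i)} {f : (∀ i, M i) → Euc N}
  {F₀ : Mink (N + 1)} {G : ∀ i, M i → Mink (N + 1)} {o : ∀ i, M i}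

theorem lor_self (h : IsSplitLift τ g f F₀ G o) (p : ∀ i, M i) :
    lor (F₀ + ∑ i, G i (p i)) (F₀ + ∑ i, G i (p i)) = 0 := by
  obtain ⟨r, -, hr⟩ := h.lift p
  rw [hr, lor_smul_left, lor_smul_right, τ.lor_embed_embed]
  simp

theorem orth_span (h : IsSplitLift τ g f F₀ G o) {i j : Fin k} (hij : i ≠ j) {x y : Mink (N + 1)}
    (hx : x ∈ Submodule.span ℝ (Set.range (G i))) (hy : y ∈ Submodule.span ℝ (Set.range (G j))) :
    lor x y = 0 := by
  refine Submodule.span_induction ?_ ?_ ?_ ?_ hx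
  · rintro _ ⟨x, rfl⟩
    refine Submodule.span_induction ?_ ?_ ?_ ?_ hy
    · rintro _ ⟨y, rfl⟩; exact h.orth i j hij x y
    · simp
    · intro y z _ _ h1 h2; rw [lor_add_right, h1, h2, add_zero]
    · intro a y _ h1; rw [lor_smul_right, h1, mul_zero]
  · simp
  · intro y z _ _ h1 h2; rw [lor_add_left, h1, h2, add_zero]
  · intro a y _ h1; rw [lor_smul_left, h1, mul_zero]

theorem mem_span (i : Fin k) (x : M i) : G i x ∈ Submodule.span ℝ (Set.range (G i)) :=
  Submodule.subset_span ⟨x, rfl⟩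

theorem not_const (h : IsSplitLift τ g f F₀ G o) (hn : ∀ i, 1 ≤ n i) (i : Fin k)
    (hc : ∀ x, G i x = 0) : False := by
  obtain ⟨X, hX⟩ := (h.isom i).exists_chartDeriv (hn i) (o i)
  have h1 : G i = fun _ => 0 := funext hc
  have h2 : chartDeriv (n i) (G i) (o i) X = 0 := by
    rw [chartDeriv, h1]
    have : ((fun _ => 0 : M i → Mink (N + 1)) ∘ (extChartAt (𝓡 (n i)) (o i)).symm) = fun _ => 0 :=
      rfl
    rw [this]
    simp
  rw [h2] at hX
  simp at hX

/-- If all spans are positive definite, `f` comes from an extrinsic product of spheres. -/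
theorem caseSphere (h : IsSplitLift τ g f F₀ G o) (hn : ∀ i, 1 ≤ n i) (i₀ : Fin k)
    (hpos : ∀ i, ∀ x ∈ Submodule.span ℝ (Set.range (G i)), x ≠ 0 → 0 < lor x x) :
    CaseSphere g f := by
  choose m K hK hKr using fun i => exists_isometry_of_posDef _ (hpos i)
  have hKm : ∀ i y, K i y ∈ Submodule.span ℝ (Set.range (G i)) := fun i y => by
    rw [← hKr i]; exact ⟨y, rfl⟩
  have hKorth : ∀ i j, i ≠ j → ∀ x y, lor (K i x) (K j y) = 0 := fun i j hij x y =>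
    h.orth_span hij (hKm i x) (hKm j y)
  have hKG : ∀ i x, K i (lorAdjoint (K i) (G i x)) = G i x := fun i x =>
    apply_lorAdjoint_of_mem (hK i) (by rw [hKr i]; exact mem_span i x)
  -- The component of `F₀` orthogonal to all spans. It is the constant part of the lift, and nullity
  -- of the lift gives `hsum`.
  obtain ⟨v, hv⟩ : ∃ v, v = F₀ - ∑ i, K i (lorAdjoint (K i) F₀) := ⟨_, rfl⟩
  have hvK : ∀ i y, lor v (K i y) = 0 := by
    intro i y
    rw [hv, lor_sub_left, lor_sum_left,
      Finset.sum_eq_single i (fun j _ hj => hKorth j i hj _ _) (by simp), hK, inner_lorAdjoint,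
      sub_self]
  have hvS : ∀ y : ∀ i, Euc (m i), lor v (∑ i, K i (y i)) = 0 := fun y => by
    rw [lor_sum_right]; exact Finset.sum_eq_zero fun i _ => hvK i _
  have hvG : ∀ i x, lor v (G i x) = 0 := fun i x => by rw [← hKG i x]; exact hvK i _
  have hFsum : ∀ p : ∀ i, M i, F₀ + ∑ i, G i (p i) =
      v + ∑ i, K i (lorAdjoint (K i) (F₀ + G i (p i))) := by
    intro p
    simp only [map_add, hKG, Finset.sum_add_distrib, hv]
    abel
  have hsum : ∀ p : ∀ i, M i, lor v v + ∑ i, ‖lorAdjoint (K i) (F₀ + G i (p i))‖ ^ 2 = 0 := by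
    intro p
    have h1 := h.lor_self p
    rw [hFsum, lor_add_left, lor_add_right, lor_add_right, hvS, lor_comm (∑ i, _) v, hvS,
      lor_sum_left] at h1
    have h2 : ∀ i, lor (K i (lorAdjoint (K i) (F₀ + G i (p i))))
        (∑ i, K i (lorAdjoint (K i) (F₀ + G i (p i)))) =
        ‖lorAdjoint (K i) (F₀ + G i (p i))‖ ^ 2 := by
      intro i
      rw [lor_sum_right, Finset.sum_eq_single i (fun j _ hj => hKorth i j hj.symm _ _) (by simp),
        hK, real_inner_self_eq_norm_sq]
    simp only [h2] at h1
    linarith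
  -- By `hsum`, -⟨v, v⟩ is a sum of squares. If it were zero, all summands would vanish identically
  -- and `G i₀` would be constant.
  have hvv : lor v v < 0 := by
    have hnn : ∀ p : ∀ i, M i, 0 ≤ ∑ i, ‖lorAdjoint (K i) (F₀ + G i (p i))‖ ^ 2 := fun p =>
      Finset.sum_nonneg fun i _ => sq_nonneg _
    have h0 := hsum o
    rcases (show lor v v ≤ 0 by linarith [hnn o]).lt_or_eq with hlt | heq
    · exact hlt
    exfalso
    have hz : ∀ p : ∀ i, M i, ∀ i, lorAdjoint (K i) (F₀ + G i (p i)) = 0 := by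
      intro p i
      have h1 := hsum p
      rw [heq, zero_add, Finset.sum_eq_zero_iff_of_nonneg (fun i _ => sq_nonneg _)] at h1
      simpa using h1 i (Finset.mem_univ i)
    refine h.not_const hn i₀ fun x => ?_
    have h1 := hz o i₀
    have h2 := hz (Function.update o i₀ x) i₀
    rw [h.base, add_zero] at h1
    rw [Function.update_self, map_add, h1, zero_add] at h2
    rw [← hKG i₀ x, h2, map_zero]
  -- The lift has constant product -R with the unit vector `u` along `v`, so its part orthogonal to
  -- `u` lies on the sphere of radius `R`; hence c = 1 / R² and the homothety of ratio 1 / R below.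
  obtain ⟨R, hR, hRv⟩ : ∃ R : ℝ, 0 < R ∧ lor v v = -(R * R) :=
    ⟨√(-lor v v), Real.sqrt_pos.2 (by linarith), by rw [Real.mul_self_sqrt (by linarith)]; ring⟩
  obtain ⟨u, hu⟩ : ∃ u, u = R⁻¹ • v := ⟨_, rfl⟩
  have huu : lor u u = -1 := by
    rw [hu, lor_smul_left, lor_smul_right, hRv]; field_simp
  have huG : ∀ i x, lor (G i x) u = 0 := fun i x => by
    rw [hu, lor_smul_right, lor_comm, hvG, mul_zero]
  have hFu : ∀ p : ∀ i, M i, lor (F₀ + ∑ i, G i (p i)) u = -R := by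
    intro p
    rw [hu, lor_smul_right, hFsum, lor_add_left, lor_comm (∑ i, _) v, hvS, hRv]
    field_simp
    ring
  obtain ⟨Q, hQ, hQu, hQd⟩ := exists_isometry_timelike_orth huu
  obtain ⟨e, P, hP, hPe⟩ := exists_stereographic τ huu hQ hQu hQd
  have hQG : ∀ i x, Q (lorAdjoint Q (G i x)) = G i x := by
    intro i x
    conv_rhs => rw [hQd (G i x), huG, zero_smul, sub_zero]
  have hQF : ∀ p : ∀ i, M i, F₀ + ∑ i, G i (p i) =
      Q (∑ i, (lorAdjoint Q (G i (p i)) + 0) + lorAdjoint Q F₀) + R • u := by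
    intro p
    conv_lhs => rw [hQd (F₀ + ∑ i, G i (p i)), hFu]
    rw [neg_smul, sub_neg_eq_add]
    simp only [map_add, map_sum, add_zero]
    congr 1
    abel
  have hsph : ∀ p : ∀ i, M i,
      ∑ i, (lorAdjoint Q (G i (p i)) + 0) + lorAdjoint Q F₀ ∈ sphereCurv (N + 1) (1 / (R * R)) := by
    intro p
    have h1 := h.lor_self p
    rw [hQF p] at h1
    simp only [lor_add_left, lor_add_right, lor_smul_left, lor_smul_right, hQ, hQu, huu,
      lor_comm u (Q _)] at h1
    change inner ℝ _ _ = 1 / (1 / (R * R))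
    rw [one_div_one_div]
    linarith
  have : ∀ i, Nonempty (M i) := fun i => ⟨o i⟩
  obtain ⟨Ψ, hh, hΨ, hiso, hmap⟩ := exists_spherical_extrinsicProduct
    (M := M) (g := g) (H := fun i x => lorAdjoint Q (G i x) + 0)
    hn
    (fun i => isIsometricImmersion_clm_add (h.isom i).1 (h.isom i).chartDeriv_eq
      (LinearMap.toContinuousLinearMap Q) hQ (lorAdjoint Q) (hQG i) 0)
    (fun i j hij x y => by
      simp only [add_zero]
      rw [← hQ, hQG, hQG, h.orth i j hij]) (lorAdjoint Q F₀) hsph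
  have hhom : ∀ x : Euc (N + 1), AffineMap.homothety (0 : Euc (N + 1)) R⁻¹ x = R⁻¹ • x := by
    simp [AffineMap.homothety_apply]
  have hmem : ∀ x : Euc (N + 1), x ∈ sphereCurv (N + 1) (1 / (R * R)) ↔ ‖x‖ = R := by
    intro x
    change inner ℝ x x = 1 / (1 / (R * R)) ↔ _
    rw [one_div_one_div, real_inner_self_eq_norm_mul_norm]
    exact mul_self_inj (norm_nonneg x) hR.le
  refine ⟨1 / (R * R), Ψ, hh, 0, R⁻¹, e, P, by positivity, hΨ, hiso, inv_pos.2 hR, ?_, hP, ?_⟩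
  · ext x
    simp only [Set.mem_image, mem_sphere_zero_iff_norm, hmem, hhom]
    constructor
    · rintro ⟨y, hy, rfl⟩
      rw [norm_smul, hy, norm_inv, Real.norm_of_nonneg hR.le, inv_mul_cancel₀ hR.ne']
    · intro hx
      refine ⟨R • x, ?_, ?_⟩
      · rw [norm_smul, hx, Real.norm_of_nonneg hR.le, mul_one]
      · rw [smul_smul, inv_mul_cancel₀ hR.ne', one_smul]
  · intro p
    obtain ⟨r, hr, hrF⟩ := h.lift p
    rw [hhom, hmap]
    have h1 := hPe (R⁻¹ • (∑ i, (lorAdjoint Q (G i (p i)) + 0) + lorAdjoint Q F₀)) (f p)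
      (R⁻¹ * r) (by positivity) (by
        rw [norm_smul, (hmem _).1 (hsph p), norm_inv, Real.norm_of_nonneg hR.le,
          inv_mul_cancel₀ hR.ne']) (by
        rw [mul_smul, ← hrF, hQF p, map_smul, smul_add, smul_smul R⁻¹ R,
          inv_mul_cancel₀ hR.ne', one_smul])
    exact ⟨h1.1, h1.2.symm⟩

end IsSplitLift

end SplitLift

/-! ### The flat case -/

section Cases

variable {k N : ℕ} {n : Fin k → ℕ} {M : Fin k → Type*} [∀ i, TopologicalSpace (M i)]
  [∀ i, ChartedSpace (Euc (n i)) (M i)] [∀ i, IsManifold (𝓡 (n i)) ∞ (M i)]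
  {τ : ConeTriple N} {g : ∀ i, RiemMetric (n i) (M i)} {f : (∀ i, M i) → Euc N}
  {F₀ : Mink (N + 1)} {G : ∀ i, M i → Mink (N + 1)} {o : ∀ i, M i}

namespace IsSplitLift

/-- A linear map that is isometric on the orthogonal complement of a vector `z` orthogonal to all
`G i` turns `F₀ + ∑ i, G i`, up to a constant, into an extrinsic product. -/
theorem exists_flat (h : IsSplitLift τ g f F₀ G o) {z : Mink (N + 1)}
    (hz : ∀ i x, lor z (G i x) = 0) (T : Mink (N + 1) →L[ℝ] Euc N)
    (hT : ∀ Z Z', lor z Z = 0 → lor z Z' = 0 → inner ℝ (T Z) (T Z') = lor Z Z') (b : Euc N) :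
    ∃ (Ψ : ExtrinsicProduct (Fin k) N) (hh : ∀ i, M i → Euc (Ψ.m i)),
      (∀ i, IsIsometricImmersion (g i) (inner ℝ) (hh i) ∧ ∀ q, hh i q ∈ Ψ.N i) ∧
      ∀ p : ∀ i, M i, Ψ.map (fun i => hh i (p i)) = T (F₀ + ∑ i, G i (p i)) + b := by
  have hder : ∀ i x X, lor z (chartDeriv (n i) (G i) x X) = 0 := by
    intro i x X
    have h1 := chartDeriv_clm_add (((h.isom i).1 x).mdifferentiableAt (by simp))
      (lorForm (N + 1) z) (0 : ℝ) X
    simp only [lorForm_apply, hz, add_zero] at h1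
    rw [← h1, chartDeriv]
    have : ((fun _ => 0 : M i → ℝ) ∘ (extChartAt (𝓡 (n i)) x).symm) = fun _ => 0 := rfl
    rw [this]
    simp
  obtain ⟨Ψ, hh, hN, hiso, hmap⟩ := exists_extrinsicProduct (M := M) (g := g)
    (H := fun i x => T (G i x) + 0)
    (fun i => isIsometricImmersion_of_chartDeriv (contMDiff_clm_add (h.isom i).1 T 0)
      fun x X Y => by
        have hd := ((h.isom i).1 x).mdifferentiableAt (n := ∞) (by simp)
        rw [chartDeriv_clm_add hd, chartDeriv_clm_add hd, hT _ _ (hder i x X) (hder i x Y)]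
        exact (h.isom i).chartDeriv_eq x X Y)
    (fun i j hij x y => by
      simp only [add_zero]
      rw [hT _ _ (hz i x) (hz j y), h.orth i j hij]) (T F₀ + b)
  refine ⟨Ψ, hh, fun i => ⟨hiso i, fun q => ?_⟩, fun p => ?_⟩
  · rw [hN]; trivial
  · rw [hmap]
    simp only [add_zero, map_add, map_sum]
    abel

/-- If some span is degenerate, `f` comes from an extrinsic product in `ℝ^N`. -/
theorem caseFlat (h : IsSplitLift τ g f F₀ G o) (hn : ∀ i, 1 ≤ n i)
    (hnn : ∀ i, ∀ x ∈ Submodule.span ℝ (Set.range (G i)), 0 ≤ lor x x) {j : Fin k}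
    {z : Mink (N + 1)} (hzj : z ∈ Submodule.span ℝ (Set.range (G j))) (hz0 : z ≠ 0)
    (hzz : lor z z = 0) : CaseFlat g f := by
  have hzG : ∀ i x, lor z (G i x) = 0 := by
    intro i x
    by_cases hij : j = i
    · subst hij
      exact lor_eq_zero_of_null (hnn j) hzj hzz (mem_span j x)
    · exact h.orth_span hij hzj (mem_span i x)
  have hzF : ∀ p : ∀ i, M i, lor z (F₀ + ∑ i, G i (p i)) = lor z F₀ := by
    intro p
    rw [lor_add_right, lor_sum_right, Finset.sum_eq_zero (fun i _ => hzG i _), add_zero]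
  -- Otherwise all values of the lift are light-like and orthogonal to `z`, hence multiples of `z`.
  -- Then `G j` takes values in a null line, which no isometric immersion does.
  have hκ : lor z F₀ ≠ 0 := by
    intro h0
    have hmul : ∀ x, ∃ a : ℝ, G j x = a • z := by
      intro x
      obtain ⟨a, ha⟩ := exists_smul_of_null hzz hz0 (h.lor_self o) ((hzF o).trans h0)
      obtain ⟨b, hb⟩ := exists_smul_of_null hzz hz0 (h.lor_self (Function.update o j x))
        ((hzF _).trans h0)
      refine ⟨b - a, ?_⟩
      rw [sub_smul, ← ha, ← hb]
      rw [Finset.sum_eq_single j, Finset.sum_eq_zero, Function.update_self]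
      · simp
      · intro i _; exact h.base i
      · intro i _ hi
        rw [Function.update_of_ne hi, h.base]
      · simp
    have hd : ∀ x, MDifferentiableAt (𝓡 (n j)) 𝓘(ℝ, Mink (N + 1)) (G j) x := fun x =>
      ((h.isom j).1 x).mdifferentiableAt (by simp)
    have hzero : ∀ x, chartDeriv (n j) (fun _ : M j => (0 : ℝ)) x = 0 := by
      intro x
      rw [chartDeriv]
      have : ((fun _ => 0 : M j → ℝ) ∘ (extChartAt (𝓡 (n j)) x).symm) = fun _ => 0 := rfl
      rw [this]
      simp
    have h1 : ∀ x y X, lor (G j x) (chartDeriv (n j) (G j) y X) = 0 := by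
      intro x y X
      have h2 := chartDeriv_clm_add (hd y) (lorForm (N + 1) (G j x)) (0 : ℝ) X
      have h3 : (fun y => lorForm (N + 1) (G j x) (G j y) + (0 : ℝ)) = fun _ => 0 := by
        funext y
        obtain ⟨a, ha⟩ := hmul x
        obtain ⟨b, hb⟩ := hmul y
        rw [lorForm_apply, ha, hb]
        simp [hzz]
      rw [h3, hzero] at h2
      exact h2.symm
    obtain ⟨X, hX⟩ := (h.isom j).exists_chartDeriv (hn j) (o j)
    have h2 := chartDeriv_clm_add (hd (o j))
      (lorForm (N + 1) (chartDeriv (n j) (G j) (o j) X)) (0 : ℝ) X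
    have h3 : (fun y => lorForm (N + 1) (chartDeriv (n j) (G j) (o j) X) (G j y) + (0 : ℝ)) =
        fun _ => 0 := by
      funext y
      rw [lorForm_apply, lor_comm, h1, add_zero]
    rw [h3, hzero] at h2
    exact hX.ne h2
  by_cases hw : lor z τ.w = 0
  · have hw0 : τ.w ≠ 0 := fun h0 => by
      have := τ.p₀_w
      rw [h0, lor_zero_right] at this
      exact zero_ne_one this
    -- Here `z` and `w` span the same line, so ⟨F, w⟩ is constant and `f` is a fixed multiple of the
    -- `A`-component of the lift.
    obtain ⟨μ, hμ⟩ := exists_smul_of_null hzz hz0 τ.w_null hw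
    have hμ0 : μ ≠ 0 := by rintro rfl; rw [zero_smul] at hμ; exact hw0 hμ
    obtain ⟨Ψ, hh, hiso, hmap⟩ := h.exists_flat hzG (lorAdjoint τ.A) (fun Z Z' hZ hZ' => by
      rw [τ.lor_eq_of_decomp Z Z', lor_comm Z τ.w, lor_comm Z' τ.w, hμ, lor_smul_left,
        lor_smul_left, hZ, hZ']
      ring) 0
    have hr : ∀ p : ∀ i, M i, 0 < μ * lor z F₀ ∧
        f p = (μ * lor z F₀)⁻¹ • lorAdjoint τ.A (F₀ + ∑ i, G i (p i)) := by
      intro p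
      obtain ⟨r, hr, hrF⟩ := h.lift p
      have h1 : μ * lor z F₀ = r := by
        rw [← hzF p, ← lor_smul_left, ← hμ, hrF, lor_smul_right, lor_comm, τ.lor_embed_w, mul_one]
      refine ⟨by rw [h1]; exact hr, ?_⟩
      rw [h1, hrF, map_smul, τ.lorAdjoint_embed, smul_smul, inv_mul_cancel₀ hr.ne', one_smul]
    refine ⟨Ψ, hh, 0, (μ * lor z F₀)⁻¹, hiso, inv_pos.2 (hr o).1, Or.inl fun p => ?_⟩
    rw [hmap, (hr p).2]
    simp [AffineMap.homothety_apply]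
  -- Here `z` represents a finite point `q` of ℝ^N, the centre of the inversion.
  · set q : Euc N := lorAdjoint τ.A ((lor z τ.w)⁻¹ • z) with hq
    have hqz : τ.embed q = (lor z τ.w)⁻¹ • z := by
      refine τ.embed_lorAdjoint ?_ ?_
      · rw [lor_smul_left, lor_smul_right, hzz, mul_zero, mul_zero]
      · rw [lor_smul_left, inv_mul_cancel₀ hw]
    have hzq : z = lor z τ.w • τ.embed q := by
      rw [hqz, smul_smul, mul_inv_cancel₀ hw, one_smul]
    -- The correction by `q` makes `T` vanish on `z` and preserve the scalar product on the
    -- complement of `z`.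
    let T : Mink (N + 1) →L[ℝ] Euc N :=
      lorAdjoint τ.A - (lorForm (N + 1) τ.w).smulRight q
    have hTa : ∀ Z, T Z = lorAdjoint τ.A Z - lor Z τ.w • q := fun Z => by
      rw [lor_comm]; rfl
    have hZq : ∀ Z, lor z Z = 0 →
        inner ℝ (lorAdjoint τ.A Z) q = ‖q‖ ^ 2 / 2 * lor Z τ.w - lor Z τ.p₀ := by
      intro Z hZ
      rw [hzq, lor_smul_left, mul_eq_zero, or_iff_right hw, lor_comm, ConeTriple.embed,
        lor_sub_right, lor_add_right, lor_smul_right, ← inner_lorAdjoint] at hZ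
      linarith
    -- Since ⟨z, F⟩ is constant and F = r E(f), the distance formula makes r ‖f - q‖² constant. As T
    -- F = r (f - q), the inverted vector (f - q) / ‖f - q‖² is a constant multiple of T F.
    have hfp : ∀ p : ∀ i, M i, 0 < -(lor z τ.w / (2 * lor z F₀)) ∧ f p ≠ q ∧
        EuclideanGeometry.inversion q 1 (f p) =
          -(lor z τ.w / (2 * lor z F₀)) • T (F₀ + ∑ i, G i (p i)) + q := by
      intro p
      obtain ⟨r, hr, hrF⟩ := h.lift p
      have h1 : lor z τ.w * r * ‖f p - q‖ ^ 2 = -(2 * lor z F₀) := by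
        have h2 := hzF p
        rw [hrF] at h2
        conv_lhs at h2 => rw [hzq]
        rw [lor_smul_left, lor_smul_right, τ.lor_embed_embed, norm_sub_rev] at h2
        linarith
      have hfq : f p ≠ q := by
        intro h0
        rw [h0, sub_self, norm_zero] at h1
        apply hκ
        linarith
      have hpos : 0 < ‖f p - q‖ := norm_pos_iff.2 (sub_ne_zero.2 hfq)
      have h3 : -(lor z τ.w / (2 * lor z F₀)) = (r * ‖f p - q‖ ^ 2)⁻¹ := by
        have h4 : 2 * lor z F₀ = -(lor z τ.w * (r * ‖f p - q‖ ^ 2)) := by linarith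
        rw [h4]
        field_simp
      refine ⟨by rw [h3]; positivity, hfq, ?_⟩
      rw [h3, EuclideanGeometry.inversion, hrF, hTa, map_smul, τ.lorAdjoint_embed, lor_smul_left,
        τ.lor_embed_w, mul_one, ← smul_sub, smul_smul, dist_eq_norm]
      simp only [vsub_eq_sub, vadd_eq_add]
      congr 2
      field_simp
    set ρ := -(lor z τ.w / (2 * lor z F₀)) with hρ
    -- The translation by ρ⁻¹ q becomes the summand `q` of the inversion after the homothety with
    -- centre 0 and ratio ρ.
    obtain ⟨Ψ, hh, hiso, hmap⟩ := h.exists_flat hzG T (fun Z Z' hZ hZ' => by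
      rw [τ.lor_eq_of_decomp Z Z', hTa, hTa, inner_sub_left, inner_sub_right, inner_sub_right,
        inner_smul_left, inner_smul_right, inner_smul_left, inner_smul_right,
        real_inner_comm (lorAdjoint τ.A Z') q, hZq Z hZ, hZq Z' hZ', real_inner_self_eq_norm_sq]
      simp only [conj_trivial]
      ring) (ρ⁻¹ • q)
    have hρ0 := (hfp o).1
    refine ⟨Ψ, hh, 0, ρ, hiso, hρ0, Or.inr ⟨q, fun p => ?_⟩⟩
    have h1 : AffineMap.homothety (0 : Euc N) ρ (Ψ.map fun i => hh i (p i)) =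
        EuclideanGeometry.inversion q 1 (f p) := by
      rw [(hfp p).2.2, hmap]
      simp [AffineMap.homothety_apply, smul_smul, mul_inv_cancel₀ hρ0.ne']
    rw [h1]
    exact ⟨fun h0 => (hfp p).2.1 ((EuclideanGeometry.inversion_eq_center one_ne_zero).1 h0),
      (EuclideanGeometry.inversion_inversion q one_ne_zero (f p)).symm⟩

end IsSplitLift
end Cases

/-! ### The hyperbolic case -/

section Theta

variable {k N : ℕ} {n : Fin k → ℕ} {M : Fin k → Type*} [∀ i, TopologicalSpace (M i)]
  [∀ i, ChartedSpace (Euc (n i)) (M i)] [∀ i, IsManifold (𝓡 (n i)) ∞ (M i)]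
  {τ : ConeTriple N} {g : ∀ i, RiemMetric (n i) (M i)} {f : (∀ i, M i) → Euc N}
  {F₀ : Mink (N + 1)} {G : ∀ i, M i → Mink (N + 1)} {o : ∀ i, M i}

theorem snd_ne_zero_of_timelike {m : ℕ} {X : Mink m} (hX : lor X X < 0) : X.2 ≠ 0 := by
  intro h
  rw [lor_eq, h, real_inner_self_eq_norm_sq] at hX
  nlinarith [sq_nonneg ‖X.1‖]

/-- A nowhere vanishing continuous function on a connected space has constant sign. -/
theorem forall_pos_or_forall_neg {X : Type*} [TopologicalSpace X] [PreconnectedSpace X]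
    {s : X → ℝ} (hs : Continuous s) (h0 : ∀ x, s x ≠ 0) : (∀ x, 0 < s x) ∨ ∀ x, s x < 0 := by
  by_contra hcon
  push Not at hcon
  obtain ⟨⟨x, hx⟩, y, hy⟩ := hcon
  obtain ⟨z, hz⟩ := mem_range_of_exists_le_of_exists_ge hs ⟨x, hx⟩ ⟨y, hy⟩
  exact h0 z hz

namespace IsSplitLift

/-- If the span of `G j` is time-like, `f` comes from a product with a hyperbolic factor. -/
theorem caseTheta [∀ i, ConnectedSpace (M i)] (h : IsSplitLift τ g f F₀ G o) (hk : 2 ≤ k)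
    (hn : ∀ i, 1 ≤ n i) {j : Fin k} {v : Mink (N + 1)}
    (hv : v ∈ Submodule.span ℝ (Set.range (G j))) (hvv : lor v v < 0) : CaseTheta g f j := by
  obtain ⟨m, l', C, T, D, hC, hD, hCD, hCr, hDr, hdec, hml⟩ := exists_decomp_of_timelike _ hv hvv
  have hDT : ∀ Z ∈ Submodule.span ℝ (Set.range (G j)), lorAdjoint D Z = 0 := fun Z hZ =>
    lorAdjoint_eq_zero fun x => by
      rw [lor_comm]
      have : D x ∈ lorOrth (Submodule.span ℝ (Set.range (G j))) := by rw [← hDr]; exact ⟨x, rfl⟩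
      exact this Z hZ
  have hCT : ∀ x, C (T (G j x)) = G j x := fun x => by
    conv_rhs => rw [hdec (G j x), hDT _ (mem_span j x), map_zero, add_zero]
  have hDG : ∀ i, i ≠ j → ∀ x, D (lorAdjoint D (G i x)) = G i x := fun i hi x =>
    apply_lorAdjoint_of_mem hD (by
      rw [hDr]
      exact fun y hy => h.orth_span hi (mem_span i x) hy)
  -- The component of the lift in the complement of the span of `G j`, which only the other factors
  -- move.
  let S : (∀ i, M i) → Euc l' := fun p =>
    ∑ i : {i // i ≠ j}, (lorAdjoint D (G i (p i)) + 0) + lorAdjoint D F₀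
  have hF : ∀ p : ∀ i, M i, F₀ + ∑ i, G i (p i) = C (T (G j (p j)) + T F₀) + D (S p) := by
    intro p
    have h1 : ∑ i : {i // i ≠ j}, D (lorAdjoint D (G i (p i))) =
        ∑ i : {i // i ≠ j}, G i (p i) := Finset.sum_congr rfl fun i _ => hDG i i.2 _
    rw [Fintype.sum_eq_add_sum_subtype_ne _ j]
    simp only [S, map_add, map_sum, add_zero, hCT, h1]
    conv_lhs => rw [hdec F₀]
    abel
  have hnull : ∀ p : ∀ i, M i,
      lor (T (G j (p j)) + T F₀) (T (G j (p j)) + T F₀) + inner ℝ (S p) (S p) = 0 := by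
    intro p
    have h1 := h.lor_self p
    rw [hF p, lor_add_left, lor_add_right, lor_add_right, hC, hD, lor_comm (D _), hCD] at h1
    linarith
  have hSup : ∀ p x, S (Function.update p j x) = S p := by
    intro p x
    simp only [S]
    congr 1
    refine Finset.sum_congr rfl fun i _ => ?_
    rw [Function.update_of_ne i.2]
  -- The squared lengths of the two parts add up to zero and depend on disjoint sets of coordinates,
  -- so both are constant.
  obtain ⟨κ, hκ⟩ : ∃ κ, κ = inner ℝ (S o) (S o) := ⟨_, rfl⟩
  have hhj : ∀ q, lor (T (G j q) + T F₀) (T (G j q) + T F₀) = -κ := by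
    intro q
    have h1 := hnull (Function.update o j q)
    rw [hSup, Function.update_self] at h1
    linarith
  have hS : ∀ p, inner ℝ (S p) (S p) = κ := by
    intro p
    have h1 := hnull p
    rw [hhj] at h1
    linarith
  have hne : ∀ i, Nonempty (M i) := fun i => ⟨o i⟩
  obtain ⟨Ψ, hh, hΨ, hiso, hmap⟩ := exists_spherical_extrinsicProduct
    (ι := {i : Fin k // i ≠ j}) (n := fun i => n i) (M := fun i => M i) (g := fun i => g i)
    (H := fun i x => lorAdjoint D (G i x) + 0) (fun i => hn i)
    (fun i => isIsometricImmersion_clm_add (h.isom i).1 (h.isom i).chartDeriv_eq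
      (LinearMap.toContinuousLinearMap D) hD (lorAdjoint D) (hDG i i.2) 0)
    (fun i i' hii x y => by
      simp only [add_zero]
      rw [← hD, hDG i i.2, hDG i' i'.2, h.orth i i' (fun h0 => hii (Subtype.ext h0))])
    (lorAdjoint D F₀) (c := 1 / κ) (fun p => by
      change inner ℝ _ _ = 1 / (1 / κ)
      rw [one_div_one_div]
      -- A point of the product of the other factors is completed by `o j`.
      have h1 := hS (fun i => if hi : i ≠ j then p ⟨i, hi⟩ else o i)
      have h2 : S (fun i => if hi : i ≠ j then p ⟨i, hi⟩ else o i) =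
          ∑ i : {i // i ≠ j}, (lorAdjoint D (G i (p i)) + 0) + lorAdjoint D F₀ := by
        simp only [S]
        congr 1
        refine Finset.sum_congr rfl fun i _ => ?_
        rw [dif_pos i.2]
      rw [h2] at h1
      exact h1)
  obtain ⟨i₁, hi₁⟩ : ∃ i : Fin k, i ≠ j := by
    have : Nontrivial (Fin k) := Fin.nontrivial_iff_two_le.2 hk
    exact exists_ne j
  -- There is a factor besides `j` because k ≥ 2, and its sphere has positive radius.
  have hκ0 : 0 < κ := by
    obtain ⟨-, c', hc', hN⟩ := hΨ.1 ⟨i₁, hi₁⟩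
    have h1 := (hiso ⟨i₁, hi₁⟩).2 (o i₁)
    rw [hN] at h1
    change inner ℝ _ _ = 1 / c' at h1
    have h2 : S o = Ψ.map (fun i => hh i (o i)) := (hmap fun i => o i).symm
    have h3 := hS o
    rw [h2, Ψ.inner_map_self] at h3
    have h4 : inner ℝ (hh ⟨i₁, hi₁⟩ (o i₁)) (hh ⟨i₁, hi₁⟩ (o i₁)) ≤
        ∑ i : {i // i ≠ j}, inner ℝ (hh i (o i)) (hh i (o i)) :=
      Finset.single_le_sum (f := fun i : {i // i ≠ j} => inner ℝ (hh i (o i)) (hh i (o i)))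
        (fun i _ => real_inner_self_nonneg) (Finset.mem_univ (⟨i₁, hi₁⟩ : {i // i ≠ j}))
    have h5 : 0 < 1 / c' := one_div_pos.2 hc'
    have h6 : (0 : ℝ) ≤ inner ℝ Ψ.v Ψ.v := real_inner_self_nonneg
    linarith
  have hl2 : 2 ≤ l' := by
    have h1 := LinearMap.finrank_le_finrank_of_injective (f := (Ψ.L ⟨i₁, hi₁⟩).toLinearMap)
      (Ψ.L ⟨i₁, hi₁⟩).injective
    have h2 := (hΨ.1 ⟨i₁, hi₁⟩).1
    simp at h1
    omega
  obtain ⟨l, rfl⟩ : ∃ l, l' = l + 1 := ⟨l' - 1, by omega⟩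
  -- Formulated for arbitrary `C` and `T`, since the hyperbolic part may lie on the lower sheet;
  -- then `-C` and `-T` are used.
  have key : ∀ (C : Mink m →ₗ[ℝ] Mink (N + 1)) (T : Mink (N + 1) →L[ℝ] Mink m),
      (∀ X Y, lor (C X) (C Y) = lor X Y) → (∀ X y, lor (C X) (D y) = 0) →
      (∀ x, C (T (G j x)) = G j x) →
      (∀ p : ∀ i, M i, F₀ + ∑ i, G i (p i) = C (T (G j (p j)) + T F₀) + D (S p)) →
      (∀ q, lor (T (G j q) + T F₀) (T (G j q) + T F₀) = -κ) →
      (∀ q, 0 < (T (G j q) + T F₀).2) → CaseTheta g f j := by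
    intro C T hC hCD hCT hF hhj hsign
    have hisoj : IsIsometricImmersion (g j) lor fun x => T (G j x) + T F₀ :=
      isIsometricImmersion_clm_add (h.isom j).1 (h.isom j).chartDeriv_eq
        (LinearMap.toContinuousLinearMap C) hC T hCT (T F₀)
    -- For m = 0 the Lorentz space is negative definite and has no space-like tangent vectors.
    have hm1 : 1 ≤ m := by
      obtain ⟨X, hX⟩ := hisoj.exists_chartDeriv (hn j) (o j)
      by_contra hm
      have hm0 : m = 0 := by omega
      subst hm0
      have h0 : ∀ Y : Mink 0, lor Y Y ≤ 0 := fun Y => by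
        rw [lor_eq, Subsingleton.elim Y.1 0, inner_zero_left]
        nlinarith [mul_self_nonneg Y.2]
      exact absurd hX (not_lt.2 (h0 _))
    refine ⟨m, l, 1 / κ, Ψ, fun x => T (G j x) + T F₀, hh,
      {Z | Z.1 ∈ hypCurv m (1 / κ) ∧ Z.2 ∈ sphereCurv (l + 1) (1 / κ) ∧
        lor (C Z.1 + D Z.2) τ.w ≠ 0},
      fun Z => lorAdjoint τ.A ((lor (C Z.1 + D Z.2) τ.w)⁻¹ • (C Z.1 + D Z.2)),
      hm1, by omega, by omega, one_div_pos.2 hκ0, hΨ, ⟨hisoj, fun q => ⟨?_, hsign q⟩⟩, hiso,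
      ⟨τ, C, D, hC, hD, hCD, rfl, ?_⟩, ?_⟩
    · rw [hhj]
      field_simp
    · rintro ⟨X, Y⟩ ⟨⟨hX, -⟩, hY, hne⟩
      refine τ.embed_lorAdjoint ?_ ?_
      · rw [lor_smul_left, lor_smul_right]
        have hY' : inner ℝ Y Y = 1 / (1 / κ) := hY
        have hX' : lor X X = -1 / (1 / κ) := hX
        have h1 : lor (C X + D Y) (C X + D Y) = 0 := by
          rw [lor_add_left, lor_add_right, lor_add_right, hC, hD, lor_comm (D _), hCD, hX', hY']
          ring
        change _ * (_ * lor (C X + D Y) (C X + D Y)) = 0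
        rw [h1, mul_zero, mul_zero]
      · rw [lor_smul_left, inv_mul_cancel₀ hne]
    · intro p
      have h1 : Ψ.map (fun i => hh i (p i)) = S p := hmap fun i => p i
      obtain ⟨r, hr, hrF⟩ := h.lift p
      have h2 : lor (C (T (G j (p j)) + T F₀) + D (S p)) τ.w = r := by
        rw [← hF p, hrF, lor_smul_left, τ.lor_embed_w, mul_one]
      rw [h1]
      refine ⟨⟨⟨?_, hsign _⟩, ?_, ?_⟩, ?_⟩
      · rw [hhj]
        field_simp
      · change inner ℝ (S p) (S p) = 1 / (1 / κ)
        rw [hS, one_div_one_div]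
      · change lor (C (T (G j (p j)) + T F₀) + D (S p)) τ.w ≠ 0
        rw [h2]; exact hr.ne'
      · change f p = lorAdjoint τ.A ((lor (C (T (G j (p j)) + T F₀) + D (S p)) τ.w)⁻¹ •
          (C (T (G j (p j)) + T F₀) + D (S p)))
        rw [h2, ← hF p, hrF, smul_smul, inv_mul_cancel₀ hr.ne', one_smul, τ.lorAdjoint_embed]
  have hcont : Continuous fun q => (T (G j q) + T F₀).2 :=
    continuous_snd.comp ((T.continuous.comp (h.isom j).1.continuous).add continuous_const)
  -- A time-like vector has nonzero time coordinate, so by connectedness of `M j` the hyperbolic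
  -- part stays on one sheet.
  rcases forall_pos_or_forall_neg hcont
    (fun q => snd_ne_zero_of_timelike (by rw [hhj]; linarith)) with hs | hs
  · exact key C T hC hCD hCT hF hhj hs
  · refine key (-C) (-T) ?_ ?_ ?_ ?_ ?_ ?_
    · intro X Y; simp [hC]
    · intro X y; simp [hCD]
    · intro x; simp [hCT]
    · intro p
      have h1 : (-C) ((-T) (G j (p j)) + (-T) F₀) = C (T (G j (p j)) + T F₀) := by
        simp only [map_add, LinearMap.neg_apply, neg_apply, map_neg, neg_neg]
      rw [hF p, h1]
    · intro q
      rw [← hhj q]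
      have : (-T) (G j q) + (-T) F₀ = -(T (G j q) + T F₀) := by
        simp only [neg_apply]; abel
      rw [this, lor_neg_left, lor_neg_right, neg_neg]
    · intro q
      have h1 := hs q
      have : (-T) (G j q) + (-T) F₀ = -(T (G j q) + T F₀) := by
        simp only [neg_apply]; abel
      rw [this]
      change 0 < -(T (G j q) + T F₀).2
      linarith

end IsSplitLift
end Theta

/-! ### Uniqueness of the hyperbolic factor -/

section Uniqueness

/-- Isometric immersions into the light cone that lift the same map to `ℝ^N` agree up to sign. -/
theorem sq_eq_of_isometric_lift {n N : ℕ} {M : Type*} [TopologicalSpace M] [ChartedSpace (Euc n) M]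
    [IsManifold (𝓡 n) ∞ M] {g : RiemMetric n M} (hn : 1 ≤ n) {τ τ' : ConeTriple N}
    {F F' : M → Mink (N + 1)} {r r' : M → ℝ} {u : M → Euc N}
    (hF : IsIsometricImmersion g lor F) (hF' : IsIsometricImmersion g lor F')
    (hr : ∀ x, F x = r x • τ.embed (u x)) (hr' : ∀ x, F' x = r' x • τ'.embed (u x))
    (hr0 : ∀ x, r x ≠ 0) (x : M) : r x ^ 2 = r' x ^ 2 := by
  have hrw : ∀ (τ : ConeTriple N) (F : M → Mink (N + 1)) (r : M → ℝ),
      (∀ x, F x = r x • τ.embed (u x)) → ∀ y, r y = lorForm (N + 1) τ.w (F y) := by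
    intro τ F r hr y
    rw [hr, lorForm_apply, lor_comm, lor_smul_left, τ.lor_embed_w, mul_one]
  have hdr : ∀ (τ : ConeTriple N) (F : M → Mink (N + 1)) (r : M → ℝ),
      IsIsometricImmersion g lor F → (∀ x, F x = r x • τ.embed (u x)) →
      DifferentiableAt ℝ (r ∘ (extChartAt (𝓡 n) x).symm) (extChartAt (𝓡 n) x x) := by
    intro τ F r hF hr
    rw [show r = fun y => lorForm (N + 1) τ.w (F y) from funext (hrw τ F r hr)]
    exact ((lorForm (N + 1) τ.w).differentiableAt).comp _
      (hasFDerivAt_chartDeriv ((hF.1 x).mdifferentiableAt (by simp))).differentiableAt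
  have hdu : DifferentiableAt ℝ (u ∘ (extChartAt (𝓡 n) x).symm) (extChartAt (𝓡 n) x x) := by
    have h1 : u = fun y => lorAdjoint τ.A ((r y)⁻¹ • F y) := by
      funext y
      rw [hr, smul_smul, inv_mul_cancel₀ (hr0 y), one_smul, τ.lorAdjoint_embed]
    rw [h1]
    exact (lorAdjoint τ.A).differentiableAt.comp _
      (((hdr τ F r hF hr).inv (hr0 _)).smul
        (hasFDerivAt_chartDeriv ((hF.1 x).mdifferentiableAt (by simp))).differentiableAt)
  -- Each lift gives r² ‖du(X)‖² = g(X, X), whatever the cone triple; `u` is differentiable because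
  -- it is recovered from `F`.
  have key : ∀ (τ : ConeTriple N) (F : M → Mink (N + 1)) (r : M → ℝ),
      IsIsometricImmersion g lor F → (∀ x, F x = r x • τ.embed (u x)) → ∀ X,
      r x ^ 2 * inner ℝ (chartDeriv n u x X) (chartDeriv n u x X) = metricAt g x X X := by
    intro τ F r hF hr X
    have h1 := τ.lor_fderiv_lift (hdr τ F r hF hr) hdu X X
    rw [← hF.chartDeriv_eq x X X]
    have h2 : (fun y => (r ∘ (extChartAt (𝓡 n) x).symm) y •
        τ.embed ((u ∘ (extChartAt (𝓡 n) x).symm) y)) = F ∘ (extChartAt (𝓡 n) x).symm :=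
      funext fun y => (hr _).symm
    rw [h2, Function.comp_apply, extChartAt_to_inv] at h1
    exact h1.symm
  obtain ⟨X, hX⟩ := exists_ne_zero_euc hn
  have h1 := key τ F r hF hr X
  have h2 := key τ' F' r' hF' hr' X
  have h3 := metricAt_pos g x hX
  have h4 : inner ℝ (chartDeriv n u x X) (chartDeriv n u x X) ≠ 0 := by
    intro h0
    rw [h0, mul_zero] at h1
    exact h3.ne h1
  exact mul_right_cancel₀ h4 (h1.trans h2.symm)

/-- An isometric immersion, composed with a linear isometry and a translation. -/
theorem IsIsometricImmersion.clm_add {n : ℕ} {M : Type*} [TopologicalSpace M]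
    [ChartedSpace (Euc n) M] [IsManifold (𝓡 n) ∞ M] {g : RiemMetric n M}
    {V W : Type*} [NormedAddCommGroup V] [NormedSpace ℝ V] [NormedAddCommGroup W]
    [NormedSpace ℝ W] {B : V → V → ℝ} {B' : W → W → ℝ} {G : M → V}
    (hG : IsIsometricImmersion g B G) (K : V →L[ℝ] W) (hK : ∀ x y, B' (K x) (K y) = B x y)
    (c : W) : IsIsometricImmersion g B' fun x => K (G x) + c := by
  refine isIsometricImmersion_of_chartDeriv (contMDiff_clm_add hG.1 K c) fun x X Y => ?_
  have hd := (hG.1 x).mdifferentiableAt (by simp)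
  rw [chartDeriv_clm_add hd, chartDeriv_clm_add hd, hK, hG.chartDeriv_eq]

/-- The reverse Cauchy-Schwarz inequality on the hyperbolic space. -/
theorem lor_le_of_mem_hypCurv {m : ℕ} {c : ℝ} (hc : 0 < c) {X Y : Mink m} (hX : X ∈ hypCurv m c)
    (hY : Y ∈ hypCurv m c) : lor X Y ≤ -1 / c := by
  obtain ⟨hX, hX0⟩ := hX
  obtain ⟨hY, hY0⟩ := hY
  rw [lor_eq, real_inner_self_eq_norm_sq] at hX hY
  rw [lor_eq]
  have h1 := real_inner_le_norm X.1 Y.1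
  obtain ⟨a, ha⟩ : ∃ a, a = 1 / c := ⟨_, rfl⟩
  have ha0 : 0 < a := by rw [ha]; exact one_div_pos.2 hc
  have ha' : -1 / c = -a := by rw [ha]; ring
  rw [ha'] at hX hY ⊢
  have h2 : ‖X.1‖ * ‖Y.1‖ + a ≤ X.2 * Y.2 := by
    refine abs_le_of_sq_le_sq' ?_ (by positivity) |>.2
    have h3 : (X.2 * Y.2) ^ 2 = (‖X.1‖ ^ 2 + a) * (‖Y.1‖ ^ 2 + a) := by
      rw [show ‖X.1‖ ^ 2 + a = X.2 * X.2 by linarith, show ‖Y.1‖ ^ 2 + a = Y.2 * Y.2 by linarith]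
      ring
    rw [h3]
    -- The difference of the two sides is a (‖X.1‖ - ‖Y.1‖)².
    nlinarith [mul_nonneg ha0.le (sq_nonneg (‖X.1‖ - ‖Y.1‖))]
  linarith

theorem inner_le_of_mem_sphereCurv {d : ℕ} {c : ℝ} {X Y : Euc d} (hX : X ∈ sphereCurv d c)
    (hY : Y ∈ sphereCurv d c) : inner ℝ X Y ≤ 1 / c := by
  have h1 : inner ℝ X X = 1 / c := hX
  have h2 : inner ℝ Y Y = 1 / c := hY
  have h3 : (0 : ℝ) ≤ inner ℝ (X - Y) (X - Y) := real_inner_self_nonneg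
  rw [inner_sub_left, inner_sub_right, inner_sub_right, real_inner_comm X Y, h1, h2] at h3
  linarith

variable {k N : ℕ} {n : Fin k → ℕ} {M : Fin k → Type*} [∀ i, TopologicalSpace (M i)]
  [∀ i, ChartedSpace (Euc (n i)) (M i)] [∀ i, IsManifold (𝓡 (n i)) ∞ (M i)]
  {τ : ConeTriple N} {g : ∀ i, RiemMetric (n i) (M i)} {f : (∀ i, M i) → Euc N}
  {F₀ : Mink (N + 1)} {G : ∀ i, M i → Mink (N + 1)} {o : ∀ i, M i}

/-- Only a factor with time-like span can be the hyperbolic factor. -/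
theorem IsSplitLift.eq_of_caseTheta (h : IsSplitLift τ g f F₀ G o) (hn : ∀ i, 1 ≤ n i)
    {j j' : Fin k} {v : Mink (N + 1)} (hv : v ∈ Submodule.span ℝ (Set.range (G j)))
    (hvv : lor v v < 0) (hθ : CaseTheta g f j') : j' = j := by
  by_contra hjj
  obtain ⟨m, l, c, Ψ, hj, h', dom, Θ, -, -, -, hc, hΨ, ⟨hjiso, hjm⟩, hiso, hΘ, hfΘ⟩ := hθ
  obtain ⟨τ', C, D, hC, hD, hCD, rfl, hE⟩ := hΘ
  let S : (∀ i, M i) → Euc (l + 1) := fun p => Ψ.map fun i => h' i (p i)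
  let F : (∀ i, M i) → Mink (N + 1) := fun p => F₀ + ∑ i, G i (p i)
  -- The second lift of `f`, read off from the given presentation with hyperbolic factor `j'`.
  let F' : (∀ i, M i) → Mink (N + 1) := fun p => C (hj (p j')) + D (S p)
  have hS : ∀ p, S p ∈ sphereCurv (l + 1) c := fun p => hΨ.2 _ fun i => (hiso i).2 _
  choose r hr hrF using h.lift
  have hσ : ∀ p, lor (F' p) τ'.w ≠ 0 := fun p => (hfΘ p).1.2.2
  have hσF : ∀ p, F' p = lor (F' p) τ'.w • τ'.embed (f p) := by
    intro p
    rw [(hfΘ p).2, hE _ (hfΘ p).1, smul_smul]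
    change F' p = (lor (F' p) τ'.w * (lor (F' p) τ'.w)⁻¹) • F' p
    rw [mul_inv_cancel₀ (hσ p), one_smul]
  have hSup : ∀ p x, S (Function.update p j' x) = S p := by
    intro p x
    simp only [S]
    congr 1
    funext i
    rw [Function.update_of_ne i.2]
  -- Restricted to the `j'`-th factor, both lifts are isometric immersions over the same map, so
  -- their factors agree up to sign.
  have hsq : ∀ p, r p ^ 2 = lor (F' p) τ'.w ^ 2 := by
    intro p
    have h1 : ∀ x, F (Function.update p j' x) = ContinuousLinearMap.id ℝ _ (G j' x) +
        (F₀ + ∑ i : {i // i ≠ j'}, G i (p i)) := by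
      intro x
      simp only [F]
      rw [Fintype.sum_eq_add_sum_subtype_ne _ j', Function.update_self]
      have h3 : ∑ i : {i // i ≠ j'}, G i (Function.update p j' x i) =
          ∑ i : {i // i ≠ j'}, G i (p i) :=
        Finset.sum_congr rfl fun i _ => by rw [Function.update_of_ne i.2]
      rw [h3, ContinuousLinearMap.id_apply]
      abel
    have h2 : ∀ x, F' (Function.update p j' x) =
        LinearMap.toContinuousLinearMap C (hj x) + D (S p) := by
      intro x
      simp only [F', hSup, Function.update_self]
      rfl
    have h3 : IsIsometricImmersion (g j') lor fun x => F (Function.update p j' x) := by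
      simp only [h1]
      exact (h.isom j').clm_add _ (fun _ _ => rfl) _
    have h4 : IsIsometricImmersion (g j') lor fun x => F' (Function.update p j' x) := by
      simp only [h2]
      exact hjiso.clm_add _ hC _
    have h5 := sq_eq_of_isometric_lift (hn j') h3 h4
      (u := fun x => f (Function.update p j' x)) (r := fun x => r (Function.update p j' x))
      (r' := fun x => lor (F' (Function.update p j' x)) τ'.w)
      (fun x => hrF _) (fun x => hσF _) (fun x => (hr _).ne') (p j')
    simpa only [Function.update_eq_self] using h5
  have hlor : ∀ p q, lor (F p) (F q) = lor (F' p) (F' q) := by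
    intro p q
    -- This settles the sign: ⟨F p, F q⟩ ≤ 0 because the factors `r` are positive, so if the factors
    -- of `F'` at `p` and `q` have opposite signs, then f p = f q and both products vanish.
    have h1 : lor (F' p) (F' q) ≤ 0 := by
      have h2 := lor_le_of_mem_hypCurv hc (hjm (p j')) (hjm (q j'))
      have h3 := inner_le_of_mem_sphereCurv (hS p) (hS q)
      simp only [F']
      rw [lor_add_left, lor_add_right, lor_add_right, hC, hD, lor_comm (D _), hCD, hCD]
      have h4 : -1 / c + 1 / c = 0 := by ring
      linarith
    have h2 : lor (F' p) (F' q) =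
        lor (F' p) τ'.w * (lor (F' q) τ'.w * -(‖f p - f q‖ ^ 2 / 2)) := by
      conv_lhs => rw [hσF p, hσF q, lor_smul_left, lor_smul_right, τ'.lor_embed_embed]
    have h3 : lor (F p) (F q) = r p * (r q * -(‖f p - f q‖ ^ 2 / 2)) := by
      simp only [F]
      rw [hrF p, hrF q, lor_smul_left, lor_smul_right, τ.lor_embed_embed]
    have h4 : (r p * r q) ^ 2 = (lor (F' p) τ'.w * lor (F' q) τ'.w) ^ 2 := by
      rw [mul_pow, mul_pow, hsq, hsq]
    rw [h2] at h1 ⊢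
    rw [h3]
    rcases sq_eq_sq_iff_eq_or_eq_neg.1 h4 with h5 | h5
    · rw [← mul_assoc, h5, mul_assoc]
    · have h6 := mul_pos (hr p) (hr q)
      have h7 : ‖f p - f q‖ ^ 2 / 2 = 0 := by
        have := sq_nonneg ‖f p - f q‖
        nlinarith
      rw [h7]
      ring
  obtain ⟨a, rfl⟩ := Finsupp.mem_span_range_iff_exists_finsupp.1 hv
  have hG : ∀ x, G j x = F (Function.update o j x) - F o := by
    intro x
    have h1 : ∀ p : ∀ i, M i, (∀ i : {i // i ≠ j}, p i = o i) → F p = F₀ + G j (p j) := by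
      intro p hp
      simp only [F]
      rw [Fintype.sum_eq_add_sum_subtype_ne _ j, Finset.sum_eq_zero, add_zero]
      intro i _
      rw [hp i, h.base]
    rw [h1 _ fun i => Function.update_of_ne i.2 _ _, h1 o fun _ => rfl, Function.update_self,
      h.base]
    abel
  -- As j ≠ j', moving the `j`-th coordinate leaves the hyperbolic part of `F'` fixed.
  have hG' : ∀ x, F' (Function.update o j x) - F' o = D (S (Function.update o j x) - S o) := by
    intro x
    simp only [F']
    rw [Function.update_of_ne hjj, map_sub]
    abel
  have h1 : ∀ x y, lor (G j x) (G j y) =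
      inner ℝ (S (Function.update o j x) - S o) (S (Function.update o j y) - S o) := by
    intro x y
    rw [← hD, ← hG', ← hG', hG, hG]
    simp only [lor_sub_left, lor_sub_right, hlor]
  -- The Gram matrix of `G j` is that of Euclidean vectors, so every vector of its span has
  -- nonnegative square, against `hvv`.
  have h2 : lor (a.sum fun x t => t • G j x) (a.sum fun x t => t • G j x) =
      inner ℝ (a.sum fun x t => t • (S (Function.update o j x) - S o))
        (a.sum fun x t => t • (S (Function.update o j x) - S o)) := by
    simp only [Finsupp.sum, lor_sum_left, lor_sum_right, lor_smul_left, lor_smul_right, sum_inner,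
      inner_sum, inner_smul_left, inner_smul_right, h1, RCLike.conj_to_real]
  rw [h2] at hvv
  exact absurd hvv (not_lt.2 real_inner_self_nonneg)

end Uniqueness

end

/-! ### The classification -/

theorem theorem4p1 {k N : ℕ} (hk : 2 ≤ k) (n : Fin k → ℕ) (hn : ∀ i, 1 ≤ n i)
    (hn3 : 3 ≤ ∑ i, n i) (M : Fin k → Type*) [∀ i, TopologicalSpace (M i)]
    [∀ i, T2Space (M i)] [∀ i, SecondCountableTopology (M i)] [∀ i, ConnectedSpace (M i)]
    [∀ i, ChartedSpace (Euc (n i)) (M i)] [∀ i, IsManifold (𝓡 (n i)) ∞ (M i)]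
    (g : ∀ i, RiemMetric (n i) (M i)) (f : (∀ i, M i) → Euc N)
    (hf : IsConformalImmersion g f) (hadapted : IsAdaptedToProductNet n f) :
    (CaseSphere g f ∨ CaseFlat g f) ∨ ∃! j, CaseTheta g f j := by
  obtain ⟨τ⟩ := nonempty_coneTriple N
  have o : ∀ i, M i := fun i => Classical.arbitrary (M i)
  obtain ⟨F₀, G, h⟩ := exists_isSplitLift τ hn hn3 hf hadapted o
  -- The three cases are separated by the signature of the spans: a time-like vector in one of them,
  -- otherwise a nonzero light-like one, otherwise all are positive definite.
  by_cases hT : ∃ j, ∃ v ∈ Submodule.span ℝ (Set.range (G j)), lor v v < 0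
  · obtain ⟨j, v, hv, hvv⟩ := hT
    exact Or.inr ⟨j, h.caseTheta hk hn hv hvv, fun j' hj' => h.eq_of_caseTheta hn hv hvv hj'⟩
  push Not at hT
  by_cases hD : ∃ j, ∃ z ∈ Submodule.span ℝ (Set.range (G j)), z ≠ 0 ∧ lor z z = 0
  · obtain ⟨j, z, hz, hz0, hzz⟩ := hD
    exact Or.inl (Or.inr (h.caseFlat hn hT hz hz0 hzz))
  push Not at hD
  exact Or.inl (Or.inl (h.caseSphere hn ⟨0, by omega⟩ fun i x hx hx0 =>
    (hT i x hx).lt_of_ne (hD i x hx hx0).symm))
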